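/- Let $V$ be a finite set with $|V|=n$ and let $P=(P_{vu})_{v,u\in V}$ be a (row-)stochastic matrix. Give each vertex $v\in V$ a Poisson clock of rate $1$, the clocks being independent, and consider the asynchronous DeGroot dynamics $(f_t(v))_{t\ge 0,\,v\in V}$ associated with $P$: starting from initial opinions $f_0$, whenever the clock of $v$ rings at a time $t$, the opinion of $v$ is replaced by $$f_t(v)=\sum_{u\in V}P_{vu}\,f_{t-}(u),$$ and opinions do not change otherwise. For $\varepsilon>0$ let $$\tau_\varepsilon=\min\Big\{t\ge 0:\ \max_{v\in V}f_t(v)-\min_{v\in V}f_t(v)\le\varepsilon\Big\}$$ (with $\tau_\varepsilon=\infty$ if there is no such $t$) be the $\varepsilon$-consensus time. **Theorem.** There are universal constants $C,c>0$ such that for every $C_0>0$ there is $n_0=n_0(C_0)$ with the following property. Let $n=|V|\ge n_0$, and suppose that - $P^k_{uv}\le C_0\,k^{-1/2}$ for all $u,v\in V$ and all integers $1\le k\le |V|^2$, and - the initial opinions $(f_0(v))_{v\in V}$ are i.i.d. random variables with values in $[0,1]$ and mean $\mu$, independent of the Poisson clocks. Then for every $\varepsilon\ge n^{-c}$, $$\mathbb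 P\big(\tau_\varepsilon\ge(\varepsilon^{-1}\log n)^C\big)\le e^{-(\log n)^2}.$$ -/

import Mathlib

open MeasureTheory ProbabilityTheory Filter Topology
open scoped NNReal ENNReal

namespace DeGroot

/-! ### Poisson clocks -/

/-- A Poisson process of rate `1`, identified with its counting function: `N t ω` is the number of
rings in `[0, t]`. Almost surely the path starts at `0`, is nondecreasing and right-continuous;
the increments are independent, and the increment over `(s, t]` is Poisson of parameter `t - s`. -/
structure IsUnitPoissonProcess {Ω : Type*} [MeasurableSpace Ω] (N : ℝ≥0 → Ω → ℕ)
    (μ : Measure Ω) : Prop where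
  measurable : ∀ t, Measurable (N t)
  zero : ∀ᵐ ω ∂μ, N 0 ω = 0
  mono : ∀ᵐ ω ∂μ, Monotone fun t => N t ω
  rightCont : ∀ᵐ ω ∂μ, ∀ t, ContinuousWithinAt (fun s => N s ω) (Set.Ici t) t
  indepIncrements : HasIndepIncrements N μ
  law : ∀ s t, s ≤ t → μ.map (fun ω => N t ω - N s ω) = poissonMeasure (t - s)

/-- The clock with counting function `N` rings at time `t > 0` when `N` jumps at `t`.
For a nondecreasing `ℕ`-valued function this says `N (t-) < N t`. -/
def Rings (N : ℝ≥0 → ℕ) (t : ℝ≥0) : Prop :=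
  0 < t ∧ ∀ s < t, N s < N t

/-- The times in `[0, t]` at which at least one of the clocks rings. -/
def ringTimes {V : Type*} (N : V → ℝ≥0 → ℕ) (t : ℝ≥0) : Set ℝ≥0 :=
  {s | s ≤ t ∧ ∃ v, Rings (N v) s}

/-! ### The asynchronous DeGroot dynamics for given clock paths -/

open Classical in
/-- The update at the ring time `s`, applied to the opinions `g` held just before `s`: every vertex
whose clock rings at `s` adopts its `P`-weighted average of `g`. -/
noncomputable def update {V : Type*} [Fintype V] (P : Matrix V V ℝ) (N : V → ℝ≥0 → ℕ)
    (g : V → ℝ) (s : ℝ≥0) : V → ℝ :=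
  fun v => if Rings (N v) s then ∑ u, P v u * g u else g v

open Classical in
/-- The ring times in `[0, t]` in increasing order. (There are finitely many of them whenever the
counting functions are nondecreasing, see `finite_ringTimes`.) -/
noncomputable def ringList {V : Type*} (N : V → ℝ≥0 → ℕ) (t : ℝ≥0) : List ℝ≥0 :=
  if h : (ringTimes N t).Finite then h.toFinset.sort (· ≤ ·) else []

/-- The opinions `f_t` at time `t` of the asynchronous DeGroot dynamics with weights `P`, clocks `N`
and initial opinions `f₀`: starting from `f₀`, apply the updates of all ring times in `[0, t]` in
chronological order. See `opinion_zero`, `opinion_of_rings` and `opinion_eq_of_not_rings`. -/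
noncomputable def opinion {V : Type*} [Fintype V] (P : Matrix V V ℝ) (N : V → ℝ≥0 → ℕ)
    (f₀ : V → ℝ) (t : ℝ≥0) : V → ℝ :=
  (ringList N t).foldl (update P N) f₀

section Facts

variable {V : Type*} [Fintype V] {P : Matrix V V ℝ} {N : V → ℝ≥0 → ℕ} {f₀ : V → ℝ}

theorem finite_ringTimes (hN : ∀ v, Monotone (N v)) (t : ℝ≥0) : (ringTimes N t).Finite := by
  have key : ringTimes N t ⊆ ⋃ v, {s | s ≤ t ∧ Rings (N v) s} := by
    rintro s ⟨hs, v, hv⟩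
    exact Set.mem_iUnion.2 ⟨v, hs, hv⟩
  refine (Set.finite_iUnion fun v => ?_).subset key
  refine Set.Finite.of_finite_image (f := N v) ((Set.finite_Iic (N v t)).subset ?_) ?_
  · rintro _ ⟨s, ⟨hs, -⟩, rfl⟩
    exact hN v hs
  · rintro a ⟨-, ha⟩ b ⟨-, hb⟩ hab
    rcases lt_trichotomy a b with h | h | h
    · exact absurd hab (hb.2 a h).ne
    · exact h
    · exact absurd hab (ha.2 b h).ne'

theorem mem_ringList (hN : ∀ v, Monotone (N v)) {s t : ℝ≥0} :
    s ∈ ringList N t ↔ s ∈ ringTimes N t := by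
  simp [ringList, finite_ringTimes hN t]

theorem pairwise_ringList {V : Type*} {N : V → ℝ≥0 → ℕ} (t : ℝ≥0) :
    (ringList N t).Pairwise (· < ·) := by
  unfold ringList
  split_ifs with h
  · exact (Finset.sortedLT_sort _).pairwise
  · exact List.Pairwise.nil

theorem ringList_eq_append (hN : ∀ v, Monotone (N v)) {s t : ℝ≥0} (hst : s ≤ t) {l : List ℝ≥0}
    (hl : l.Pairwise (· < ·)) (hmem : ∀ r, r ∈ l ↔ s < r ∧ r ∈ ringTimes N t) :
    ringList N t = ringList N s ++ l := by
  have h1 : (ringList N s ++ l).Pairwise (· < ·) := by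
    refine List.pairwise_append.2 ⟨pairwise_ringList s, hl, fun a ha b hb => ?_⟩
    exact lt_of_le_of_lt ((mem_ringList hN).1 ha).1 ((hmem b).1 hb).1
  refine List.Perm.eq_of_pairwise' (pairwise_ringList t) h1 ?_
  refine (List.perm_ext_iff_of_nodup ((pairwise_ringList t).imp ne_of_lt)
    (h1.imp ne_of_lt)).2 fun r => ?_
  rw [List.mem_append, mem_ringList hN, mem_ringList hN, hmem]
  constructor
  · intro hr
    rcases le_or_gt r s with h | h
    · exact Or.inl ⟨h, hr.2⟩
    · exact Or.inr ⟨h, hr⟩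
  · rintro (hr | hr)
    · exact ⟨hr.1.trans hst, hr.2⟩
    · exact hr.2

/-- At time `0` the opinions are the initial ones. -/
theorem opinion_zero : opinion P N f₀ 0 = f₀ := by
  have : ringTimes N 0 = ∅ := by
    ext s
    simp only [ringTimes, Set.mem_ofPred_eq, Set.mem_empty_iff_false, iff_false]
    rintro ⟨hs, v, hv, -⟩
    exact absurd hs hv.not_ge
  simp [opinion, ringList, this]

/-- An opinion does not change while the clock of its vertex does not ring. -/
theorem opinion_eq_of_not_rings (hN : ∀ v, Monotone (N v)) {s t : ℝ≥0} (hst : s ≤ t) {v : V}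
    (hv : ∀ r, s < r → r ≤ t → ¬ Rings (N v) r) :
    opinion P N f₀ t v = opinion P N f₀ s v := by
  classical
  have hl := ringList_eq_append hN hst (l := (ringList N t).filter (s < ·))
    ((pairwise_ringList t).filter _) (fun r => by simp [mem_ringList hN, and_comm])
  have aux : ∀ (l : List ℝ≥0) (g : V → ℝ), (∀ r ∈ l, ¬ Rings (N v) r) →
      l.foldl (update P N) g v = g v := by
    intro l
    induction l with
    | nil => intro g _; rfl
    | cons a l ih =>
      intro g h
      rw [List.foldl_cons, ih _ fun r hr => h r (List.mem_cons_of_mem _ hr)]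
      simp [update, h a]
  unfold opinion
  rw [hl, List.foldl_append]
  refine aux _ _ fun r hr => ?_
  simp only [List.mem_filter, decide_eq_true_eq, mem_ringList hN] at hr
  exact hv r hr.2 hr.1.1

/-- The updating rule: when the clock of `v` rings at time `t`, the new opinion of `v` is the
`P`-weighted average of the left limits at `t` of the opinions. -/
theorem opinion_of_rings (hN : ∀ v, Monotone (N v)) {t : ℝ≥0} {v : V} (hv : Rings (N v) t) :
    opinion P N f₀ t v
      = ∑ u, P v u * Function.leftLim (fun s => opinion P N f₀ s u) t := by
  obtain ⟨s, hst, hs⟩ : ∃ s < t, ∀ r, s < r → r < t → ¬ ∃ u, Rings (N u) r := by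
    have hfin : (insert 0 (ringTimes N t ∩ Set.Iio t)).Finite :=
      ((finite_ringTimes hN t).inter_of_left _).insert 0
    obtain ⟨s, hs, hmax⟩ := hfin.exists_maximalFor id _ ⟨0, Set.mem_insert _ _⟩
    have hst : s < t := by
      rcases hs with rfl | hs
      · exact hv.1
      · exact hs.2
    refine ⟨s, hst, fun r hsr hrt hr => ?_⟩
    exact absurd (hmax (j := r) (Set.mem_insert_of_mem _ ⟨⟨hrt.le, hr⟩, hrt⟩) hsr.le) hsr.not_ge
  have hlim : ∀ u, Function.leftLim (fun r => opinion P N f₀ r u) t = opinion P N f₀ s u := by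
    intro u
    have : (𝓝[<] t).NeBot := nhdsLT_neBot_of_exists_lt ⟨s, hst⟩
    refine leftLim_eq_of_tendsto (tendsto_const_nhds.congr' ?_)
    filter_upwards [Ioo_mem_nhdsLT hst] with r hr
    exact (opinion_eq_of_not_rings hN hr.1.le fun q hq hqr hq' =>
      hs q hq (lt_of_le_of_lt hqr hr.2) ⟨u, hq'⟩).symm
  simp only [hlim]
  have hl := ringList_eq_append hN hst.le (l := [t]) (List.pairwise_singleton _ _) (fun r => by
    rw [List.mem_singleton]
    constructor
    · rintro rfl
      exact ⟨hst, le_rfl, v, hv⟩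
    · rintro ⟨h1, h2, h3⟩
      by_contra hne
      exact hs r h1 (lt_of_le_of_ne h2 hne) h3)
  have h2 : opinion P N f₀ t = update P N (opinion P N f₀ s) t := by
    simp [opinion, hl]
  rw [h2, update, if_pos hv]

end Facts

/-! ### Consensus time -/

/-- The oscillation `max f - min f` of a function on a finite nonempty set. -/
noncomputable def osc {V : Type*} (f : V → ℝ) : ℝ :=
  (⨆ v, f v) - ⨅ v, f v

/-- The `ε`-consensus time `min {t ≥ 0 : osc (f t) ≤ ε}` of a trajectory `f`; it is `∞` if the
oscillation never drops to `ε`. -/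
noncomputable def consensusTime {V : Type*} (f : ℝ≥0 → V → ℝ) (ε : ℝ) : ℝ≥0∞ :=
  ⨅ (t : ℝ≥0) (_ : osc (f t) ≤ ε), (t : ℝ≥0∞)

/-! ### Assumptions -/

/-- Square root decay of the transition probabilities, with constant `C₀`, up to time `|V|²`. -/
def SqrtDecay {V : Type*} [Fintype V] [DecidableEq V] (P : Matrix V V ℝ) (C₀ : ℝ) : Prop :=
  ∀ k : ℕ, 1 ≤ k → k ≤ Fintype.card V ^ 2 → ∀ u v, (P ^ k) u v ≤ C₀ * (k : ℝ) ^ (-(1 / 2) : ℝ)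

/-- The initial opinions are i.i.d. random variables with values in `[0, 1]` and expectation `m`. -/
structure IsIIDOpinions {V Ω : Type*} [MeasurableSpace Ω] (f₀ : V → Ω → ℝ) (m : ℝ)
    (μ : Measure Ω) : Prop where
  indep : iIndepFun f₀ μ
  identDistrib : ∀ u v, IdentDistrib (f₀ u) (f₀ v) μ μ
  mem_Icc : ∀ v, ∀ᵐ ω ∂μ, f₀ v ω ∈ Set.Icc (0 : ℝ) 1
  mean : ∀ v, ∫ ω, f₀ v ω ∂μ = m

/-- Independent rate-`1` Poisson clocks, one at each vertex, which are jointly independent of the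
initial opinions. -/
structure IsClockFamily {V Ω : Type*} [MeasurableSpace Ω] (N : V → ℝ≥0 → Ω → ℕ)
    (f₀ : V → Ω → ℝ) (μ : Measure Ω) : Prop where
  poisson : ∀ v, IsUnitPoissonProcess (N v) μ
  indep : iIndepFun (fun v ω t => N v t ω) μ
  indep_initial : IndepFun (fun ω v t => N v t ω) (fun ω v => f₀ v ω) μ

end DeGroot

/-! Cut time into intervals so short that, with high probability, each contains at most one ring.
Then the opinion of `v` at a late time is `(e_v ᵥ* L) ⬝ᵥ f₀`, where `e_v` is the unit vector at `v`
and `L = listMat P l` is a product of independent single-row updates with mean `lazyMat P p`. Read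
backwards in time, `e_v ᵥ* L` is a random probability vector: the unit mass of `v` fragments and is
carried along rows of `P`. It must be shown that the average of `f₀` against this vector is close to
the mean opinion.

For a probability vector `ν` and `w_m = ν ᵥ* lazyMat P p ^ m`, the process `w_{J-j} ⬝ᵥ f_j` is a
martingale. If all `w_m` are bounded by `η`, its quadratic variation is at most `η` times the
accumulated `jumpEnergy`, the mean squared jump at the position of a lazy walk. Everything therefore
rests on bounding the total expected `jumpEnergy` by a constant independent of `ν`, of the time and
of the mesh (`IsSetup.sum_jumpEnergy_le`).

The mean square `∑ w f²` decreases at the rate of the local variance, but a vertex with an almost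
deterministic row may jump with hardly any local variance. The decay hypothesis makes the entries of
some power `P ^ K` smaller than `1/2`, so there is no chain of `K` almost deterministic transitions
(`following_pow_eq_zero`): every position of the walk has a branching less than `K` generations
back. Just below a branching, a jump tends to increase the squared distance between two siblings;
further down, it tends to increase the squared distance between child and parent. Subtracting these
pair energies with geometrically decreasing coefficients from the mean square gives `lyap`, which
decreases at the rate of `jumpEnergy` (`lyap_drift`).

There are two consequences. Adding a multiple of `lyap` in the exponent absorbs the quadratic
variation and gives Gaussian concentration of averages against spread out vectors
(`IsSetup.expec_exp_le`). Second moments tested on random signs show that from any probability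
vector a block of polynomial length produces a spread out vector with probability at least one half
(`IsSetup.expec_not_isSpread_le`). With order `(log n)²` blocks, failure to spread has probability
below `exp (-(log n)²)` by a margin (`IsSetup.expec_devProb_le`). Once the vector is spread,
concentration and Hoeffding's inequality for `f₀` apply. The bounds do not depend on the mesh, which
tends to zero; a union bound over the vertices concludes. -/

namespace DeGroot

open Matrix

/-! ### Random sequences of single-vertex updates -/

section Discrete

set_option linter.unusedSectionVars false

variable {V : Type*} [Fintype V] [DecidableEq V]

/-- Weights on `Option V`: each vertex rings with weight `p`, and nothing happens otherwise. -/
noncomputable def stepWeight (V : Type*) [Fintype V] (p : ℝ) : Option V → ℝ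
  | none => 1 - Fintype.card V * p
  | some _ => p

/-- Expectation over lists of `j` independent steps, each distributed as `stepWeight V p`. -/
noncomputable def expec (p : ℝ) : ℕ → (List (Option V) → ℝ) → ℝ
  | 0, F => F []
  | j + 1, F => ∑ a, stepWeight V p a * expec p j (fun l => F (a :: l))

/-- The matrix of a step: replace row `x` of the identity by row `x` of `P` if `x` rings. -/
def stepMat (P : Matrix V V ℝ) : Option V → Matrix V V ℝ
  | none => 1
  | some x => Matrix.updateRow 1 x (P x)

/-- The product of the step matrices of a list. The head of the list is the last step in time. -/
def listMat (P : Matrix V V ℝ) (l : List (Option V)) : Matrix V V ℝ :=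
  (l.map (stepMat P)).prod

/-- The mean step matrix. -/
def lazyMat (P : Matrix V V ℝ) (p : ℝ) : Matrix V V ℝ := (1 - p) • 1 + p • P

/-- The opinions after `x` has rung. -/
def ringAt (P : Matrix V V ℝ) (f : V → ℝ) (x : V) : V → ℝ := Function.update f x ((P *ᵥ f) x)

/-- The jump of the opinion of `x` when `x` rings. -/
def jump (P : Matrix V V ℝ) (f : V → ℝ) (x : V) : ℝ := (P *ᵥ f) x - f x

/-- The variance of `f` under row `x` of `P`. -/
def locVar (P : Matrix V V ℝ) (f : V → ℝ) (x : V) : ℝ :=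
  (P *ᵥ fun y => f y ^ 2) x - (P *ᵥ f) x ^ 2

variable {P : Matrix V V ℝ} {p : ℝ}

@[simp] theorem listMat_nil : listMat P [] = 1 := rfl

@[simp] theorem listMat_cons (a : Option V) (l : List (Option V)) :
    listMat P (a :: l) = stepMat P a * listMat P l := by simp [listMat]

theorem listMat_append (l l' : List (Option V)) :
    listMat P (l ++ l') = listMat P l * listMat P l' := by simp [listMat]

theorem stepMat_none_mulVec (f : V → ℝ) : stepMat P none *ᵥ f = f := by simp [stepMat]

theorem stepMat_some_mulVec (f : V → ℝ) (x : V) : stepMat P (some x) *ᵥ f = ringAt P f x := by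
  ext y
  by_cases h : y = x
  · subst h; simp [stepMat, ringAt, mulVec]
  · simp only [stepMat, ringAt, mulVec, Matrix.updateRow_ne h, Function.update_of_ne h]
    simp [Matrix.one_apply, dotProduct]

theorem ringAt_apply (f : V → ℝ) (x y : V) :
    ringAt P f x y = f y + if y = x then jump P f y else 0 := by
  by_cases h : y = x
  · subst h; simp [ringAt, jump]
  · simp [ringAt, h]

theorem stepMat_mem (hP : P ∈ rowStochastic ℝ V) (a : Option V) :
    stepMat P a ∈ rowStochastic ℝ V := by
  cases a with
  | none => exact one_mem _
  | some x =>
    rw [mem_rowStochastic]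
    constructor
    · intro i j
      by_cases h : i = x
      · subst h; simpa [stepMat] using nonneg_of_mem_rowStochastic hP
      · rw [stepMat, Matrix.updateRow_ne h, Matrix.one_apply]; split_ifs <;> norm_num
    · rw [stepMat_some_mulVec]
      ext y
      simp [ringAt, one_vecMul_of_mem_rowStochastic hP, Function.update_apply]

theorem listMat_mem (hP : P ∈ rowStochastic ℝ V) (l : List (Option V)) :
    listMat P l ∈ rowStochastic ℝ V := by
  refine Submonoid.list_prod_mem _ fun A hA => ?_
  obtain ⟨a, -, rfl⟩ := List.mem_map.1 hA
  exact stepMat_mem hP a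

theorem lazyMat_mem (hP : P ∈ rowStochastic ℝ V) (h0 : 0 ≤ p) (h1 : p ≤ 1) :
    lazyMat P p ∈ rowStochastic ℝ V := by
  have := convex_rowStochastic (R := ℝ) (n := V) (one_mem _) hP (sub_nonneg.2 h1) h0 (by ring)
  simpa [lazyMat] using this

theorem lazyMat_mulVec (f : V → ℝ) (x : V) :
    (lazyMat P p *ᵥ f) x = f x + p * jump P f x := by
  simp [lazyMat, Matrix.add_mulVec, Matrix.smul_mulVec, jump]; ring

/-! Expectations -/

theorem sum_stepWeight (F : Option V → ℝ) :
    ∑ a, stepWeight V p a * F a = F none + p * ∑ x, (F (some x) - F none) := by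
  simp only [Fintype.sum_option, Finset.sum_sub_distrib, stepWeight, ← Finset.mul_sum,
    Finset.sum_const, Finset.card_univ, nsmul_eq_mul]
  ring

theorem sum_stepWeight_stepMat (F : (V → ℝ) → ℝ) (f : V → ℝ) :
    ∑ a, stepWeight V p a * F (stepMat P a *ᵥ f) =
      F f + p * ∑ x, (F (ringAt P f x) - F f) := by
  rw [sum_stepWeight (F := fun a => F (stepMat P a *ᵥ f))]
  simp only [stepMat_none_mulVec, stepMat_some_mulVec]

theorem sum_stepWeight_one : ∑ a, stepWeight V p a = 1 := by
  simpa using sum_stepWeight (V := V) (p := p) (fun _ => 1)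

theorem stepWeight_nonneg (h0 : 0 ≤ p) (h1 : Fintype.card V * p ≤ 1) (a : Option V) :
    0 ≤ stepWeight V p a := by
  cases a
  · simpa [stepWeight] using h1
  · exact h0

theorem expec_add (j : ℕ) (F G : List (Option V) → ℝ) :
    expec p j (fun l => F l + G l) = expec p j F + expec p j G := by
  induction j generalizing F G with
  | zero => rfl
  | succ j ih => simp only [expec, ih, mul_add, Finset.sum_add_distrib]

theorem expec_const_mul (j : ℕ) (c : ℝ) (F : List (Option V) → ℝ) :
    expec p j (fun l => c * F l) = c * expec p j F := by
  induction j generalizing F with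
  | zero => rfl
  | succ j ih =>
    simp only [expec, ih, Finset.mul_sum]
    exact Finset.sum_congr rfl fun a _ => by ring

theorem expec_const (j : ℕ) (c : ℝ) : expec (V := V) p j (fun _ => c) = c := by
  induction j with
  | zero => rfl
  | succ j ih => simp only [expec, ih, ← Finset.sum_mul, sum_stepWeight_one, one_mul]

theorem expec_sum {ι : Type*} (s : Finset ι) (j : ℕ) (F : ι → List (Option V) → ℝ) :
    expec p j (fun l => ∑ i ∈ s, F i l) = ∑ i ∈ s, expec p j (F i) := by
  classical
  induction s using Finset.induction_on with
  | empty => simpa using expec_const (V := V) (p := p) j 0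
  | insert i s hi ih => simp only [Finset.sum_insert hi, expec_add, ih]

theorem expec_mono_of_length (h0 : 0 ≤ p) (h1 : Fintype.card V * p ≤ 1) {j : ℕ}
    {F G : List (Option V) → ℝ} (h : ∀ l, l.length = j → F l ≤ G l) :
    expec p j F ≤ expec p j G := by
  induction j generalizing F G with
  | zero => exact h [] rfl
  | succ j ih =>
    exact Finset.sum_le_sum fun a _ => mul_le_mul_of_nonneg_left
      (ih fun l hl => h _ (by simp [hl])) (stepWeight_nonneg h0 h1 a)

theorem expec_mono (h0 : 0 ≤ p) (h1 : Fintype.card V * p ≤ 1) {j : ℕ}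
    {F G : List (Option V) → ℝ} (h : ∀ l, F l ≤ G l) : expec p j F ≤ expec p j G :=
  expec_mono_of_length h0 h1 fun l _ => h l

theorem expec_succ_cons (j : ℕ) (F : List (Option V) → ℝ) :
    expec p (j + 1) F = expec p j (fun l => ∑ a, stepWeight V p a * F (a :: l)) := by
  rw [expec_sum]
  simp only [expec_const_mul, expec]

/-- Since the head of a list is the last step in time, the outer expectation is over the later `i`
steps and the inner one over the earlier `j` steps. This is the order in which mass is followed
backwards. -/
theorem expec_append (i j : ℕ) (F : List (Option V) → ℝ) :
    expec p (i + j) F = expec p i (fun l => expec p j (fun l' => F (l ++ l'))) := by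
  induction i generalizing F with
  | zero => simp [expec]
  | succ i ih =>
    rw [Nat.succ_add]
    simp only [expec, ih, List.cons_append]

theorem expec_eq_sum (j : ℕ) (F : List (Option V) → ℝ) :
    expec p j F =
      ∑ σ : Fin j → Option V, (∏ i, stepWeight V p (σ i)) * F (List.ofFn σ) := by
  induction j generalizing F with
  | zero => simp [expec]
  | succ j ih =>
    rw [← (Fin.consEquiv fun _ => Option V).sum_comp, Fintype.sum_prod_type]
    simp only [expec, ih, Finset.mul_sum]
    refine Finset.sum_congr rfl fun a _ => Finset.sum_congr rfl fun σ _ => ?_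
    simp [Fin.consEquiv, Fin.prod_univ_succ, List.ofFn_succ, mul_assoc]

/-- One step of the evolution of an observable of the opinions. -/
theorem expec_succ_listMat (j : ℕ) (F : (V → ℝ) → ℝ) (f : V → ℝ) :
    expec p (j + 1) (fun l => F (listMat P l *ᵥ f)) =
      expec p j (fun l => F (listMat P l *ᵥ f) +
        p * ∑ x, (F (ringAt P (listMat P l *ᵥ f) x) - F (listMat P l *ᵥ f))) := by
  rw [expec_succ_cons]
  congr 1
  ext l
  rw [← sum_stepWeight_stepMat]
  simp only [listMat_cons, mulVec_mulVec]

theorem abs_mulVec_le {A : Matrix V V ℝ} (hA : A ∈ rowStochastic ℝ V) {f : V → ℝ} {c : ℝ}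
    (hf : ∀ x, |f x| ≤ c) (x : V) : |(A *ᵥ f) x| ≤ c := by
  calc |(A *ᵥ f) x| = |∑ y, A x y * f y| := rfl
    _ ≤ ∑ y, |A x y * f y| := Finset.abs_sum_le_sum_abs _ _
    _ ≤ ∑ y, A x y * c := Finset.sum_le_sum fun y _ => by
        rw [abs_mul, abs_of_nonneg (nonneg_of_mem_rowStochastic hA)]
        exact mul_le_mul_of_nonneg_left (hf y) (nonneg_of_mem_rowStochastic hA)
    _ = c := by rw [← Finset.sum_mul, sum_row_of_mem_rowStochastic hA, one_mul]

theorem abs_jump_le (hP : P ∈ rowStochastic ℝ V) {f : V → ℝ} (hf : ∀ x, |f x| ≤ 1) (x : V) :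
    |jump P f x| ≤ 2 := by
  have h1 := abs_le.1 (abs_mulVec_le hP hf x)
  have h2 := abs_le.1 (hf x)
  rw [jump, abs_le]
  constructor <;> linarith

theorem jump_sq_le (hP : P ∈ rowStochastic ℝ V) {f : V → ℝ} (hf : ∀ x, |f x| ≤ 1) (x : V) :
    jump P f x ^ 2 ≤ 4 := by
  have h1 := abs_le.1 (abs_jump_le hP hf x)
  nlinarith

/-- Second moment around `f x` under row `x` of `P`. -/
theorem sum_mul_sub_sq (hP : P ∈ rowStochastic ℝ V) (f : V → ℝ) (x : V) :
    ∑ y, P x y * (f y - f x) ^ 2 = jump P f x ^ 2 + locVar P f x := by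
  have h1 := sum_row_of_mem_rowStochastic hP x
  have : ∀ y, P x y * (f y - f x) ^ 2 =
      P x y * f y ^ 2 - 2 * f x * (P x y * f y) + f x ^ 2 * P x y := fun y => by ring
  simp only [this, Finset.sum_add_distrib, Finset.sum_sub_distrib, ← Finset.mul_sum, h1,
    jump, locVar, mulVec, dotProduct]
  ring

/-- The variance is half the mean squared difference of two independent samples. -/
theorem locVar_eq_sum (hP : P ∈ rowStochastic ℝ V) (f : V → ℝ) (x : V) :
    ∑ y, ∑ z, P x y * P x z * (f y - f z) ^ 2 = 2 * locVar P f x := by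
  have h1 := sum_row_of_mem_rowStochastic hP x
  have : ∀ y z, P x y * P x z * (f y - f z) ^ 2 =
      (P x y * f y ^ 2) * P x z - 2 * (P x y * f y) * (P x z * f z) + P x y * (P x z * f z ^ 2) :=
    fun y z => by ring
  simp only [this, Finset.sum_add_distrib, Finset.sum_sub_distrib, ← Finset.mul_sum,
    ← Finset.sum_mul, h1, locVar, mulVec, dotProduct]
  ring

theorem locVar_nonneg (hP : P ∈ rowStochastic ℝ V) (f : V → ℝ) (x : V) : 0 ≤ locVar P f x := by
  have h := locVar_eq_sum hP f x
  have : 0 ≤ ∑ y, ∑ z, P x y * P x z * (f y - f z) ^ 2 :=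
    Finset.sum_nonneg fun y _ => Finset.sum_nonneg fun z _ =>
      mul_nonneg (mul_nonneg (nonneg_of_mem_rowStochastic hP) (nonneg_of_mem_rowStochastic hP))
        (sq_nonneg _)
  linarith

theorem locVar_le_one (hP : P ∈ rowStochastic ℝ V) {f : V → ℝ} (hf : ∀ x, |f x| ≤ 1) (x : V) :
    locVar P f x ≤ 1 := by
  have h : |(P *ᵥ fun y => f y ^ 2) x| ≤ 1 := abs_mulVec_le hP (fun y => by
    rw [abs_pow]; exact pow_le_one₀ (abs_nonneg _) (hf y)) x
  have := (abs_le.1 h).2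
  rw [locVar]
  nlinarith [sq_nonneg ((P *ᵥ f) x)]

/-- The atom of row `x` at `x` itself turns jumps into variance. -/
theorem diag_mul_jump_sq_le (hP : P ∈ rowStochastic ℝ V) (f : V → ℝ) (x : V) :
    P x x * jump P f x ^ 2 ≤ locVar P f x := by
  have h1 := sum_mul_sub_sq hP f x
  have h2 := locVar_eq_sum hP f x
  have hn : ∀ {a b}, 0 ≤ P a b := nonneg_of_mem_rowStochastic hP
  have hx : ∀ z, 0 ≤ P x x * P x z * (f x - f z) ^ 2 := fun z =>
    mul_nonneg (mul_nonneg hn hn) (sq_nonneg _)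
  have h3 : P x x * ∑ y, P x y * (f y - f x) ^ 2 ≤ locVar P f x := by
    have hrow : ∑ z, P x x * P x z * (f x - f z) ^ 2 = P x x * ∑ y, P x y * (f y - f x) ^ 2 := by
      rw [Finset.mul_sum]; exact Finset.sum_congr rfl fun y _ => by ring
    have hcol : ∑ y, P x y * P x x * (f y - f x) ^ 2 = P x x * ∑ y, P x y * (f y - f x) ^ 2 := by
      rw [Finset.mul_sum]; exact Finset.sum_congr rfl fun y _ => by ring
    -- Only the pairs with a coordinate equal to `x` are kept; the pair `(x, x)`, which would be
    -- counted twice, contributes zero.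
    have hge : ∑ z, P x x * P x z * (f x - f z) ^ 2 + ∑ y, P x y * P x x * (f y - f x) ^ 2 ≤
        ∑ y, ∑ z, P x y * P x z * (f y - f z) ^ 2 := by
      have hsplit : ∀ y, (if y = x then ∑ z, P x x * P x z * (f x - f z) ^ 2 else 0) +
          P x y * P x x * (f y - f x) ^ 2 ≤ ∑ z, P x y * P x z * (f y - f z) ^ 2 := by
        intro y
        by_cases h : y = x
        · subst h; simp
        · simp only [h, if_false, zero_add]
          exact Finset.single_le_sum (f := fun z => P x y * P x z * (f y - f z) ^ 2)
            (fun z _ => mul_nonneg (mul_nonneg hn hn) (sq_nonneg _)) (Finset.mem_univ x)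
      have := Finset.sum_le_sum fun y (_ : y ∈ Finset.univ) => hsplit y
      simpa [Finset.sum_add_distrib] using this
    rw [hrow, hcol, h2] at hge
    linarith
  have h4 : P x x * jump P f x ^ 2 ≤ P x x * (jump P f x ^ 2 + locVar P f x) :=
    mul_le_mul_of_nonneg_left (by linarith [locVar_nonneg hP f x]) hn
  rw [h1] at h3
  exact h4.trans h3

end Discrete

end DeGroot

namespace DeGroot

open Matrix

/-! ### Binomial weights and ancestor measures -/

/-- The binomial weights. -/
noncomputable def binom (p : ℝ) (m k : ℕ) : ℝ := m.choose k * p ^ k * (1 - p) ^ (m - k)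

section Binom

variable {p : ℝ}

theorem binom_nonneg (h0 : 0 ≤ p) (h1 : p ≤ 1) (m k : ℕ) : 0 ≤ binom p m k :=
  mul_nonneg (mul_nonneg (Nat.cast_nonneg _) (pow_nonneg h0 _)) (pow_nonneg (by linarith) _)

theorem binom_eq_zero {m k : ℕ} (h : m < k) : binom p m k = 0 := by
  simp [binom, Nat.choose_eq_zero_of_lt h]

theorem binom_succ_succ (m k : ℕ) :
    binom p (m + 1) (k + 1) = (1 - p) * binom p m (k + 1) + p * binom p m k := by
  rcases lt_or_ge m (k + 1) with h | h
  · rw [binom_eq_zero h]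
    rcases Nat.lt_or_ge m k with h' | h'
    · rw [binom_eq_zero (by omega), binom_eq_zero h']; ring
    · obtain rfl : m = k := by omega
      simp [binom]; ring
  · obtain ⟨d, rfl⟩ := Nat.exists_eq_add_of_le h
    simp only [binom, Nat.choose_succ_succ, Nat.cast_add]
    rw [show k + 1 + d + 1 - (k + 1) = d + 1 by omega, show k + 1 + d - (k + 1) = d by omega,
      show k + 1 + d - k = d + 1 by omega]
    ring

theorem sum_binom_mul_pow (m : ℕ) (t : ℝ) :
    ∑ k ∈ Finset.range (m + 1), binom p m k * t ^ k = (1 - p + p * t) ^ m := by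
  rw [add_comm (1 - p), add_pow]
  refine Finset.sum_congr rfl fun k _ => ?_
  rw [binom, mul_pow]; ring

theorem binom_mul_eq {m k : ℕ} (h : k ≤ m) :
    ((m : ℝ) - k) * p * binom p m k = (k + 1) * (1 - p) * binom p m (k + 1) := by
  rcases h.eq_or_lt with rfl | h
  · rw [binom_eq_zero (Nat.lt_succ_self _)]; simp
  · obtain ⟨d, rfl⟩ := Nat.exists_eq_add_of_lt h
    have hc : ((k + d + 1).choose (k + 1) : ℝ) * (k + 1) = (k + d + 1).choose k * (d + 1) := by
      have := Nat.choose_succ_right_eq (k + d + 1) k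
      rw [show k + d + 1 - k = d + 1 by omega] at this
      exact_mod_cast this
    simp only [binom]
    rw [show k + d + 1 - k = d + 1 by omega, show k + d + 1 - (k + 1) = d by omega]
    push_cast
    linear_combination (-(p ^ (k + 1) * (1 - p) ^ (d + 1))) * hc

/-- For `k + 1 < 4pm` the ratio of consecutive weights, `(k + 1)(1 - p) / ((m - k) p)`, is at most
`8`. For larger `k` the exponential factor is at least `1`, so the last term, whose sum over `k` is
a Chernoff tail, suffices alone. -/
theorem binom_le_succ_add (h0 : 0 < p) (h1 : p ≤ 1 / 16) (m k : ℕ) :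
    binom p m k ≤ 8 * binom p m (k + 1) + binom p m k * Real.exp (k + 1 - 4 * p * m) := by
  have hb := binom_nonneg h0.le (by linarith : p ≤ 1) m
  rcases le_or_gt (4 * p * m) (k + 1) with h | h
  · have : 1 ≤ Real.exp (k + 1 - 4 * p * m) := Real.one_le_exp (by linarith)
    nlinarith [hb k, hb (k + 1)]
  · have hkm : (k : ℝ) ≤ m / 4 := by nlinarith [(Nat.cast_nonneg m : (0 : ℝ) ≤ m)]
    have hm : (0 : ℝ) < p * m := by
      have : (0 : ℝ) ≤ k := Nat.cast_nonneg k
      linarith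
    have hk : k ≤ m := by
      have : (k : ℝ) ≤ m := by linarith [(Nat.cast_nonneg m : (0 : ℝ) ≤ m)]
      exact_mod_cast this
    have e := binom_mul_eq (p := p) hk
    have l1 : (k + 1) * (1 - p) * binom p m (k + 1) ≤ 4 * (p * m) * binom p m (k + 1) := by
      refine mul_le_mul_of_nonneg_right ?_ (hb _)
      have : (0 : ℝ) ≤ k + 1 := by positivity
      nlinarith
    have l2 : 1 / 2 * (p * m) * binom p m k ≤ ((m : ℝ) - k) * p * binom p m k := by
      refine mul_le_mul_of_nonneg_right ?_ (hb _)
      nlinarith [(Nat.cast_nonneg m : (0 : ℝ) ≤ m)]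
    have l3 : p * m * binom p m k ≤ p * m * (8 * binom p m (k + 1)) := by linarith
    have := le_of_mul_le_mul_left l3 hm
    have := mul_nonneg (hb k) (Real.exp_pos (k + 1 - 4 * p * m)).le
    linarith

/-- The reverse comparison: the inverse ratio is bounded as soon as `k + 1 > pm / 8`, and below this
level the lower tail term suffices alone. -/
theorem binom_succ_le_add (h0 : 0 < p) (h1 : p ≤ 1 / 16) (m k : ℕ) :
    binom p m (k + 1) ≤
      16 * binom p m k + binom p m (k + 1) * Real.exp (p * m / 8 - (k + 1)) := by
  have hb := binom_nonneg h0.le (by linarith : p ≤ 1) m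
  rcases le_or_gt (k + 1 : ℝ) (p * m / 8) with h | h
  · have : 1 ≤ Real.exp (p * m / 8 - (k + 1)) := Real.one_le_exp (by linarith)
    nlinarith [hb k, hb (k + 1)]
  · have hpos := mul_nonneg (hb (k + 1)) (Real.exp_pos (p * m / 8 - (k + 1))).le
    rcases lt_or_ge m k with hk | hk
    · rw [binom_eq_zero (show m < k + 1 by omega)] at *; linarith [hb k]
    have e := binom_mul_eq (p := p) hk
    have hk1 : (0 : ℝ) < k + 1 := by positivity
    have l1 : (k + 1) * (15 / 16) * binom p m (k + 1) ≤ (k + 1) * (1 - p) * binom p m (k + 1) := by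
      refine mul_le_mul_of_nonneg_right ?_ (hb _)
      exact mul_le_mul_of_nonneg_left (by linarith) hk1.le
    have l2 : ((m : ℝ) - k) * p * binom p m k ≤ 8 * (k + 1) * binom p m k := by
      refine mul_le_mul_of_nonneg_right ?_ (hb _)
      nlinarith [(Nat.cast_nonneg k : (0 : ℝ) ≤ k)]
    have l3 : (k + 1) * binom p m (k + 1) ≤ (k + 1) * (16 * binom p m k) := by
      nlinarith [mul_nonneg hk1.le (hb k)]
    have := le_of_mul_le_mul_left l3 hk1
    linarith

/-- The exponential moment of a binomial variable at slope `1` is at most `exp (2pm)`, because `e -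
1 ≤ 2`. -/
theorem sum_binom_mul_exp_le (h0 : 0 ≤ p) (h1 : p ≤ 1) (m : ℕ) :
    ∑ k ∈ Finset.range (m + 1), binom p m k * Real.exp (k + 1 - 4 * p * m) ≤
      3 * Real.exp (-(p * m / 2)) := by
  have he : Real.exp 1 < 2.7182818286 := Real.exp_one_lt_d9
  have e : ∀ k : ℕ, Real.exp (k + 1 - 4 * p * m) =
      Real.exp (1 - 4 * p * m) * Real.exp 1 ^ k := fun k => by
    rw [← Real.exp_nat_mul, ← Real.exp_add]; ring_nf
  have : ∑ k ∈ Finset.range (m + 1), binom p m k * Real.exp (k + 1 - 4 * p * m) =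
      Real.exp (1 - 4 * p * m) * (1 - p + p * Real.exp 1) ^ m := by
    rw [← sum_binom_mul_pow, Finset.mul_sum]
    exact Finset.sum_congr rfl fun k _ => by rw [e]; ring
  rw [this]
  have hbase : 1 - p + p * Real.exp 1 ≤ Real.exp (2 * p) := by
    nlinarith [Real.add_one_le_exp (2 * p)]
  have hb0 : 0 ≤ 1 - p + p * Real.exp 1 := by nlinarith [Real.exp_pos 1]
  have hpow : (1 - p + p * Real.exp 1) ^ m ≤ Real.exp (2 * p * m) := by
    refine (pow_le_pow_left₀ hb0 hbase m).trans_eq ?_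
    rw [← Real.exp_nat_mul]; ring_nf
  have hpm : 0 ≤ p * m := mul_nonneg h0 (Nat.cast_nonneg m)
  calc Real.exp (1 - 4 * p * m) * (1 - p + p * Real.exp 1) ^ m
      ≤ Real.exp (1 - 4 * p * m) * Real.exp (2 * p * m) :=
        mul_le_mul_of_nonneg_left hpow (Real.exp_pos _).le
    _ = Real.exp 1 * Real.exp (-(2 * (p * m))) := by
        rw [← Real.exp_add, ← Real.exp_add]; ring_nf
    _ ≤ 3 * Real.exp (-(p * m / 2)) :=
        mul_le_mul (by linarith) (Real.exp_le_exp.2 (by linarith)) (Real.exp_pos _).le (by norm_num)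

theorem sum_binom_mul_exp_neg_le (h0 : 0 ≤ p) (h1 : p ≤ 1) (m : ℕ) :
    ∑ k ∈ Finset.range (m + 1), binom p m k * Real.exp (p * m / 8 - k) ≤
      Real.exp (-(p * m / 2)) := by
  have he : 2.7182818283 < Real.exp 1 := Real.exp_one_gt_d9
  have e : ∀ k : ℕ, Real.exp (p * m / 8 - k) =
      Real.exp (p * m / 8) * Real.exp (-1) ^ k := fun k => by
    rw [← Real.exp_nat_mul, ← Real.exp_add]; ring_nf
  have : ∑ k ∈ Finset.range (m + 1), binom p m k * Real.exp (p * m / 8 - k) =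
      Real.exp (p * m / 8) * (1 - p + p * Real.exp (-1)) ^ m := by
    rw [← sum_binom_mul_pow, Finset.mul_sum]
    exact Finset.sum_congr rfl fun k _ => by rw [e]; ring
  rw [this]
  have hinv : Real.exp (-1) ≤ 3 / 8 := by
    rw [Real.exp_neg, inv_le_comm₀ (Real.exp_pos 1) (by norm_num)]; norm_num; linarith
  have hbase : 1 - p + p * Real.exp (-1) ≤ Real.exp (-(5 / 8 * p)) := by
    nlinarith [Real.add_one_le_exp (-(5 / 8 * p))]
  have hb0 : 0 ≤ 1 - p + p * Real.exp (-1) := by nlinarith [Real.exp_pos (-1)]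
  have hpow : (1 - p + p * Real.exp (-1)) ^ m ≤ Real.exp (-(5 / 8 * (p * m))) := by
    refine (pow_le_pow_left₀ hb0 hbase m).trans_eq ?_
    rw [← Real.exp_nat_mul]; ring_nf
  calc Real.exp (p * m / 8) * (1 - p + p * Real.exp (-1)) ^ m
      ≤ Real.exp (p * m / 8) * Real.exp (-(5 / 8 * (p * m))) :=
        mul_le_mul_of_nonneg_left hpow (Real.exp_pos _).le
    _ = Real.exp (-(p * m / 2)) := by rw [← Real.exp_add]; ring_nf

/-- The lower tail of the binomial weights. -/
theorem sum_binom_lt_le (h0 : 0 ≤ p) (h1 : p ≤ 1) (m K : ℕ) :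
    ∑ k ∈ Finset.range K, binom p m k ≤
      Real.exp (K - p * m / 8) * Real.exp (-(p * m / 2)) := by
  have hb := binom_nonneg h0 h1 m
  have h2 : ∑ k ∈ Finset.range K, binom p m k ≤ ∑ k ∈ Finset.range K,
      Real.exp (K - p * m / 8) * (binom p m k * Real.exp (p * m / 8 - k)) := by
    refine Finset.sum_le_sum fun k hk => ?_
    have hk' : (k : ℝ) ≤ K := by exact_mod_cast (Finset.mem_range.1 hk).le
    have : Real.exp (K - p * m / 8) * (binom p m k * Real.exp (p * m / 8 - k)) =
        binom p m k * Real.exp (K - k) := by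
      rw [show (K - k : ℝ) = (K - p * m / 8) + (p * m / 8 - k) by ring, Real.exp_add]; ring
    rw [this]
    exact le_mul_of_one_le_right (hb k) (Real.one_le_exp (by linarith))
  refine h2.trans ?_
  rw [← Finset.mul_sum]
  refine mul_le_mul_of_nonneg_left ?_ (Real.exp_pos _).le
  refine le_trans ?_ (sum_binom_mul_exp_neg_le h0 h1 m)
  have hz : ∀ k, 0 ≤ binom p m k * Real.exp (p * m / 8 - k) := fun k =>
    mul_nonneg (hb k) (Real.exp_pos _).le
  rcases le_total K (m + 1) with h | h
  · exact Finset.sum_le_sum_of_subset_of_nonneg (Finset.range_mono h) fun k _ _ => hz k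
  · refine (Finset.sum_subset (Finset.range_mono h) fun k _ hk => ?_).ge
    rw [Finset.mem_range, not_lt] at hk
    rw [binom_eq_zero (by omega), zero_mul]

theorem sum_binom (m : ℕ) : ∑ k ∈ Finset.range (m + 1), binom p m k = 1 := by
  simpa using sum_binom_mul_pow (p := p) m 1

end Binom

section Ancestors

set_option linter.unusedSectionVars false

variable {V : Type*} [Fintype V] [DecidableEq V] {P : Matrix V V ℝ} {p : ℝ} {M : V → ℝ}

/-- For the lazy walk with `m` steps started from `M`, the law of its position `i` jumps before
the end (on the event that it has at least `i` jumps). -/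
noncomputable def anc (P : Matrix V V ℝ) (p : ℝ) (M : V → ℝ) (i m : ℕ) : V → ℝ :=
  ∑ l ∈ Finset.range (m + 1), binom p m (l + i) • (M ᵥ* P ^ l)

theorem anc_apply (i m : ℕ) (x : V) :
    anc P p M i m x = ∑ l ∈ Finset.range (m + 1), binom p m (l + i) * (M ᵥ* P ^ l) x := by
  simp [anc, Finset.sum_apply]

theorem vecMul_nonneg {A : Matrix V V ℝ} (hA : ∀ x y, 0 ≤ A x y) {ν : V → ℝ} (hν : ∀ x, 0 ≤ ν x)
    (y : V) : 0 ≤ (ν ᵥ* A) y :=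
  Finset.sum_nonneg fun x _ => mul_nonneg (hν x) (hA x y)

theorem vecMul_mono {A : Matrix V V ℝ} (hA : ∀ x y, 0 ≤ A x y) {ν ν' : V → ℝ}
    (h : ∀ x, ν x ≤ ν' x) (y : V) : (ν ᵥ* A) y ≤ (ν' ᵥ* A) y :=
  Finset.sum_le_sum fun x _ => mul_le_mul_of_nonneg_right (h x) (hA x y)

theorem vecMul_mono_right {A A' : Matrix V V ℝ} (hA : ∀ x y, A x y ≤ A' x y) {ν : V → ℝ}
    (h : ∀ x, 0 ≤ ν x) (y : V) : (ν ᵥ* A) y ≤ (ν ᵥ* A') y :=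
  Finset.sum_le_sum fun x _ => mul_le_mul_of_nonneg_left (hA x y) (h x)

theorem sum_vecMul {A : Matrix V V ℝ} (hA : A ∈ rowStochastic ℝ V) (ν : V → ℝ) :
    ∑ y, (ν ᵥ* A) y = ∑ x, ν x := by
  simp only [vecMul, dotProduct]
  rw [Finset.sum_comm]
  simp only [← Finset.mul_sum, sum_row_of_mem_rowStochastic hA, mul_one]

theorem anc_nonneg (hP : P ∈ rowStochastic ℝ V) (h0 : 0 ≤ p) (h1 : p ≤ 1) (hM : ∀ x, 0 ≤ M x)
    (i m : ℕ) (x : V) : 0 ≤ anc P p M i m x := by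
  rw [anc_apply]
  exact Finset.sum_nonneg fun l _ => mul_nonneg (binom_nonneg h0 h1 _ _)
    (vecMul_nonneg (fun _ _ => nonneg_of_mem_rowStochastic (pow_mem hP l)) hM x)

theorem lazyMat_pow (m : ℕ) :
    lazyMat P p ^ m = ∑ l ∈ Finset.range (m + 1), binom p m l • P ^ l := by
  rw [lazyMat, add_comm, Commute.add_pow (by
    refine Commute.smul_left (Commute.smul_right (Commute.one_right _) _) _)]
  refine Finset.sum_congr rfl fun l _ => ?_
  rw [smul_pow, smul_pow, one_pow, binom, ← Nat.cast_comm, smul_mul_smul_comm, mul_one,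
    ← nsmul_eq_mul, ← Nat.cast_smul_eq_nsmul ℝ, smul_smul, mul_assoc]

theorem anc_zero (m : ℕ) : anc P p M 0 m = M ᵥ* lazyMat P p ^ m := by
  rw [lazyMat_pow, Matrix.vecMul_sum]
  simp [anc, Matrix.vecMul_smul]

/-- Either the walk makes exactly `i` jumps, and the ancestor is the starting point, or the ancestor
is reached by one `P`-step from the ancestor one generation earlier. -/
theorem anc_eq_add (i m : ℕ) :
    anc P p M i m = binom p m i • M + anc P p M (i + 1) m ᵥ* P := by
  have h : anc P p M (i + 1) m ᵥ* P =
      ∑ l ∈ Finset.range m, binom p m (l + 1 + i) • (M ᵥ* P ^ (l + 1)) := by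
    rw [anc, Matrix.sum_vecMul, Finset.sum_range_succ, binom_eq_zero (by omega : m < m + (i + 1)),
      zero_smul, Matrix.zero_vecMul, add_zero]
    refine Finset.sum_congr rfl fun l _ => ?_
    rw [Matrix.smul_vecMul, Matrix.vecMul_vecMul, ← pow_succ, show l + (i + 1) = l + 1 + i by ring]
  rw [h, anc, Finset.sum_range_succ', add_comm]
  simp

/-- One more step of the walk is a jump with probability `p`; in that case the ancestor of
generation `i + 1` is the former ancestor of generation `i`. -/
theorem anc_succ_succ (i m : ℕ) (x : V) :
    anc P p M (i + 1) (m + 1) x = (1 - p) * anc P p M (i + 1) m x + p * anc P p M i m x := by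
  rw [anc_apply, anc_apply, anc_apply, Finset.sum_range_succ,
    binom_eq_zero (by omega : m + 1 < m + 1 + (i + 1)), zero_mul, add_zero, Finset.mul_sum,
    Finset.mul_sum, ← Finset.sum_add_distrib]
  refine Finset.sum_congr rfl fun l _ => ?_
  rw [← add_assoc, binom_succ_succ]; ring

theorem sum_sum_range_le (hP : P ∈ rowStochastic ℝ V) (hM1 : ∑ x, M x = 1) (i m : ℕ)
    {c : ℕ → ℝ} (hc : ∀ k, 0 ≤ c k) (hc' : ∀ k, m < k → c k = 0) :
    ∑ x, ∑ l ∈ Finset.range (m + 1), c (l + i) * (M ᵥ* P ^ l) x ≤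
      ∑ k ∈ Finset.range (m + 1), c k := by
  rw [Finset.sum_comm]
  simp only [← Finset.mul_sum, sum_vecMul (pow_mem hP _), hM1, mul_one]
  calc ∑ l ∈ Finset.range (m + 1), c (l + i)
      = ∑ k ∈ Finset.Ico i (m + 1 + i), c k := by
        rw [Finset.sum_Ico_eq_sum_range, Nat.add_sub_cancel]
        exact Finset.sum_congr rfl fun l _ => by rw [add_comm]
    _ ≤ ∑ k ∈ Finset.range (m + 1 + i), c k :=
        Finset.sum_le_sum_of_subset_of_nonneg (fun k hk => by
          simp only [Finset.mem_Ico, Finset.mem_range] at *; omega) fun k _ _ => hc k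
    _ = ∑ k ∈ Finset.range (m + 1), c k := by
        refine (Finset.sum_subset (Finset.range_mono (by omega)) fun k _ hk => ?_).symm
        exact hc' k (by rw [Finset.mem_range, not_lt] at hk; omega)

/-- The law of the ancestor changes little between consecutive generations. -/
theorem exists_anc_le_succ (hP : P ∈ rowStochastic ℝ V) (h0 : 0 < p) (h1 : p ≤ 1 / 16)
    (hM : ∀ x, 0 ≤ M x) (hM1 : ∑ x, M x = 1) (i m : ℕ) :
    ∃ ζ : V → ℝ, (∀ x, 0 ≤ ζ x) ∧ ∑ x, ζ x ≤ 3 * Real.exp (-(p * m / 2)) ∧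
      ∀ x, anc P p M i m x ≤ 8 * anc P p M (i + 1) m x + ζ x := by
  have hμ : ∀ l x, 0 ≤ (M ᵥ* P ^ l) x := fun l x =>
    vecMul_nonneg (fun _ _ => nonneg_of_mem_rowStochastic (pow_mem hP l)) hM x
  have hb := binom_nonneg h0.le (by linarith : p ≤ 1) m
  refine ⟨fun x => ∑ l ∈ Finset.range (m + 1),
    (binom p m (l + i) * Real.exp ((l + i : ℕ) + 1 - 4 * p * m)) * (M ᵥ* P ^ l) x,
    fun x => Finset.sum_nonneg fun l _ => mul_nonneg (mul_nonneg (hb _) (Real.exp_pos _).le)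
      (hμ l x), ?_, fun x => ?_⟩
  · exact (sum_sum_range_le hP hM1 i m (c := fun k => binom p m k * Real.exp (k + 1 - 4 * p * m))
      (fun k => mul_nonneg (hb _) (Real.exp_pos _).le)
      (fun k hk => by simp [binom_eq_zero hk])).trans (sum_binom_mul_exp_le h0.le (by linarith) m)
  · rw [anc_apply, anc_apply, Finset.mul_sum, ← Finset.sum_add_distrib]
    refine Finset.sum_le_sum fun l _ => ?_
    have := mul_le_mul_of_nonneg_right (binom_le_succ_add h0 h1 m (l + i)) (hμ l x)
    rw [← add_assoc]
    linarith

/-- The law of the ancestor changes little between consecutive generations. -/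
theorem exists_anc_succ_le (hP : P ∈ rowStochastic ℝ V) (h0 : 0 < p) (h1 : p ≤ 1 / 16)
    (hM : ∀ x, 0 ≤ M x) (hM1 : ∑ x, M x = 1) (i m : ℕ) :
    ∃ ζ : V → ℝ, (∀ x, 0 ≤ ζ x) ∧ ∑ x, ζ x ≤ Real.exp (-(p * m / 2)) ∧
      ∀ x, anc P p M (i + 1) m x ≤ 16 * anc P p M i m x + ζ x := by
  have hμ : ∀ l x, 0 ≤ (M ᵥ* P ^ l) x := fun l x =>
    vecMul_nonneg (fun _ _ => nonneg_of_mem_rowStochastic (pow_mem hP l)) hM x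
  have hb := binom_nonneg h0.le (by linarith : p ≤ 1) m
  refine ⟨fun x => ∑ l ∈ Finset.range (m + 1),
    (binom p m (l + (i + 1)) * Real.exp (p * m / 8 - (l + (i + 1) : ℕ))) * (M ᵥ* P ^ l) x,
    fun x => Finset.sum_nonneg fun l _ => mul_nonneg (mul_nonneg (hb _) (Real.exp_pos _).le)
      (hμ l x), ?_, fun x => ?_⟩
  · exact (sum_sum_range_le hP hM1 (i + 1) m
      (c := fun k => binom p m k * Real.exp (p * m / 8 - k))
      (fun k => mul_nonneg (hb _) (Real.exp_pos _).le)
      (fun k hk => by simp [binom_eq_zero hk])).trans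
        (sum_binom_mul_exp_neg_le h0.le (by linarith) m)
  · rw [anc_apply, anc_apply, Finset.mul_sum, ← Finset.sum_add_distrib]
    refine Finset.sum_le_sum fun l _ => ?_
    have := mul_le_mul_of_nonneg_right (binom_succ_le_add h0 h1 m (l + i)) (hμ l x)
    rw [← add_assoc]
    push_cast at *
    linarith

/-- The law of the ancestor changes little in one step. -/
theorem exists_anc_step_le (hP : P ∈ rowStochastic ℝ V) (h0 : 0 < p) (h1 : p ≤ 1 / 16)
    (hM : ∀ x, 0 ≤ M x) (hM1 : ∑ x, M x = 1) (i m : ℕ) :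
    ∃ ζ : V → ℝ, (∀ x, 0 ≤ ζ x) ∧ ∑ x, ζ x ≤ 3 * Real.exp (-(p * m / 2)) ∧
      ∀ x, anc P p M (i + 1) (m + 1) x ≤ (1 + 8 * p) * anc P p M (i + 1) m x + p * ζ x := by
  obtain ⟨ζ, hζ0, hζ1, hζ⟩ := exists_anc_le_succ hP h0 h1 hM hM1 i m
  refine ⟨ζ, hζ0, hζ1, fun x => ?_⟩
  rw [anc_succ_succ]
  have := mul_le_mul_of_nonneg_left (hζ x) h0.le
  nlinarith [anc_nonneg hP h0.le (by linarith : p ≤ 1) hM (i + 1) m x]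

/-- Running `i` jumps from the `i`-th ancestor recovers the final position, restricted to the event
of at least `i` jumps. -/
theorem anc_vecMul_pow_le (hP : P ∈ rowStochastic ℝ V) (h0 : 0 ≤ p) (h1 : p ≤ 1)
    (hM : ∀ x, 0 ≤ M x) (i m : ℕ) (x : V) :
    (anc P p M i m ᵥ* P ^ i) x ≤ anc P p M 0 m x := by
  induction i generalizing x with
  | zero => simp
  | succ i ih =>
    refine le_trans ?_ (ih x)
    rw [pow_succ', ← Matrix.vecMul_vecMul]
    refine vecMul_mono (fun _ _ => nonneg_of_mem_rowStochastic (pow_mem hP i)) (fun y => ?_) x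
    rw [anc_eq_add (i := i)]
    simpa using mul_nonneg (binom_nonneg h0 h1 m i) (hM y)

/-- With one jump fewer than generations, this is the law of the position just before the last jump.
By `anc_succ_succ` each additional step mixes the previous such law with one dominated by the law of
the walk, so the bound `η` persists. -/
theorem anc_succ_vecMul_pow_le (hP : P ∈ rowStochastic ℝ V) (h0 : 0 ≤ p) (h1 : p ≤ 1)
    (hM : ∀ x, 0 ≤ M x) {η : ℝ} (hη : ∀ m x, (M ᵥ* lazyMat P p ^ m) x ≤ η) (hη0 : 0 ≤ η)
    (i m : ℕ) (x : V) : (anc P p M (i + 1) m ᵥ* P ^ i) x ≤ η := by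
  induction m with
  | zero =>
    have : anc P p M (i + 1) 0 = 0 := by
      simp [anc, binom_eq_zero (Nat.succ_pos i)]
    simpa [this] using hη0
  | succ m ih =>
    have h2 : anc P p M (i + 1) (m + 1) = (1 - p) • anc P p M (i + 1) m + p • anc P p M i m := by
      ext y; simpa using anc_succ_succ i m y
    rw [h2, Matrix.add_vecMul, Matrix.smul_vecMul, Matrix.smul_vecMul]
    have h3 := (anc_vecMul_pow_le hP h0 h1 hM i m x).trans_eq (congrFun (anc_zero m) x)
    have h4 := h3.trans (hη m x)
    simp only [Pi.add_apply, Pi.smul_apply, smul_eq_mul]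
    nlinarith [mul_le_mul_of_nonneg_left ih (sub_nonneg.2 h1), mul_le_mul_of_nonneg_left h4 h0]

end Ancestors

end DeGroot

namespace DeGroot

open Matrix

/-! ### The Lyapunov functional -/

section Lyapunov

set_option linter.unusedSectionVars false

variable {V : Type*} [Fintype V] [DecidableEq V] {P : Matrix V V ℝ} {p : ℝ} {M : V → ℝ}

/-- The part of `P` consisting of the transitions that are not almost deterministic. -/
noncomputable def branching (P : Matrix V V ℝ) (β : ℝ) : Matrix V V ℝ :=
  Matrix.of fun x y => if P x y ≤ 1 - β then P x y else 0

/-- The part of `P` consisting of the almost deterministic transitions. -/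
noncomputable def following (P : Matrix V V ℝ) (β : ℝ) : Matrix V V ℝ :=
  Matrix.of fun x y => if P x y ≤ 1 - β then 0 else P x y

theorem branching_add_following (P : Matrix V V ℝ) (β : ℝ) :
    branching P β + following P β = P := by
  ext x y
  simp only [branching, following, Matrix.add_apply, Matrix.of_apply]
  split_ifs <;> simp

variable {β : ℝ}

theorem branching_nonneg (hP : P ∈ rowStochastic ℝ V) (x y : V) : 0 ≤ branching P β x y := by
  simp only [branching, Matrix.of_apply]
  split_ifs
  exacts [nonneg_of_mem_rowStochastic hP, le_rfl]

theorem branching_le (hP : P ∈ rowStochastic ℝ V) (x y : V) : branching P β x y ≤ P x y := by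
  simp only [branching, Matrix.of_apply]
  split_ifs
  exacts [le_rfl, nonneg_of_mem_rowStochastic hP]

theorem following_nonneg (hP : P ∈ rowStochastic ℝ V) (x y : V) : 0 ≤ following P β x y := by
  simp only [following, Matrix.of_apply]
  split_ifs
  exacts [le_rfl, nonneg_of_mem_rowStochastic hP]

theorem following_le (hP : P ∈ rowStochastic ℝ V) (x y : V) : following P β x y ≤ P x y := by
  simp only [following, Matrix.of_apply]
  split_ifs
  exacts [nonneg_of_mem_rowStochastic hP, le_rfl]

theorem mul_nonneg_entries {A B : Matrix V V ℝ} (hA : ∀ x y, 0 ≤ A x y) (hB : ∀ x y, 0 ≤ B x y)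
    (x y : V) : 0 ≤ (A * B) x y :=
  Finset.sum_nonneg fun z _ => mul_nonneg (hA x z) (hB z y)

theorem mul_le_mul_entries {A A' B B' : Matrix V V ℝ} (hA : ∀ x y, 0 ≤ A x y)
    (hB : ∀ x y, 0 ≤ B x y) (hAA : ∀ x y, A x y ≤ A' x y) (hBB : ∀ x y, B x y ≤ B' x y)
    (x y : V) : (A * B) x y ≤ (A' * B') x y :=
  Finset.sum_le_sum fun z _ => mul_le_mul (hAA x z) (hBB z y) (hB z y) ((hA x z).trans (hAA x z))

theorem pow_nonneg_entries (hP : P ∈ rowStochastic ℝ V) (i : ℕ) (x y : V) : 0 ≤ (P ^ i) x y :=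
  nonneg_of_mem_rowStochastic (pow_mem hP i)

theorem following_pow_nonneg (hP : P ∈ rowStochastic ℝ V) (i : ℕ) (x y : V) :
    0 ≤ (following P β ^ i) x y := by
  induction i generalizing x y with
  | zero => rw [pow_zero, Matrix.one_apply]; split_ifs <;> norm_num
  | succ i ih => rw [pow_succ]; exact mul_nonneg_entries ih (following_nonneg hP) x y

theorem following_pow_le (hP : P ∈ rowStochastic ℝ V) (i : ℕ) (x y : V) :
    (following P β ^ i) x y ≤ (P ^ i) x y := by
  induction i generalizing x y with
  | zero => simp
  | succ i ih =>
    rw [pow_succ, pow_succ]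
    exact mul_le_mul_entries (following_pow_nonneg hP i) (following_nonneg hP) ih
      (following_le hP) x y

/-- The transitions by one branching step followed by `i` arbitrary steps. -/
noncomputable def branchPow (P : Matrix V V ℝ) (β : ℝ) (i : ℕ) : Matrix V V ℝ :=
  branching P β * P ^ i

theorem branchPow_nonneg (hP : P ∈ rowStochastic ℝ V) (i : ℕ) (x y : V) :
    0 ≤ branchPow P β i x y :=
  mul_nonneg_entries (branching_nonneg hP) (pow_nonneg_entries hP i) x y

theorem branchPow_le (hP : P ∈ rowStochastic ℝ V) (i : ℕ) (x y : V) :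
    branchPow P β i x y ≤ (P ^ (i + 1)) x y := by
  rw [pow_succ']
  exact mul_le_mul_entries (branching_nonneg hP) (pow_nonneg_entries hP i) (branching_le hP)
    (fun _ _ => le_rfl) x y

/-- If some power of `P` has small entries, there are no long almost deterministic paths. -/
theorem following_pow_eq_zero (hP : P ∈ rowStochastic ℝ V) {K : ℕ} (hK : 1 ≤ K)
    (hPK : ∀ x y, (P ^ K) x y < 1 / 2) : following P (1 / (2 * K)) ^ K = 0 := by
  set β : ℝ := 1 / (2 * K) with hβ
  have hK' : (1 : ℝ) ≤ K := by exact_mod_cast hK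
  have hKβ : K * β = 1 / 2 := by rw [hβ]; field_simp
  have hβ0 : 0 < β := by positivity
  have hβ1 : β ≤ 1 / 2 := by nlinarith
  -- A single path of almost deterministic transitions already has weight at least `(1 - β) ^ i`.
  have hpath : ∀ (i : ℕ) x y, (following P β ^ i) x y = 0 ∨ (1 - β) ^ i ≤ (following P β ^ i) x y := by
    intro i
    induction i with
    | zero =>
      intro x y
      by_cases h : x = y
      · right; simp [h]
      · left; simp [h]
    | succ i ih =>
      intro x y
      rw [pow_succ, Matrix.mul_apply]
      by_cases h : ∃ z, (following P β ^ i) x z ≠ 0 ∧ following P β z y ≠ 0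
      · right
        obtain ⟨z, h1, h2⟩ := h
        have h3 := (ih x z).resolve_left h1
        have h4 : 1 - β ≤ following P β z y := by
          simp only [following, Matrix.of_apply] at h2 ⊢
          split_ifs at h2 ⊢ with h5
          · exact absurd rfl h2
          · exact (not_le.1 h5).le
        calc (1 - β) ^ (i + 1) = (1 - β) ^ i * (1 - β) := pow_succ _ _
          _ ≤ (following P β ^ i) x z * following P β z y :=
            mul_le_mul h3 h4 (by linarith) (following_pow_nonneg hP i x z)
          _ ≤ _ := Finset.single_le_sum
            (f := fun z => (following P β ^ i) x z * following P β z y)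
            (fun z _ => mul_nonneg (following_pow_nonneg hP i x z) (following_nonneg hP z y))
            (Finset.mem_univ z)
      · left
        push Not at h
        refine Finset.sum_eq_zero fun z _ => ?_
        by_cases h1 : (following P β ^ i) x z = 0
        · rw [h1, zero_mul]
        · rw [h z h1, mul_zero]
  ext x y
  refine (hpath K x y).resolve_right fun h => ?_
  -- Bernoulli's inequality gives `(1 - β) ^ K ≥ 1 - K β = 1 / 2`, which contradicts the bound on
  -- the entries of `P ^ K`. This fixes the choice `β = 1 / (2 K)`.
  have h1 := one_add_mul_le_pow (a := -β) (by linarith) K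
  have h2 := following_pow_le (β := β) hP K x y
  have h3 := hPK x y
  rw [← sub_eq_add_neg] at h1
  nlinarith

/-- The energy of `f` for a weight on pairs. -/
def pairEnergy (θ : V → V → ℝ) (f : V → ℝ) : ℝ := ∑ y, ∑ z, θ y z * (f y - f z) ^ 2

theorem pairEnergy_nonneg {θ : V → V → ℝ} (hθ : ∀ y z, 0 ≤ θ y z) (f : V → ℝ) :
    0 ≤ pairEnergy θ f :=
  Finset.sum_nonneg fun y _ => Finset.sum_nonneg fun z _ => mul_nonneg (hθ y z) (sq_nonneg _)

theorem sub_sq_le_four {f : V → ℝ} (hf : ∀ x, |f x| ≤ 1) (y z : V) : (f y - f z) ^ 2 ≤ 4 := by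
  have h1 := abs_le.1 (hf y)
  have h2 := abs_le.1 (hf z)
  nlinarith

theorem pairEnergy_le {θ : V → V → ℝ} (hθ : ∀ y z, 0 ≤ θ y z) {f : V → ℝ}
    (hf : ∀ x, |f x| ≤ 1) : pairEnergy θ f ≤ 4 * ∑ y, ∑ z, θ y z := by
  simp only [pairEnergy, Finset.mul_sum]
  refine Finset.sum_le_sum fun y _ => Finset.sum_le_sum fun z _ => ?_
  nlinarith [mul_le_mul_of_nonneg_left (sub_sq_le_four hf y z) (hθ y z)]

theorem ringAt_sub_sq {f : V → ℝ} (x : V) {y z : V} (hyz : y ≠ z) :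
    (ringAt P f x y - ringAt P f x z) ^ 2 - (f y - f z) ^ 2 =
      (if y = x then 2 * (f y - f z) * jump P f y + jump P f y ^ 2 else 0) +
        (if z = x then -2 * (f y - f z) * jump P f z + jump P f z ^ 2 else 0) := by
  rw [ringAt_apply, ringAt_apply]
  by_cases h1 : y = x
  · by_cases h2 : z = x
    · exact absurd (h1.trans h2.symm) hyz
    · simp only [h1, h2, if_true, if_false]; ring
  · by_cases h2 : z = x
    · simp only [h1, h2, if_true, if_false]; ring
    · simp only [h1, h2, if_false]; ring

/-- The mean change of a pair energy when a uniformly chosen vertex rings. -/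
theorem sum_pairEnergy_ringAt {θ : V → V → ℝ} (hθ : ∀ y z, 0 ≤ θ y z) (hd : ∀ y, θ y y = 0)
    (f : V → ℝ) :
    (∑ y, ∑ z, θ y z * jump P f y ^ 2) / 2 - 4 * pairEnergy θ f ≤
      ∑ x, (pairEnergy θ (ringAt P f x) - pairEnergy θ f) := by
  have h1 : ∑ x, (pairEnergy θ (ringAt P f x) - pairEnergy θ f) =
      ∑ y, ∑ z, θ y z * (2 * (f y - f z) * jump P f y + jump P f y ^ 2 +
        (-2 * (f y - f z) * jump P f z + jump P f z ^ 2)) := by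
    simp only [pairEnergy, ← Finset.sum_sub_distrib]
    rw [Finset.sum_comm]
    refine Finset.sum_congr rfl fun y _ => ?_
    rw [Finset.sum_comm]
    refine Finset.sum_congr rfl fun z _ => ?_
    by_cases hyz : y = z
    · subst hyz; simp [hd]
    · simp only [← mul_sub, ← Finset.mul_sum, ringAt_sub_sq _ hyz, Finset.sum_add_distrib]
      simp
  rw [h1, pairEnergy, Finset.mul_sum, Finset.sum_div, ← Finset.sum_sub_distrib]
  refine Finset.sum_le_sum fun y _ => ?_
  rw [Finset.mul_sum, Finset.sum_div, ← Finset.sum_sub_distrib]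
  refine Finset.sum_le_sum fun z _ => ?_
  have := hθ y z
  -- Completing squares: the ring of `y` contributes at least half its squared jump minus `2 (f y -
  -- f z)²`, and the ring of `z` costs at most `(f y - f z)²`.
  have key : jump P f y ^ 2 / 2 - 4 * (f y - f z) ^ 2 ≤
      2 * (f y - f z) * jump P f y + jump P f y ^ 2 +
        (-2 * (f y - f z) * jump P f z + jump P f z ^ 2) := by
    nlinarith [sq_nonneg (jump P f y + 2 * (f y - f z)), sq_nonneg (jump P f z - (f y - f z))]
  nlinarith [mul_le_mul_of_nonneg_left key this]

/-- The change of a pair energy when one vertex rings. -/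
theorem abs_pairEnergy_ringAt_sub_le (hP : P ∈ rowStochastic ℝ V) {θ : V → V → ℝ}
    (hθ : ∀ y z, 0 ≤ θ y z) (hd : ∀ y, θ y y = 0) {f : V → ℝ} (hf : ∀ x, |f x| ≤ 1) (x : V) :
    |pairEnergy θ (ringAt P f x) - pairEnergy θ f| ≤
      4 * |jump P f x| * (∑ z, θ x z + ∑ y, θ y x) := by
  have hPf := abs_mulVec_le hP hf
  have h1 : pairEnergy θ (ringAt P f x) - pairEnergy θ f =
      ∑ z, θ x z * (2 * (f x - f z) * jump P f x + jump P f x ^ 2) +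
        ∑ y, θ y x * (-2 * (f y - f x) * jump P f x + jump P f x ^ 2) := by
    have h2 : ∀ y z, θ y z * (ringAt P f x y - ringAt P f x z) ^ 2 - θ y z * (f y - f z) ^ 2 =
        (if y = x then θ y z * (2 * (f y - f z) * jump P f y + jump P f y ^ 2) else 0) +
        (if z = x then θ y z * (-2 * (f y - f z) * jump P f z + jump P f z ^ 2) else 0) := by
      intro y z
      by_cases hyz : y = z
      · subst hyz; simp [hd]
      · rw [← mul_sub, ringAt_sub_sq x hyz, mul_add, mul_ite, mul_ite, mul_zero]
    simp only [pairEnergy, ← Finset.sum_sub_distrib, h2, Finset.sum_add_distrib]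
    congr 1
    · rw [Finset.sum_comm]; simp
    · simp
  have hjump : ∀ y, |2 * (f x - f y) * jump P f x + jump P f x ^ 2| ≤ 4 * |jump P f x| := by
    intro y
    have : 2 * (f x - f y) * jump P f x + jump P f x ^ 2 =
        (f x - f y + ((P *ᵥ f) x - f y)) * jump P f x := by rw [jump]; ring
    rw [this, abs_mul]
    refine mul_le_mul_of_nonneg_right ?_ (abs_nonneg _)
    have a := abs_le.1 (hf x)
    have b := abs_le.1 (hf y)
    have d := abs_le.1 (hPf x)
    rw [abs_le]
    constructor <;> linarith
  have hjump' : ∀ y, |-2 * (f y - f x) * jump P f x + jump P f x ^ 2| ≤ 4 * |jump P f x| := by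
    intro y
    have := hjump y
    rwa [show -2 * (f y - f x) = 2 * (f x - f y) by ring]
  rw [h1, mul_add, Finset.mul_sum, Finset.mul_sum]
  refine (abs_add_le _ _).trans (add_le_add ?_ ?_) <;>
    refine (Finset.abs_sum_le_sum_abs _ _).trans (Finset.sum_le_sum fun y _ => ?_)
  · rw [abs_mul, abs_of_nonneg (hθ x y), mul_comm]
    exact mul_le_mul_of_nonneg_right (hjump y) (hθ x y)
  · rw [abs_mul, abs_of_nonneg (hθ y x), mul_comm]
    exact mul_le_mul_of_nonneg_right (hjump' y) (hθ y x)

/-- One step of a pair energy whose weights depend on time. -/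
theorem pairEnergy_step {θ θ' ζ : V → V → ℝ} (hp : 0 ≤ p) (hθ : ∀ y z, 0 ≤ θ y z)
    (hd : ∀ y, θ y y = 0) (hζ : ∀ y z, 0 ≤ ζ y z) (h : ∀ y z, θ' y z ≤ (1 + 8 * p) * θ y z + p * ζ y z)
    {f : V → ℝ} (hf : ∀ x, |f x| ≤ 1) :
    p * ((∑ y, ∑ z, θ y z * jump P f y ^ 2) / 2 - 12 * pairEnergy θ f - 4 * ∑ y, ∑ z, ζ y z) ≤
      pairEnergy θ f + p * ∑ x, (pairEnergy θ (ringAt P f x) - pairEnergy θ f) -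
        pairEnergy θ' f := by
  have h1 : pairEnergy θ' f ≤ (1 + 8 * p) * pairEnergy θ f + p * pairEnergy ζ f := by
    simp only [pairEnergy, Finset.mul_sum, ← Finset.sum_add_distrib]
    refine Finset.sum_le_sum fun y _ => Finset.sum_le_sum fun z _ => ?_
    nlinarith [mul_le_mul_of_nonneg_right (h y z) (sq_nonneg (f y - f z))]
  -- The coefficient `12` is `4` from the rings plus `8` from the growth of the weights; the
  -- coefficient `4` of `ζ` bounds a squared difference of opinions.
  have h2 := mul_le_mul_of_nonneg_left (pairEnergy_le hζ hf) hp
  have h3 := mul_le_mul_of_nonneg_left (sum_pairEnergy_ringAt (P := P) hθ hd f) hp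
  nlinarith

/-- Weights on pairs: two children of an ancestor with law `u`, the first one through a branching
step, or a vertex reached by a branching step and `i - 1` further steps, and its child. -/
noncomputable def pairWeight (P : Matrix V V ℝ) (β : ℝ) : ℕ → (V → ℝ) → V → V → ℝ
  -- At every level the first coordinate is the vertex whose jumps the energy detects: the branched
  -- child at level `0`, the child of the vertex reached at later levels. The diagonal is removed
  -- because a vertex cannot move away from itself.
  | 0, u, y, z => if y = z then 0 else ∑ x, u x * branching P β x y * P x z
  | i + 1, u, z, y => if z = y then 0 else (u ᵥ* branchPow P β i) y * P y z

theorem pairWeight_self (i : ℕ) (u : V → ℝ) (y : V) : pairWeight P β i u y y = 0 := by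
  cases i <;> simp [pairWeight]

theorem pairWeight_nonneg (hP : P ∈ rowStochastic ℝ V) {u : V → ℝ} (hu : ∀ x, 0 ≤ u x) (i : ℕ)
    (y z : V) : 0 ≤ pairWeight P β i u y z := by
  cases i with
  | zero =>
    rw [pairWeight]
    split_ifs
    · exact le_rfl
    · exact Finset.sum_nonneg fun x _ => mul_nonneg (mul_nonneg (hu x) (branching_nonneg hP _ _))
        (nonneg_of_mem_rowStochastic hP)
  | succ i =>
    rw [pairWeight]
    split_ifs
    · exact le_rfl
    · exact mul_nonneg (vecMul_nonneg (branchPow_nonneg hP i) hu _)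
        (nonneg_of_mem_rowStochastic hP)

theorem pairWeight_le_add (hP : P ∈ rowStochastic ℝ V) {u v w : V → ℝ} {a b : ℝ}
    (h : ∀ x, u x ≤ a * v x + b * w x) (i : ℕ) (y z : V) :
    pairWeight P β i u y z ≤ a * pairWeight P β i v y z + b * pairWeight P β i w y z := by
  cases i with
  | zero =>
    simp only [pairWeight]
    split_ifs
    · simp
    · rw [Finset.mul_sum, Finset.mul_sum, ← Finset.sum_add_distrib]
      refine Finset.sum_le_sum fun x _ => ?_
      have := mul_le_mul_of_nonneg_right (h x) (mul_nonneg (branching_nonneg (β := β) hP x y)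
        (nonneg_of_mem_rowStochastic hP (i := x) (j := z)))
      linarith
  | succ i =>
    simp only [pairWeight]
    split_ifs
    · simp
    · have h1 : (u ᵥ* branchPow P β i) z ≤
          a * (v ᵥ* branchPow P β i) z + b * (w ᵥ* branchPow P β i) z := by
        simp only [vecMul, dotProduct]
        rw [Finset.mul_sum, Finset.mul_sum, ← Finset.sum_add_distrib]
        refine Finset.sum_le_sum fun x _ => ?_
        have := mul_le_mul_of_nonneg_right (h x) (branchPow_nonneg (β := β) hP i x z)
        linarith
      have := mul_le_mul_of_nonneg_right h1 (nonneg_of_mem_rowStochastic hP (i := z) (j := y))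
      linarith

theorem sum_pairWeight_le (hP : P ∈ rowStochastic ℝ V) {u : V → ℝ} (hu : ∀ x, 0 ≤ u x) (i : ℕ)
    (y : V) : ∑ z, pairWeight P β i u y z ≤ (u ᵥ* branchPow P β i) y := by
  have hn : ∀ {a b}, 0 ≤ P a b := nonneg_of_mem_rowStochastic hP
  cases i with
  | zero =>
    calc ∑ z, pairWeight P β 0 u y z
        ≤ ∑ z, ∑ x, u x * branching P β x y * P x z := by
          refine Finset.sum_le_sum fun z _ => ?_
          rw [pairWeight]
          split_ifs
          · exact Finset.sum_nonneg fun x _ =>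
              mul_nonneg (mul_nonneg (hu x) (branching_nonneg hP _ _)) hn
          · exact le_rfl
      _ = (u ᵥ* branchPow P β 0) y := by
          rw [Finset.sum_comm]
          simp [← Finset.mul_sum, sum_row_of_mem_rowStochastic hP, branchPow, vecMul, dotProduct]
  | succ i =>
    rw [branchPow, pow_succ, ← mul_assoc, ← Matrix.vecMul_vecMul]
    refine Finset.sum_le_sum fun z _ => ?_
    have := mul_nonneg (vecMul_nonneg (branchPow_nonneg (β := β) hP i) hu z) (hn (a := z) (b := y))
    rw [pairWeight]
    split_ifs
    · exact this
    · exact le_rfl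

theorem sum_pairWeight_zero_right_le (hP : P ∈ rowStochastic ℝ V) {u : V → ℝ}
    (hu : ∀ x, 0 ≤ u x) (z : V) : ∑ y, pairWeight P β 0 u y z ≤ (u ᵥ* P) z := by
  have hn : ∀ {a b}, 0 ≤ P a b := nonneg_of_mem_rowStochastic hP
  calc ∑ y, pairWeight P β 0 u y z
      ≤ ∑ y, ∑ x, u x * P x y * P x z := by
        refine Finset.sum_le_sum fun y _ => ?_
        rw [pairWeight]
        split_ifs
        · exact Finset.sum_nonneg fun x _ => mul_nonneg (mul_nonneg (hu x) hn) hn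
        · exact Finset.sum_le_sum fun x _ => mul_le_mul_of_nonneg_right
            (mul_le_mul_of_nonneg_left (branching_le hP x y) (hu x)) hn
    _ = (u ᵥ* P) z := by
        rw [Finset.sum_comm]
        simp [← Finset.mul_sum, ← Finset.sum_mul, sum_row_of_mem_rowStochastic hP, vecMul,
          dotProduct]

theorem sum_pairWeight_succ_right_le (hP : P ∈ rowStochastic ℝ V) {u : V → ℝ}
    (hu : ∀ x, 0 ≤ u x) (i : ℕ) (y : V) :
    ∑ z, pairWeight P β (i + 1) u z y ≤ (u ᵥ* branchPow P β i) y := by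
  have h0 := vecMul_nonneg (branchPow_nonneg (β := β) hP i) hu y
  calc ∑ z, pairWeight P β (i + 1) u z y
      ≤ ∑ z, (u ᵥ* branchPow P β i) y * P y z := by
        refine Finset.sum_le_sum fun z _ => ?_
        rw [pairWeight]
        split_ifs
        · exact mul_nonneg h0 (nonneg_of_mem_rowStochastic hP)
        · exact le_rfl
    _ = _ := by rw [← Finset.mul_sum, sum_row_of_mem_rowStochastic hP, mul_one]

theorem sum_vecMul_le {A : Matrix V V ℝ} (i : ℕ) (hP : P ∈ rowStochastic ℝ V)
    (hA : ∀ x y, A x y ≤ (P ^ i) x y) {u : V → ℝ} (hu : ∀ x, 0 ≤ u x) :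
    ∑ y, (u ᵥ* A) y ≤ ∑ x, u x :=
  (Finset.sum_le_sum fun y _ => vecMul_mono_right hA hu y).trans_eq (sum_vecMul (pow_mem hP i) u)

theorem sum_sum_pairWeight_le (hP : P ∈ rowStochastic ℝ V) {u : V → ℝ} (hu : ∀ x, 0 ≤ u x)
    (i : ℕ) : ∑ y, ∑ z, pairWeight P β i u y z ≤ ∑ x, u x :=
  (Finset.sum_le_sum fun y _ => sum_pairWeight_le hP hu i y).trans
    (sum_vecMul_le (i + 1) hP (branchPow_le hP i) hu)

/-- Two children of `x` are two independent samples from row `x`, so `locVar_eq_sum` applies. -/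
theorem pairEnergy_pairWeight_zero_le (hP : P ∈ rowStochastic ℝ V) {u : V → ℝ}
    (hu : ∀ x, 0 ≤ u x) (f : V → ℝ) :
    pairEnergy (pairWeight P β 0 u) f ≤ 2 * ∑ x, u x * locVar P f x := by
  have hn : ∀ {a b}, 0 ≤ P a b := nonneg_of_mem_rowStochastic hP
  have h1 : 2 * ∑ x, u x * locVar P f x =
      ∑ y, ∑ z, ∑ x, u x * (P x y * P x z * (f y - f z) ^ 2) := by
    rw [Finset.mul_sum]
    simp only [fun x => show 2 * (u x * locVar P f x) = u x * (2 * locVar P f x) by ring,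
      ← locVar_eq_sum hP, Finset.mul_sum]
    rw [Finset.sum_comm]
    exact Finset.sum_congr rfl fun y _ => Finset.sum_comm
  rw [h1, pairEnergy]
  refine Finset.sum_le_sum fun y _ => Finset.sum_le_sum fun z _ => ?_
  rw [pairWeight]
  split_ifs
  · rw [zero_mul]
    exact Finset.sum_nonneg fun x _ => mul_nonneg (hu x) (mul_nonneg (mul_nonneg hn hn)
      (sq_nonneg _))
  · rw [Finset.sum_mul]
    refine Finset.sum_le_sum fun x _ => ?_
    have := mul_le_mul_of_nonneg_right (mul_le_mul_of_nonneg_right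
      (mul_le_mul_of_nonneg_left (branching_le (β := β) hP x y) (hu x)) (hn (a := x) (b := z)))
      (sq_nonneg (f y - f z))
    linarith

/-- A branching transition has probability at most `1 - β`, so the sibling differs from `y` with
probability at least `β`. This is where excluding the almost deterministic transitions matters. -/
theorem le_sum_pairWeight_zero (hP : P ∈ rowStochastic ℝ V) {u : V → ℝ}
    (hu : ∀ x, 0 ≤ u x) (g : V → ℝ) (hg : ∀ x, 0 ≤ g x) :
    β * ∑ y, (u ᵥ* branchPow P β 0) y * g y ≤ ∑ y, ∑ z, pairWeight P β 0 u y z * g y := by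
  rw [Finset.mul_sum]
  refine Finset.sum_le_sum fun y _ => ?_
  rw [← Finset.sum_mul]
  have h1 : ∑ z, pairWeight P β 0 u y z = ∑ x, u x * branching P β x y * (1 - P x y) := by
    have h2 : ∀ z, pairWeight P β 0 u y z = ∑ x, u x * branching P β x y * P x z -
        if y = z then ∑ x, u x * branching P β x y * P x z else 0 := by
      intro z
      rw [pairWeight]
      split_ifs <;> simp
    simp only [h2, Finset.sum_sub_distrib, Finset.sum_ite_eq, Finset.mem_univ, if_true]
    rw [Finset.sum_comm, ← Finset.sum_sub_distrib]
    refine Finset.sum_congr rfl fun x _ => ?_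
    rw [← Finset.mul_sum, sum_row_of_mem_rowStochastic hP]; ring
  rw [h1, ← mul_assoc]
  refine mul_le_mul_of_nonneg_right ?_ (hg y)
  simp only [branchPow, pow_zero, mul_one, vecMul, dotProduct, Finset.mul_sum]
  refine Finset.sum_le_sum fun x _ => ?_
  rw [mul_comm]
  by_cases h : P x y ≤ 1 - β
  · exact mul_le_mul_of_nonneg_left (by linarith)
      (mul_nonneg (hu x) (branching_nonneg hP x y))
  · simp [branching, h]

/-- The energy of the parent-child pairs is the second moment of the child's opinion around the
parent's; it is controlled by the jumps one level above and the local variance. -/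
theorem pairEnergy_pairWeight_succ (hP : P ∈ rowStochastic ℝ V) (u : V → ℝ) (i : ℕ) (f : V → ℝ) :
    pairEnergy (pairWeight P β (i + 1) u) f =
      ∑ y, (u ᵥ* branchPow P β i) y * (jump P f y ^ 2 + locVar P f y) := by
  simp only [← sum_mul_sub_sq hP, Finset.mul_sum]
  rw [pairEnergy, Finset.sum_comm]
  refine Finset.sum_congr rfl fun y _ => Finset.sum_congr rfl fun z _ => ?_
  rw [pairWeight]
  split_ifs with h
  · simp [h]
  · ring

/-- Removing the diagonal costs the self-loop term; for squared jumps it is bounded by the local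
variance through `diag_mul_jump_sq_le`. -/
theorem sum_pairWeight_succ_mul (u : V → ℝ) (i : ℕ) (g : V → ℝ) :
    ∑ z, ∑ y, pairWeight P β (i + 1) u z y * g z =
      ∑ z, (u ᵥ* branchPow P β (i + 1)) z * g z - ∑ z, (u ᵥ* branchPow P β i) z * P z z * g z := by
  rw [← Finset.sum_sub_distrib]
  refine Finset.sum_congr rfl fun z _ => ?_
  rw [← Finset.sum_mul, ← sub_mul]
  congr 1
  rw [branchPow, pow_succ, ← mul_assoc, ← Matrix.vecMul_vecMul]
  have h2 : ∀ y, pairWeight P β (i + 1) u z y = (u ᵥ* branchPow P β i) y * P y z -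
      if z = y then (u ᵥ* branchPow P β i) y * P y z else 0 := by
    intro y
    rw [pairWeight]
    split_ifs <;> simp
  simp only [h2, Finset.sum_sub_distrib, Finset.sum_ite_eq, Finset.mem_univ, if_true]
  rfl

end Lyapunov

end DeGroot

namespace DeGroot

open Matrix

/-! ### Drift of the pair energies and of the Lyapunov functional. -/

section Drift

set_option linter.unusedSectionVars false

variable {V : Type*} [Fintype V] [DecidableEq V] {P : Matrix V V ℝ} {p : ℝ} {M : V → ℝ} {β : ℝ}

/-- The mean squared jump below a branching `i` generations ago. -/
noncomputable def branchEnergy (P : Matrix V V ℝ) (p : ℝ) (M : V → ℝ) (β : ℝ) (i m : ℕ)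
    (f : V → ℝ) : ℝ :=
  ∑ y, (anc P p M (i + 1) m ᵥ* branchPow P β i) y * jump P f y ^ 2

/-- The mean local variance at the position of the lazy walk after `m` steps. -/
noncomputable def varEnergy (P : Matrix V V ℝ) (p : ℝ) (M : V → ℝ) (m : ℕ) (f : V → ℝ) : ℝ :=
  ∑ x, anc P p M 0 m x * locVar P f x

/-- The mean squared jump at the position of the lazy walk after `m` steps. -/
noncomputable def jumpEnergy (P : Matrix V V ℝ) (p : ℝ) (M : V → ℝ) (m : ℕ) (f : V → ℝ) : ℝ :=
  ∑ x, anc P p M 0 m x * jump P f x ^ 2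

/-- The pair energy of level `i`. -/
noncomputable def levelEnergy (P : Matrix V V ℝ) (p : ℝ) (M : V → ℝ) (β : ℝ) (i m : ℕ)
    (f : V → ℝ) : ℝ :=
  pairEnergy (pairWeight P β i (anc P p M (i + 1) m)) f

theorem sum_mul_le_mul_sum {u g : V → ℝ} {c : ℝ} (hu : ∀ x, 0 ≤ u x) (hg : ∀ x, g x ≤ c) :
    ∑ x, u x * g x ≤ c * ∑ x, u x := by
  rw [Finset.mul_sum]
  exact Finset.sum_le_sum fun x _ => by nlinarith [mul_le_mul_of_nonneg_left (hg x) (hu x)]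

theorem branchEnergy_nonneg (hP : P ∈ rowStochastic ℝ V) (h0 : 0 ≤ p) (h1 : p ≤ 1)
    (hM : ∀ x, 0 ≤ M x) (i m : ℕ) (f : V → ℝ) : 0 ≤ branchEnergy P p M β i m f :=
  Finset.sum_nonneg fun y _ => mul_nonneg
    (vecMul_nonneg (branchPow_nonneg hP i) (anc_nonneg hP h0 h1 hM _ _) y) (sq_nonneg _)

theorem varEnergy_nonneg (hP : P ∈ rowStochastic ℝ V) (h0 : 0 ≤ p) (h1 : p ≤ 1)
    (hM : ∀ x, 0 ≤ M x) (m : ℕ) (f : V → ℝ) : 0 ≤ varEnergy P p M m f :=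
  Finset.sum_nonneg fun y _ => mul_nonneg (anc_nonneg hP h0 h1 hM _ _ _) (locVar_nonneg hP f y)

theorem jumpEnergy_nonneg (hP : P ∈ rowStochastic ℝ V) (h0 : 0 ≤ p) (h1 : p ≤ 1)
    (hM : ∀ x, 0 ≤ M x) (m : ℕ) (f : V → ℝ) : 0 ≤ jumpEnergy P p M m f :=
  Finset.sum_nonneg fun _ _ => mul_nonneg (anc_nonneg hP h0 h1 hM _ _ _) (sq_nonneg _)

theorem anc_vecMul_branchPow_le (hP : P ∈ rowStochastic ℝ V) (h0 : 0 ≤ p) (h1 : p ≤ 1)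
    (hM : ∀ x, 0 ≤ M x) (i m : ℕ) (x : V) :
    (anc P p M (i + 1) m ᵥ* branchPow P β i) x ≤ anc P p M 0 m x :=
  (vecMul_mono_right (branchPow_le hP i) (anc_nonneg hP h0 h1 hM _ _) x).trans
    (anc_vecMul_pow_le hP h0 h1 hM (i + 1) m x)

/-- Jumps of a branched child feed the sibling energy, which is itself bounded by the local variance
of the parent. Passing from the law of the parent to the law of the present position costs the
factor `16` of `exists_anc_succ_le`; then `12 * 2 * 16 ≤ 400`. -/
theorem levelEnergy_zero_drift (hP : P ∈ rowStochastic ℝ V) (h0 : 0 < p) (h1 : p ≤ 1 / 16)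
    (hM : ∀ x, 0 ≤ M x) (hM1 : ∑ x, M x = 1) (m : ℕ) {f : V → ℝ} (hf : ∀ x, |f x| ≤ 1) :
    p * (β / 2 * branchEnergy P p M β 0 m f - 400 * varEnergy P p M m f -
        100 * Real.exp (-(p * m / 2))) ≤
      levelEnergy P p M β 0 m f +
        p * ∑ x, (levelEnergy P p M β 0 m (ringAt P f x) - levelEnergy P p M β 0 m f) -
        levelEnergy P p M β 0 (m + 1) f := by
  have hp1 : p ≤ 1 := by linarith
  have hu := anc_nonneg hP h0.le hp1 hM
  obtain ⟨ζ, hζ0, hζ1, hζ⟩ := exists_anc_step_le hP h0 h1 hM hM1 0 m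
  obtain ⟨ξ, hξ0, hξ1, hξ⟩ := exists_anc_succ_le hP h0 h1 hM hM1 0 m
  have step := pairEnergy_step (P := P) (p := p) h0.le
    (pairWeight_nonneg (β := β) hP (hu 1 m) 0) (pairWeight_self 0 _)
    (pairWeight_nonneg (β := β) hP hζ0 0) (fun y z => pairWeight_le_add hP hζ 0 y z) hf
  refine le_trans (mul_le_mul_of_nonneg_left ?_ h0.le) step
  have a := le_sum_pairWeight_zero (β := β) hP (hu 1 m) (fun y => jump P f y ^ 2)
    (fun _ => sq_nonneg _)
  have b := pairEnergy_pairWeight_zero_le (β := β) hP (hu 1 m) f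
  have d := sum_sum_pairWeight_le (β := β) hP hζ0 0
  have e : ∑ x, anc P p M 1 m x * locVar P f x ≤
      16 * varEnergy P p M m f + Real.exp (-(p * m / 2)) := by
    have e1 : ∑ x, anc P p M 1 m x * locVar P f x ≤
        ∑ x, (16 * (anc P p M 0 m x * locVar P f x) + ξ x * locVar P f x) :=
      Finset.sum_le_sum fun x _ => by
        nlinarith [mul_le_mul_of_nonneg_right (hξ x) (locVar_nonneg hP f x)]
    rw [Finset.sum_add_distrib, ← Finset.mul_sum] at e1
    have := sum_mul_le_mul_sum hξ0 (locVar_le_one hP hf)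
    rw [varEnergy]; linarith
  have hv := varEnergy_nonneg hP h0.le hp1 hM m f
  have he := Real.exp_pos (-(p * m / 2))
  simp only [branchEnergy] at *
  simp only [zero_add] at *
  linarith

/-- Jumps one generation further down feed the parent-child energy. This energy involves the squared
jumps of the parent, whence the loss `192 = 12 * 16` times the quantity of the level above. -/
theorem levelEnergy_succ_drift (hP : P ∈ rowStochastic ℝ V) (h0 : 0 < p) (h1 : p ≤ 1 / 16)
    (hM : ∀ x, 0 ≤ M x) (hM1 : ∑ x, M x = 1) (hβ : β ≤ 1) (i m : ℕ) {f : V → ℝ}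
    (hf : ∀ x, |f x| ≤ 1) :
    p * (β / 2 * branchEnergy P p M β (i + 1) m f - 192 * branchEnergy P p M β i m f -
        400 * varEnergy P p M m f - 100 * Real.exp (-(p * m / 2))) ≤
      levelEnergy P p M β (i + 1) m f +
        p * ∑ x, (levelEnergy P p M β (i + 1) m (ringAt P f x) -
          levelEnergy P p M β (i + 1) m f) -
        levelEnergy P p M β (i + 1) (m + 1) f := by
  have hp1 : p ≤ 1 := by linarith
  have hu := anc_nonneg hP h0.le hp1 hM
  obtain ⟨ζ, hζ0, hζ1, hζ⟩ := exists_anc_step_le hP h0 h1 hM hM1 (i + 1) m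
  obtain ⟨ξ, hξ0, hξ1, hξ⟩ := exists_anc_succ_le hP h0 h1 hM hM1 (i + 1) m
  have step := pairEnergy_step (P := P) (p := p) h0.le
    (pairWeight_nonneg (β := β) hP (hu (i + 1 + 1) m) (i + 1)) (pairWeight_self (i + 1) _)
    (pairWeight_nonneg (β := β) hP hζ0 (i + 1))
    (fun y z => pairWeight_le_add hP hζ (i + 1) y z) hf
  refine le_trans (mul_le_mul_of_nonneg_left ?_ h0.le) step
  have a := sum_pairWeight_succ_mul (P := P) (β := β) (anc P p M (i + 1 + 1) m) i
    (fun y => jump P f y ^ 2)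
  have b := pairEnergy_pairWeight_succ (β := β) hP (anc P p M (i + 1 + 1) m) i f
  have d := sum_sum_pairWeight_le (β := β) hP hζ0 (i + 1)
  have hB := branchPow_nonneg (β := β) hP i
  have key : ∀ g : V → ℝ, (∀ x, 0 ≤ g x) → ∀ c : ℝ, 0 ≤ c → (∀ x, g x ≤ c) →
      ∑ y, (anc P p M (i + 1 + 1) m ᵥ* branchPow P β i) y * g y ≤
        16 * ∑ y, (anc P p M (i + 1) m ᵥ* branchPow P β i) y * g y +
          c * Real.exp (-(p * m / 2)) := by
    intro g hg c hc hgc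
    have e0 : ∀ y, (anc P p M (i + 1 + 1) m ᵥ* branchPow P β i) y ≤
        16 * (anc P p M (i + 1) m ᵥ* branchPow P β i) y + (ξ ᵥ* branchPow P β i) y := by
      intro y
      simp only [vecMul, dotProduct, Finset.mul_sum, ← Finset.sum_add_distrib]
      exact Finset.sum_le_sum fun x _ => by
        nlinarith [mul_le_mul_of_nonneg_right (hξ x) (hB x y)]
    have e1 : ∑ y, (anc P p M (i + 1 + 1) m ᵥ* branchPow P β i) y * g y ≤
        ∑ y, (16 * ((anc P p M (i + 1) m ᵥ* branchPow P β i) y * g y) +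
          (ξ ᵥ* branchPow P β i) y * g y) :=
      Finset.sum_le_sum fun y _ => by
        nlinarith [mul_le_mul_of_nonneg_right (e0 y) (hg y)]
    rw [Finset.sum_add_distrib, ← Finset.mul_sum] at e1
    have e2 := sum_mul_le_mul_sum (vecMul_nonneg hB hξ0) hgc
    have e3 := sum_vecMul_le (i + 1) hP (branchPow_le (β := β) hP i) hξ0
    have := mul_le_mul_of_nonneg_left (e3.trans hξ1) hc
    linarith
  have hVar : ∑ y, (anc P p M (i + 1) m ᵥ* branchPow P β i) y * locVar P f y ≤
      varEnergy P p M m f :=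
    Finset.sum_le_sum fun y _ => mul_le_mul_of_nonneg_right
      (anc_vecMul_branchPow_le hP h0.le hp1 hM i m y) (locVar_nonneg hP f y)
  have k1 := key (fun y => jump P f y ^ 2) (fun _ => sq_nonneg _) 4 (by norm_num)
    (jump_sq_le hP hf)
  have k2 := key (fun y => locVar P f y) (locVar_nonneg hP f) 1 (by norm_num)
    (locVar_le_one hP hf)
  have k3 : ∑ z, (anc P p M (i + 1 + 1) m ᵥ* branchPow P β i) z * P z z * jump P f z ^ 2 ≤
      ∑ z, (anc P p M (i + 1 + 1) m ᵥ* branchPow P β i) z * locVar P f z :=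
    Finset.sum_le_sum fun z _ => by
      rw [mul_assoc]
      exact mul_le_mul_of_nonneg_left (diag_mul_jump_sq_le hP f z) (vecMul_nonneg hB (hu _ _) z)
  simp only [mul_add, Finset.sum_add_distrib] at b
  have hv := varEnergy_nonneg hP h0.le hp1 hM m f
  have he := Real.exp_pos (-(p * m / 2))
  have hX := mul_le_mul_of_nonneg_right hβ
    (branchEnergy_nonneg (β := β) hP h0.le hp1 hM (i + 1) m f)
  simp only [branchEnergy] at *
  linarith

/-- The Lyapunov functional. -/
noncomputable def lyap (P : Matrix V V ℝ) (p : ℝ) (M : V → ℝ) (β : ℝ) (K m : ℕ) (f : V → ℝ) : ℝ :=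
  800 * ∑ x, anc P p M 0 m x * f x ^ 2 -
    ∑ i ∈ Finset.range K, (β / 1000) ^ i * levelEnergy P p M β i m f

theorem sum_range_pow_le_two {q : ℝ} (h0 : 0 ≤ q) (h1 : q ≤ 1 / 2) (K : ℕ) :
    ∑ i ∈ Finset.range K, q ^ i ≤ 2 := by
  have h : ∀ K : ℕ, ∑ i ∈ Finset.range K, q ^ i ≤ 2 - 2 * q ^ K ∧ q ^ K ≤ 1 := by
    intro K
    induction K with
    | zero => norm_num
    | succ K ih =>
      rw [Finset.sum_range_succ, pow_succ]
      have := pow_nonneg h0 K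
      constructor <;> nlinarith
  linarith [(h K).1, pow_nonneg h0 K]

/-- A ring replaces `f x ^ 2` by the square of an average, whereas one further step of the walk
averages the squares; the difference is the local variance. -/
theorem sum_anc_zero_sq_drift (m : ℕ) (f : V → ℝ) :
    (∑ x, anc P p M 0 m x * f x ^ 2) + p * ∑ y, (∑ x, anc P p M 0 m x * ringAt P f y x ^ 2 -
        ∑ x, anc P p M 0 m x * f x ^ 2) - ∑ x, anc P p M 0 (m + 1) x * f x ^ 2 =
      -(p * varEnergy P p M m f) := by
  have h1 : ∑ x, anc P p M 0 (m + 1) x * f x ^ 2 =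
      ∑ x, anc P p M 0 m x * ((1 - p) * f x ^ 2 + p * (P *ᵥ fun y => f y ^ 2) x) := by
    have : anc P p M 0 (m + 1) = anc P p M 0 m ᵥ* lazyMat P p := by
      rw [anc_zero, anc_zero, pow_succ, Matrix.vecMul_vecMul]
    change (anc P p M 0 (m + 1)) ⬝ᵥ (fun x => f x ^ 2) = _
    rw [this, ← Matrix.dotProduct_mulVec]
    refine Finset.sum_congr rfl fun x _ => ?_
    rw [lazyMat_mulVec, jump]; ring
  have h2 : ∑ y, (∑ x, anc P p M 0 m x * ringAt P f y x ^ 2 -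
      ∑ x, anc P p M 0 m x * f x ^ 2) = ∑ x, anc P p M 0 m x * ((P *ᵥ f) x ^ 2 - f x ^ 2) := by
    simp only [← Finset.sum_sub_distrib, ← mul_sub]
    rw [Finset.sum_comm]
    refine Finset.sum_congr rfl fun x _ => ?_
    rw [← Finset.mul_sum]
    congr 1
    rw [Finset.sum_eq_single x]
    · simp [ringAt]
    · intro y _ hy
      rw [ringAt, Function.update_of_ne hy.symm, sub_self]
    · simp
  rw [h1, h2, varEnergy]
  simp only [Finset.mul_sum, ← Finset.sum_add_distrib, ← Finset.sum_sub_distrib,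
    ← Finset.sum_neg_distrib]
  refine Finset.sum_congr rfl fun x _ => ?_
  rw [locVar]; ring

/-- With ratio `β / 1000` between consecutive levels, the loss `192` of level `i + 1` is paid by
half of the gain `β / 2` of level `i`, since `192 / 1000 ≤ 1 / 4`. -/
theorem levelEnergy_sum_drift (hP : P ∈ rowStochastic ℝ V) (h0 : 0 < p) (h1 : p ≤ 1 / 16)
    (hM : ∀ x, 0 ≤ M x) (hM1 : ∑ x, M x = 1) (hβ0 : 0 ≤ β) (hβ : β ≤ 1) (K m : ℕ) {f : V → ℝ}
    (hf : ∀ x, |f x| ≤ 1) :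
    p * (β / 4 * ∑ i ∈ Finset.range K, (β / 1000) ^ i * branchEnergy P p M β i m f -
        (400 * varEnergy P p M m f + 100 * Real.exp (-(p * m / 2))) *
          ∑ i ∈ Finset.range K, (β / 1000) ^ i) ≤
      ∑ i ∈ Finset.range K, (β / 1000) ^ i * (levelEnergy P p M β i m f +
        p * ∑ x, (levelEnergy P p M β i m (ringAt P f x) - levelEnergy P p M β i m f) -
        levelEnergy P p M β i (m + 1) f) := by
  have hp1 : p ≤ 1 := by linarith
  have hX := fun i => branchEnergy_nonneg (β := β) hP h0.le hp1 hM i m f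
  have hq : 0 ≤ β / 1000 := by positivity
  cases K with
  | zero => simp
  | succ K =>
    -- The strengthened claim keeps the full gain `β / 2` at the highest level; the extra half pays
    -- for the next level in the induction.
    suffices h : p * (β / 4 * ∑ i ∈ Finset.range (K + 1), (β / 1000) ^ i * branchEnergy P p M β i m f
        + β / 4 * ((β / 1000) ^ K * branchEnergy P p M β K m f) -
        (400 * varEnergy P p M m f + 100 * Real.exp (-(p * m / 2))) *
          ∑ i ∈ Finset.range (K + 1), (β / 1000) ^ i) ≤
      ∑ i ∈ Finset.range (K + 1), (β / 1000) ^ i * (levelEnergy P p M β i m f +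
        p * ∑ x, (levelEnergy P p M β i m (ringAt P f x) - levelEnergy P p M β i m f) -
        levelEnergy P p M β i (m + 1) f) by
      refine le_trans (mul_le_mul_of_nonneg_left ?_ h0.le) h
      have := mul_nonneg (by positivity : 0 ≤ β / 4) (mul_nonneg (pow_nonneg hq K) (hX K))
      linarith
    induction K with
    | zero =>
      have := levelEnergy_zero_drift (β := β) hP h0 h1 hM hM1 m hf
      simp only [zero_add, Finset.sum_range_one, pow_zero, one_mul] at this ⊢
      linarith
    | succ K ih =>
      rw [Finset.sum_range_succ, Finset.sum_range_succ (n := K + 1),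
        Finset.sum_range_succ (n := K + 1)]
      have s := mul_le_mul_of_nonneg_left
        (levelEnergy_succ_drift (β := β) hP h0 h1 hM hM1 hβ K m hf) (pow_nonneg hq (K + 1))
      have e1 : (β / 1000) ^ (K + 1) * 192 * branchEnergy P p M β K m f ≤
          β / 4 * ((β / 1000) ^ K * branchEnergy P p M β K m f) := by
        have := mul_nonneg (mul_nonneg (pow_nonneg hq K) (hX K)) hβ0
        rw [pow_succ]; nlinarith
      have e2 := mul_le_mul_of_nonneg_left e1 h0.le
      nlinarith

/-- The stationary decomposition of the law of the lazy walk according to its last branching. -/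
theorem sum_anc_zero_mul_le (hP : P ∈ rowStochastic ℝ V) (h0 : 0 ≤ p) (h1 : p ≤ 1)
    (hM : ∀ x, 0 ≤ M x) (hM1 : ∑ x, M x = 1) (K m : ℕ) {g : V → ℝ} {c : ℝ} (hg : ∀ x, 0 ≤ g x)
    (hgc : ∀ x, g x ≤ c) :
    ∑ x, anc P p M 0 m x * g x ≤ c * ∑ i ∈ Finset.range K, binom p m i +
      ∑ i ∈ Finset.range K, ∑ x, (anc P p M (i + 1) m ᵥ* branchPow P β i) x * g x +
      ∑ x, (anc P p M K m ᵥ* following P β ^ K) x * g x := by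
  induction K with
  | zero => simp
  | succ K ih =>
    have hc : 0 ≤ c := by
      by_contra hc
      have : ∀ x, M x = 0 := fun x => absurd ((hg x).trans (hgc x)) hc
      simp [this] at hM1
    have hu := anc_nonneg hP h0 h1 hM (K + 1) m
    rw [Finset.sum_range_succ, Finset.sum_range_succ]
    -- The ancestor of generation `K` is the starting point, or it is reached by a branching step,
    -- or by an almost deterministic step that prolongs the following path.
    have e1 : ∀ x, (anc P p M K m ᵥ* following P β ^ K) x ≤
        binom p m K * (M ᵥ* following P β ^ K) x +
          (anc P p M (K + 1) m ᵥ* branchPow P β K) x +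
          (anc P p M (K + 1) m ᵥ* following P β ^ (K + 1)) x := by
      intro x
      have e2 : anc P p M (K + 1) m ᵥ* P ᵥ* following P β ^ K =
          anc P p M (K + 1) m ᵥ* (branching P β * following P β ^ K) +
            anc P p M (K + 1) m ᵥ* following P β ^ (K + 1) := by
        rw [Matrix.vecMul_vecMul, ← Matrix.vecMul_add, pow_succ', ← add_mul,
          branching_add_following]
      rw [anc_eq_add, Matrix.add_vecMul, Matrix.smul_vecMul, e2]
      have e3 := vecMul_mono_right (A' := branchPow P β K) (mul_le_mul_entries
        (branching_nonneg (β := β) hP)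
        (following_pow_nonneg (β := β) hP K) (fun _ _ => le_rfl) (following_pow_le hP K)) hu x
      simp only [Pi.add_apply, Pi.smul_apply, smul_eq_mul]
      linarith
    have e4 : ∑ x, (anc P p M K m ᵥ* following P β ^ K) x * g x ≤
        ∑ x, (binom p m K * ((M ᵥ* following P β ^ K) x * g x) +
          (anc P p M (K + 1) m ᵥ* branchPow P β K) x * g x +
          (anc P p M (K + 1) m ᵥ* following P β ^ (K + 1)) x * g x) :=
      Finset.sum_le_sum fun x _ => by nlinarith [mul_le_mul_of_nonneg_right (e1 x) (hg x)]
    rw [Finset.sum_add_distrib, Finset.sum_add_distrib, ← Finset.mul_sum] at e4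
    have e5 := sum_mul_le_mul_sum (vecMul_nonneg (following_pow_nonneg (β := β) hP K) hM) hgc
    have e6 := sum_vecMul_le K hP (following_pow_le (β := β) hP K) hM
    rw [hM1] at e6
    have e7 := mul_le_mul_of_nonneg_left (e5.trans (mul_le_mul_of_nonneg_left e6 hc))
      (binom_nonneg h0 h1 m K)
    nlinarith

/-- The Lyapunov functional decreases at the rate of the mean squared jump. -/
theorem lyap_drift (hP : P ∈ rowStochastic ℝ V) (h0 : 0 < p) (h1 : p ≤ 1 / 16)
    (hM : ∀ x, 0 ≤ M x) (hM1 : ∑ x, M x = 1) (hβ0 : 0 ≤ β) (hβ : β ≤ 1) {K : ℕ}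
    (hK : following P β ^ K = 0) (m : ℕ) {f : V → ℝ} (hf : ∀ x, |f x| ≤ 1) :
    lyap P p M β K m f + p * ∑ x, (lyap P p M β K m (ringAt P f x) - lyap P p M β K m f) -
        lyap P p M β K (m + 1) f ≤
      p * (-(β / 4 * (β / 1000) ^ K) * jumpEnergy P p M m f +
        (200 + 4 * Real.exp K) * Real.exp (-(p * m / 2))) := by
  have hp1 : p ≤ 1 := by linarith
  have hq : 0 ≤ β / 1000 := by positivity
  have hq1 : β / 1000 ≤ 1 := by linarith
  have d1 := sum_anc_zero_sq_drift (P := P) (p := p) (M := M) m f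
  have d2 := levelEnergy_sum_drift (β := β) hP h0 h1 hM hM1 hβ0 hβ K m hf
  have d3 := sum_anc_zero_mul_le (β := β) hP h0.le hp1 hM hM1 K m
    (g := fun x => jump P f x ^ 2) (fun _ => sq_nonneg _) (jump_sq_le hP hf)
  -- No following path has length `K`: up to the lower binomial tail, every squared jump lies below
  -- one of the last `K` branchings.
  rw [hK] at d3
  simp only [Matrix.vecMul_zero, Pi.zero_apply, zero_mul, Finset.sum_const_zero, add_zero] at d3
  have hid : lyap P p M β K m f +
      p * ∑ x, (lyap P p M β K m (ringAt P f x) - lyap P p M β K m f) -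
        lyap P p M β K (m + 1) f = 800 * ((∑ x, anc P p M 0 m x * f x ^ 2) +
        p * ∑ y, (∑ x, anc P p M 0 m x * ringAt P f y x ^ 2 -
        ∑ x, anc P p M 0 m x * f x ^ 2) - ∑ x, anc P p M 0 (m + 1) x * f x ^ 2) -
      ∑ i ∈ Finset.range K, (β / 1000) ^ i * (levelEnergy P p M β i m f +
        p * ∑ x, (levelEnergy P p M β i m (ringAt P f x) - levelEnergy P p M β i m f) -
        levelEnergy P p M β i (m + 1) f) := by
    have : ∑ i ∈ Finset.range K, (β / 1000) ^ i * (levelEnergy P p M β i m f +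
        p * ∑ x, (levelEnergy P p M β i m (ringAt P f x) - levelEnergy P p M β i m f) -
        levelEnergy P p M β i (m + 1) f) =
        ∑ i ∈ Finset.range K, (β / 1000) ^ i * levelEnergy P p M β i m f +
        p * ∑ x, (∑ i ∈ Finset.range K, (β / 1000) ^ i * levelEnergy P p M β i m (ringAt P f x) -
          ∑ i ∈ Finset.range K, (β / 1000) ^ i * levelEnergy P p M β i m f) -
        ∑ i ∈ Finset.range K, (β / 1000) ^ i * levelEnergy P p M β i (m + 1) f := by
      simp only [← Finset.sum_sub_distrib]
      rw [Finset.sum_comm, Finset.mul_sum, ← Finset.sum_add_distrib, ← Finset.sum_sub_distrib]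
      refine Finset.sum_congr rfl fun i _ => ?_
      simp only [← mul_sub, ← Finset.mul_sum]
      ring
    rw [this]
    simp only [lyap, Finset.sum_sub_distrib, ← Finset.mul_sum]
    ring
  rw [hid, d1]
  have hX := fun i => branchEnergy_nonneg (β := β) hP h0.le hp1 hM i m f
  have hv := varEnergy_nonneg hP h0.le hp1 hM m f
  have he := Real.exp_pos (-(p * m / 2))
  have hS := sum_range_pow_le_two hq (by linarith) K
  have t1 : (β / 1000) ^ K * ∑ i ∈ Finset.range K, branchEnergy P p M β i m f ≤
      ∑ i ∈ Finset.range K, (β / 1000) ^ i * branchEnergy P p M β i m f := by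
    rw [Finset.mul_sum]
    exact Finset.sum_le_sum fun i hi => mul_le_mul_of_nonneg_right
      (pow_le_pow_of_le_one hq hq1 (Finset.mem_range.1 hi).le) (hX i)
  have t2 : ∑ i ∈ Finset.range K, binom p m i ≤ Real.exp K * Real.exp (-(p * m / 2)) := by
    refine (sum_binom_lt_le h0.le hp1 m K).trans (mul_le_mul_of_nonneg_right
      (Real.exp_le_exp.2 ?_) he.le)
    have : 0 ≤ p * m / 8 := by positivity
    linarith
  have t3 : jumpEnergy P p M m f ≤ 4 * (Real.exp K * Real.exp (-(p * m / 2))) +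
      ∑ i ∈ Finset.range K, branchEnergy P p M β i m f := by
    unfold jumpEnergy branchEnergy
    linarith
  have hqK := pow_nonneg hq K
  have hqK1 := pow_le_one₀ hq hq1 (n := K)
  have t4 : β / 4 * (β / 1000) ^ K * jumpEnergy P p M m f ≤
      4 * (Real.exp K * Real.exp (-(p * m / 2))) +
      β / 4 * ∑ i ∈ Finset.range K, (β / 1000) ^ i * branchEnergy P p M β i m f := by
    have c0 : 0 ≤ β / 4 * (β / 1000) ^ K := by positivity
    have c1 : β / 4 * (β / 1000) ^ K ≤ 1 := by nlinarith
    have := mul_le_mul_of_nonneg_left t3 c0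
    have := mul_le_mul_of_nonneg_left t1 (by positivity : 0 ≤ β / 4)
    have : 0 ≤ Real.exp K * Real.exp (-(p * m / 2)) := by positivity
    nlinarith
  -- The geometric sum is at most `2`, so the variance losses of all levels total at most `800`, the
  -- coefficient of the mean square in `lyap`.
  have t5 : (400 * varEnergy P p M m f + 100 * Real.exp (-(p * m / 2))) *
      ∑ i ∈ Finset.range K, (β / 1000) ^ i ≤
      800 * varEnergy P p M m f + 200 * Real.exp (-(p * m / 2)) := by
    nlinarith
  have t6 : p * (-(β / 4 * (β / 1000) ^ K) * jumpEnergy P p M m f +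
        (200 + 4 * Real.exp K) * Real.exp (-(p * m / 2))) ≥
      p * (-800 * varEnergy P p M m f - (β / 4 * ∑ i ∈ Finset.range K, (β / 1000) ^ i *
        branchEnergy P p M β i m f - (400 * varEnergy P p M m f +
          100 * Real.exp (-(p * m / 2))) * ∑ i ∈ Finset.range K, (β / 1000) ^ i)) := by
    refine mul_le_mul_of_nonneg_left ?_ h0.le
    linarith
  linarith

end Drift

end DeGroot

namespace DeGroot

open Matrix

/-! ### The energy bound and the second moment of spread out averages. -/

section Concentration

set_option linter.unusedSectionVars false

variable {V : Type*} [Fintype V] [DecidableEq V] {P : Matrix V V ℝ} {p : ℝ} {M : V → ℝ} {β : ℝ}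

theorem sum_anc_zero (hP : P ∈ rowStochastic ℝ V) (h0 : 0 ≤ p) (h1 : p ≤ 1)
    (hM1 : ∑ x, M x = 1) (m : ℕ) : ∑ x, anc P p M 0 m x = 1 := by
  rw [anc_zero, sum_vecMul (pow_mem (lazyMat_mem hP h0 h1) m), hM1]

theorem sum_anc_le_one (hP : P ∈ rowStochastic ℝ V) (h0 : 0 ≤ p) (h1 : p ≤ 1)
    (hM : ∀ x, 0 ≤ M x) (hM1 : ∑ x, M x = 1) (i m : ℕ) : ∑ x, anc P p M i m x ≤ 1 := by
  rw [← sum_anc_zero hP h0 h1 hM1 m, ← sum_vecMul (pow_mem hP i)]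
  exact Finset.sum_le_sum fun x _ => anc_vecMul_pow_le hP h0 h1 hM i m x

theorem lyap_le (hP : P ∈ rowStochastic ℝ V) (h0 : 0 ≤ p) (h1 : p ≤ 1) (hM : ∀ x, 0 ≤ M x)
    (hM1 : ∑ x, M x = 1) (hβ0 : 0 ≤ β) (K m : ℕ) {f : V → ℝ} (hf : ∀ x, |f x| ≤ 1) :
    lyap P p M β K m f ≤ 800 := by
  have a := sum_mul_le_mul_sum (g := fun x => f x ^ 2) (anc_nonneg hP h0 h1 hM 0 m)
    (fun x => (sq_le_one_iff_abs_le_one _).2 (hf x))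
  rw [sum_anc_zero hP h0 h1 hM1] at a
  have b : 0 ≤ ∑ i ∈ Finset.range K, (β / 1000) ^ i * levelEnergy P p M β i m f :=
    Finset.sum_nonneg fun i _ => mul_nonneg (pow_nonneg (by positivity) i)
      (pairEnergy_nonneg (pairWeight_nonneg hP (anc_nonneg hP h0 h1 hM _ _) i) f)
  rw [lyap]; linarith

theorem neg_eight_le_lyap (hP : P ∈ rowStochastic ℝ V) (h0 : 0 ≤ p) (h1 : p ≤ 1)
    (hM : ∀ x, 0 ≤ M x) (hM1 : ∑ x, M x = 1) (hβ0 : 0 ≤ β) (hβ : β ≤ 1) (K m : ℕ) {f : V → ℝ}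
    (hf : ∀ x, |f x| ≤ 1) : -8 ≤ lyap P p M β K m f := by
  have a : 0 ≤ ∑ x, anc P p M 0 m x * f x ^ 2 :=
    Finset.sum_nonneg fun x _ => mul_nonneg (anc_nonneg hP h0 h1 hM _ _ _) (sq_nonneg _)
  have b : ∑ i ∈ Finset.range K, (β / 1000) ^ i * levelEnergy P p M β i m f ≤
      ∑ i ∈ Finset.range K, (β / 1000) ^ i * 4 := by
    refine Finset.sum_le_sum fun i _ => mul_le_mul_of_nonneg_left ?_ (by positivity)
    have hu := anc_nonneg hP h0 h1 hM (i + 1) m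
    have b1 := pairEnergy_le (pairWeight_nonneg (β := β) hP hu i) hf
    have b2 := sum_sum_pairWeight_le (β := β) hP hu i
    have b3 := sum_anc_le_one hP h0 h1 hM hM1 (i + 1) m
    rw [levelEnergy]; linarith
  rw [← Finset.sum_mul] at b
  have := sum_range_pow_le_two (q := β / 1000) (by positivity) (by linarith) K
  rw [lyap]; linarith

/-- The rate in the decrease of the Lyapunov functional. -/
noncomputable def driftRate (K : ℕ) : ℝ := 1 / (2 * K) / 4 * (1 / (2 * K) / 1000) ^ K

/-- The constant in the energy and concentration estimates. -/
noncomputable def concConst (K : ℕ) : ℝ := 8000 * (2420 + 16 * Real.exp K) / driftRate K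

theorem driftRate_pos {K : ℕ} (hK : 1 ≤ K) : 0 < driftRate K := by
  have : (0 : ℝ) < K := by exact_mod_cast hK
  unfold driftRate; positivity

theorem driftRate_le_one {K : ℕ} (hK : 1 ≤ K) : driftRate K ≤ 1 := by
  have h : (1 : ℝ) ≤ K := by exact_mod_cast hK
  have h1 : 1 / (2 * (K : ℝ)) ≤ 1 := by
    rw [div_le_one (by linarith)]; linarith
  have h0 : 0 ≤ 1 / (2 * (K : ℝ)) := by positivity
  have h2 : (1 / (2 * (K : ℝ)) / 1000) ^ K ≤ 1 := pow_le_one₀ (by positivity) (by linarith)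
  have h3 : 0 ≤ (1 / (2 * (K : ℝ)) / 1000) ^ K := by positivity
  unfold driftRate
  nlinarith

theorem concConst_pos {K : ℕ} (hK : 1 ≤ K) : 0 < concConst K := by
  have := driftRate_pos hK
  unfold concConst; positivity

/-- The standing assumptions on the weights, the step size and the initial law of the walk. -/
structure IsSetup (P : Matrix V V ℝ) (p : ℝ) (K : ℕ) : Prop where
  mem : P ∈ rowStochastic ℝ V
  pos : 0 < p
  le : p ≤ 1 / 16
  card_mul_le : Fintype.card V * p ≤ 1
  one_le : 1 ≤ K
  pow_lt : ∀ x y, (P ^ K) x y < 1 / 2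

variable {K : ℕ}

theorem IsSetup.le_one (h : IsSetup P p K) : p ≤ 1 := h.le.trans (by norm_num)

theorem IsSetup.following_pow (h : IsSetup P p K) : following P (1 / (2 * K)) ^ K = 0 :=
  following_pow_eq_zero h.mem h.one_le h.pow_lt

theorem IsSetup.lazy_mem (h : IsSetup P p K) : lazyMat P p ∈ rowStochastic ℝ V :=
  lazyMat_mem h.mem h.pos.le h.le_one

theorem one_div_two_mul_le_one {K : ℕ} (hK : 1 ≤ K) : 1 / (2 * (K : ℝ)) ≤ 1 := by
  have h : (1 : ℝ) ≤ K := by exact_mod_cast hK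
  rw [div_le_one (by linarith)]; linarith

theorem IsSetup.drift (h : IsSetup P p K) (hM : ∀ x, 0 ≤ M x) (hM1 : ∑ x, M x = 1) (m : ℕ)
    {f : V → ℝ} (hf : ∀ x, |f x| ≤ 1) :
    lyap P p M (1 / (2 * K)) K m f + p * ∑ x, (lyap P p M (1 / (2 * K)) K m (ringAt P f x) -
        lyap P p M (1 / (2 * K)) K m f) - lyap P p M (1 / (2 * K)) K (m + 1) f ≤
      p * (-driftRate K * jumpEnergy P p M m f +
        (200 + 4 * Real.exp K) * Real.exp (-(p * m / 2))) :=
  lyap_drift h.mem h.pos h.le hM hM1 (by positivity) (one_div_two_mul_le_one h.one_le)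
    h.following_pow m hf

theorem sum_mul_exp_le_four (h0 : 0 < p) (h1 : p ≤ 1) (n : ℕ) :
    ∑ i ∈ Finset.range n, p * Real.exp (-(p * i / 2)) ≤ 4 := by
  suffices h : ∑ i ∈ Finset.range n, p * Real.exp (-(p * i / 2)) ≤
      4 - 4 * Real.exp (-(p * n / 2)) by
    linarith [Real.exp_pos (-(p * n / 2))]
  induction n with
  | zero => simp
  | succ n ih =>
    rw [Finset.sum_range_succ]
    have e : Real.exp (-(p * (n + 1 : ℕ) / 2)) =
        Real.exp (-(p * n / 2)) * Real.exp (-(p / 2)) := by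
      rw [← Real.exp_add]; push_cast; ring_nf
    have e2 : Real.exp (-(p / 2)) ≤ 1 - p / 4 := by
      rw [Real.exp_neg, inv_le_comm₀ (Real.exp_pos _) (by linarith)]
      have := Real.add_one_le_exp (p / 2)
      refine le_trans ?_ this
      rw [inv_le_iff_one_le_mul₀ (by linarith)]
      nlinarith
    rw [e]
    nlinarith [Real.exp_pos (-(p * n / 2))]

theorem sum_mul_exp_reflect_le (h0 : 0 < p) (h1 : p ≤ 1) (n : ℕ) :
    ∑ i ∈ Finset.range n, p * Real.exp (-(p * (n - 1 - i : ℕ) / 2)) ≤ 4 := by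
  rw [Finset.sum_range_reflect (fun i => p * Real.exp (-(p * i / 2)))]
  exact sum_mul_exp_le_four h0 h1 n

/-- With `dotProduct_ringAt`, this makes `anc P p M 0 (J - j) ⬝ᵥ f_j` a martingale in `j`. -/
theorem anc_zero_dotProduct_step (m : ℕ) (f : V → ℝ) :
    anc P p M 0 (m + 1) ⬝ᵥ f = anc P p M 0 m ⬝ᵥ f + p * ∑ x, anc P p M 0 m x * jump P f x := by
  have : anc P p M 0 (m + 1) = anc P p M 0 m ᵥ* lazyMat P p := by
    rw [anc_zero, anc_zero, pow_succ, Matrix.vecMul_vecMul]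
  rw [this, ← Matrix.dotProduct_mulVec, Finset.mul_sum]
  simp only [dotProduct, lazyMat_mulVec, ← Finset.sum_add_distrib]
  exact Finset.sum_congr rfl fun x _ => by ring

theorem dotProduct_ringAt (u f : V → ℝ) (x : V) :
    u ⬝ᵥ ringAt P f x = u ⬝ᵥ f + u x * jump P f x := by
  simp only [dotProduct, ringAt_apply, mul_add, Finset.sum_add_distrib, mul_ite, mul_zero,
    Finset.sum_ite_eq', Finset.mem_univ, if_true]

theorem abs_listMat_mulVec_le (hP : P ∈ rowStochastic ℝ V) {f : V → ℝ} (hf : ∀ x, |f x| ≤ 1)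
    (l : List (Option V)) (x : V) : |(listMat P l *ᵥ f) x| ≤ 1 :=
  abs_mulVec_le (listMat_mem hP l) hf x

/-- The total expected squared jump along the lazy walk is bounded. -/
theorem IsSetup.sum_jumpEnergy_le (h : IsSetup P p K) (hM : ∀ x, 0 ≤ M x) (hM1 : ∑ x, M x = 1)
    {f : V → ℝ} (hf : ∀ x, |f x| ≤ 1) (J : ℕ) :
    p * ∑ i ∈ Finset.range J, expec p i
      (fun l => jumpEnergy P p M (J - 1 - i) (listMat P l *ᵥ f)) ≤ concConst K := by
  set β : ℝ := 1 / (2 * K)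
  have hβ0 : 0 ≤ β := by positivity
  have hβ1 : β ≤ 1 := one_div_two_mul_le_one h.one_le
  -- After `j` steps of the dynamics the walk has `m` steps left; a step of the dynamics trades one
  -- for the other while `m + j` stays fixed, so the drift inequalities telescope.
  have key : ∀ j m : ℕ, driftRate K * (p * ∑ i ∈ Finset.range j, expec p i
      (fun l => jumpEnergy P p M (m + j - 1 - i) (listMat P l *ᵥ f))) +
      expec p j (fun l => lyap P p M β K m (listMat P l *ᵥ f)) ≤
      lyap P p M β K (m + j) f + (200 + 4 * Real.exp K) * ∑ i ∈ Finset.range j,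
        p * Real.exp (-(p * (m + j - 1 - i : ℕ) / 2)) := by
    intro j
    induction j with
    | zero => intro m; simp [expec]
    | succ j ih =>
      intro m
      have ih' := ih (m + 1)
      simp only [show m + 1 + j = m + (j + 1) by ring] at ih'
      rw [Finset.sum_range_succ, Finset.sum_range_succ, show m + (j + 1) - 1 - j = m by omega,
        expec_succ_listMat]
      have step : expec p j (fun l => lyap P p M β K m (listMat P l *ᵥ f) +
          p * ∑ x, (lyap P p M β K m (ringAt P (listMat P l *ᵥ f) x) -
            lyap P p M β K m (listMat P l *ᵥ f))) ≤
          expec p j (fun l => lyap P p M β K (m + 1) (listMat P l *ᵥ f)) +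
            (-(p * driftRate K) * expec p j (fun l => jumpEnergy P p M m (listMat P l *ᵥ f)) +
              p * ((200 + 4 * Real.exp K) * Real.exp (-(p * m / 2)))) := by
        rw [← expec_const_mul, ← expec_const (V := V) (p := p) j (p * ((200 + 4 * Real.exp K) * _)),
          ← expec_add, ← expec_add]
        refine expec_mono h.pos.le h.card_mul_le fun l => ?_
        have := h.drift hM hM1 m (abs_listMat_mulVec_le h.mem hf l)
        linarith
      linarith
  have k := key J 0
  simp only [zero_add] at k
  have a1 := lyap_le (β := β) h.mem h.pos.le h.le_one hM hM1 hβ0 K J hf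
  have a2 := expec_mono (p := p) (j := J) (F := fun _ => -8) h.pos.le h.card_mul_le fun l =>
    neg_eight_le_lyap (β := β) h.mem h.pos.le h.le_one hM hM1 hβ0 hβ1 K 0
      (abs_listMat_mulVec_le h.mem hf l)
  rw [expec_const] at a2
  have a3 := mul_le_mul_of_nonneg_left (sum_mul_exp_reflect_le h.pos h.le_one J)
    (by positivity : 0 ≤ 200 + 4 * Real.exp K)
  have hc := driftRate_pos h.one_le
  rw [concConst, le_div_iff₀ hc]
  have := Real.exp_pos K
  linarith

/-- The variance of a spread out average of the opinions. -/
theorem IsSetup.expec_sq_le (h : IsSetup P p K) (hM : ∀ x, 0 ≤ M x) (hM1 : ∑ x, M x = 1)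
    {η : ℝ} (hη0 : 0 ≤ η) (hη : ∀ m x, (M ᵥ* lazyMat P p ^ m) x ≤ η)
    {f : V → ℝ} (hf : ∀ x, |f x| ≤ 1) (J : ℕ) :
    expec p J (fun l => (M ⬝ᵥ listMat P l *ᵥ f) ^ 2) ≤
      (M ᵥ* lazyMat P p ^ J ⬝ᵥ f) ^ 2 + η * concConst K := by
  have key : ∀ j m : ℕ, expec p j (fun l => (anc P p M 0 m ⬝ᵥ listMat P l *ᵥ f) ^ 2) ≤
      (anc P p M 0 (m + j) ⬝ᵥ f) ^ 2 + η * (p * ∑ i ∈ Finset.range j, expec p i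
      (fun l => jumpEnergy P p M (m + j - 1 - i) (listMat P l *ᵥ f))) := by
    intro j
    induction j with
    | zero => intro m; simp [expec]
    | succ j ih =>
      intro m
      have ih' := ih (m + 1)
      simp only [show m + 1 + j = m + (j + 1) by ring] at ih'
      rw [Finset.sum_range_succ, show m + (j + 1) - 1 - j = m by omega]
      rw [expec_succ_listMat (F := fun g => (anc P p M 0 m ⬝ᵥ g) ^ 2)]
      have step : expec p j (fun l => (anc P p M 0 m ⬝ᵥ listMat P l *ᵥ f) ^ 2 +
          p * ∑ x, ((anc P p M 0 m ⬝ᵥ ringAt P (listMat P l *ᵥ f) x) ^ 2 -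
            (anc P p M 0 m ⬝ᵥ listMat P l *ᵥ f) ^ 2)) ≤
          expec p j (fun l => (anc P p M 0 (m + 1) ⬝ᵥ listMat P l *ᵥ f) ^ 2) +
            (η * p) * expec p j (fun l => jumpEnergy P p M m (listMat P l *ᵥ f)) := by
        rw [← expec_const_mul, ← expec_add]
        refine expec_mono h.pos.le h.card_mul_le fun l => ?_
        set g := listMat P l *ᵥ f
        set Z := anc P p M 0 m ⬝ᵥ g
        have e1 : ∑ x, ((anc P p M 0 m ⬝ᵥ ringAt P g x) ^ 2 - Z ^ 2) =
            2 * Z * ∑ x, anc P p M 0 m x * jump P g x +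
              ∑ x, anc P p M 0 m x * (anc P p M 0 m x * jump P g x ^ 2) := by
          rw [Finset.mul_sum, ← Finset.sum_add_distrib]
          refine Finset.sum_congr rfl fun x _ => ?_
          rw [dotProduct_ringAt]; ring
        -- One of the two factors `anc P p M 0 m x` in the conditional variance is bounded by `η`;
        -- the other one forms `jumpEnergy`.
        have e2 : ∑ x, anc P p M 0 m x * (anc P p M 0 m x * jump P g x ^ 2) ≤
            η * jumpEnergy P p M m g := by
          rw [jumpEnergy, Finset.mul_sum]
          refine Finset.sum_le_sum fun x _ => mul_le_mul_of_nonneg_right ?_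
            (mul_nonneg (anc_nonneg h.mem h.pos.le h.le_one hM 0 m x) (sq_nonneg _))
          rw [anc_zero]; exact hη m x
        rw [e1, anc_zero_dotProduct_step]
        have := mul_le_mul_of_nonneg_left e2 h.pos.le
        nlinarith [sq_nonneg (p * ∑ x, anc P p M 0 m x * jump P g x)]
      linarith
  have k := key J 0
  simp only [zero_add] at k
  have := mul_le_mul_of_nonneg_left (h.sum_jumpEnergy_le hM hM1 hf J) hη0
  simp only [anc_zero, pow_zero, Matrix.vecMul_one] at k
  linarith

end Concentration

end DeGroot

namespace DeGroot

open Matrix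

/-! ### Exponential moments of spread out averages. -/

section Exponential

set_option linter.unusedSectionVars false

variable {V : Type*} [Fintype V] [DecidableEq V] {P : Matrix V V ℝ} {p : ℝ} {M : V → ℝ} {β : ℝ}
  {K : ℕ}

/-- The second marginal of the pair weights of level `i`. -/
noncomputable def pairMarginal (P : Matrix V V ℝ) (p : ℝ) (M : V → ℝ) (β : ℝ) (i m : ℕ) (x : V) :
    ℝ := ∑ y, pairWeight P β i (anc P p M (i + 1) m) y x

theorem pairMarginal_nonneg (hP : P ∈ rowStochastic ℝ V) (h0 : 0 ≤ p) (h1 : p ≤ 1)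
    (hM : ∀ x, 0 ≤ M x) (i m : ℕ) (x : V) : 0 ≤ pairMarginal P p M β i m x :=
  Finset.sum_nonneg fun y _ => pairWeight_nonneg hP (anc_nonneg hP h0 h1 hM _ _) i y x

theorem pairMarginal_zero_le (hP : P ∈ rowStochastic ℝ V) (h0 : 0 ≤ p) (h1 : p ≤ 1)
    (hM : ∀ x, 0 ≤ M x) (m : ℕ) (x : V) : pairMarginal P p M β 0 m x ≤ anc P p M 0 m x := by
  have a := anc_vecMul_pow_le hP h0 h1 hM 1 m x
  rw [pow_one] at a
  exact (sum_pairWeight_zero_right_le hP (anc_nonneg hP h0 h1 hM _ _) x).trans a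

theorem pairMarginal_succ_le (hP : P ∈ rowStochastic ℝ V) (h0 : 0 ≤ p) (h1 : p ≤ 1)
    (hM : ∀ x, 0 ≤ M x) (i m : ℕ) (x : V) : pairMarginal P p M β (i + 1) m x ≤
      (anc P p M (i + 2) m ᵥ* P ^ (i + 1)) x :=
  (sum_pairWeight_succ_right_le hP (anc_nonneg hP h0 h1 hM _ _) i x).trans
    (vecMul_mono_right (branchPow_le hP i) (anc_nonneg hP h0 h1 hM _ _) x)

/-- At positive levels the second coordinate is the parent, reached by one jump fewer than the
generations of its ancestor; hence the recourse to `anc_succ_vecMul_pow_le`. -/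
theorem pairMarginal_le (hP : P ∈ rowStochastic ℝ V) (h0 : 0 ≤ p) (h1 : p ≤ 1)
    (hM : ∀ x, 0 ≤ M x) {η : ℝ} (hη0 : 0 ≤ η) (hη : ∀ m x, (M ᵥ* lazyMat P p ^ m) x ≤ η)
    (i m : ℕ) (x : V) : pairMarginal P p M β i m x ≤ η := by
  cases i with
  | zero =>
    exact (pairMarginal_zero_le hP h0 h1 hM m x).trans (by rw [anc_zero]; exact hη m x)
  | succ i =>
    exact (pairMarginal_succ_le hP h0 h1 hM i m x).trans
      (anc_succ_vecMul_pow_le hP h0 h1 hM hη hη0 (i + 1) m x)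

/-- For the same reason, at positive levels the ancestor must be moved down by one generation, at
the cost of a factor `16` and an exponentially small error. -/
theorem sum_pairMarginal_mul_le (hP : P ∈ rowStochastic ℝ V) (h0 : 0 < p) (h1 : p ≤ 1 / 16)
    (hM : ∀ x, 0 ≤ M x) (hM1 : ∑ x, M x = 1) (i m : ℕ) {f : V → ℝ} (hf : ∀ x, |f x| ≤ 1) :
    ∑ x, pairMarginal P p M β i m x * jump P f x ^ 2 ≤
      16 * jumpEnergy P p M m f + 4 * Real.exp (-(p * m / 2)) := by
  have hp1 : p ≤ 1 := by linarith
  cases i with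
  | zero =>
    have a : ∑ x, pairMarginal P p M β 0 m x * jump P f x ^ 2 ≤ jumpEnergy P p M m f :=
      Finset.sum_le_sum fun x _ => mul_le_mul_of_nonneg_right
        (pairMarginal_zero_le hP h0.le hp1 hM m x) (sq_nonneg _)
    have := jumpEnergy_nonneg hP h0.le hp1 hM m f
    linarith [Real.exp_pos (-(p * m / 2))]
  | succ i =>
    obtain ⟨ξ, hξ0, hξ1, hξ⟩ := exists_anc_succ_le hP h0 h1 hM hM1 (i + 1) m
    have hn := pow_nonneg_entries hP (i + 1)
    have e0 : ∀ x, pairMarginal P p M β (i + 1) m x ≤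
        16 * anc P p M 0 m x + (ξ ᵥ* P ^ (i + 1)) x := by
      intro x
      refine (pairMarginal_succ_le hP h0.le hp1 hM i m x).trans ?_
      have e1 := vecMul_mono (ν' := (16 : ℝ) • anc P p M (i + 1) m + ξ) hn
        (fun y => by simpa using hξ y) x
      rw [Matrix.add_vecMul, Matrix.smul_vecMul] at e1
      have e2 := anc_vecMul_pow_le hP h0.le hp1 hM (i + 1) m x
      simp only [Pi.add_apply, Pi.smul_apply, smul_eq_mul] at e1
      exact e1.trans (by linarith)
    have e3 : ∑ x, pairMarginal P p M β (i + 1) m x * jump P f x ^ 2 ≤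
        ∑ x, (16 * (anc P p M 0 m x * jump P f x ^ 2) +
          (ξ ᵥ* P ^ (i + 1)) x * jump P f x ^ 2) :=
      Finset.sum_le_sum fun x _ => by
        nlinarith [mul_le_mul_of_nonneg_right (e0 x) (sq_nonneg (jump P f x))]
    rw [Finset.sum_add_distrib, ← Finset.mul_sum] at e3
    have e4 := sum_mul_le_mul_sum (vecMul_nonneg hn hξ0) (jump_sq_le hP hf)
    rw [sum_vecMul (pow_mem hP (i + 1))] at e4
    rw [jumpEnergy]
    linarith

/-- A bound on the influence of the vertex `x` on the Lyapunov functional. -/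
noncomputable def influence (P : Matrix V V ℝ) (p : ℝ) (M : V → ℝ) (β : ℝ) (K m : ℕ) (x : V) : ℝ :=
  -- `1608 = 1600 + 8`: the mean square contributes `800 * 2`, the first marginals of the pair
  -- weights `4 * 2`.
  1608 * anc P p M 0 m x + 4 * ∑ i ∈ Finset.range K, (β / 1000) ^ i * pairMarginal P p M β i m x

theorem abs_lyap_ringAt_sub_le (hP : P ∈ rowStochastic ℝ V) (h0 : 0 ≤ p) (h1 : p ≤ 1)
    (hM : ∀ x, 0 ≤ M x) (hβ0 : 0 ≤ β) (hβ : β ≤ 1) (m : ℕ) {f : V → ℝ} (hf : ∀ x, |f x| ≤ 1)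
    (x : V) : |lyap P p M β K m (ringAt P f x) - lyap P p M β K m f| ≤
      |jump P f x| * influence P p M β K m x := by
  have hu := anc_nonneg hP h0 h1 hM
  have hq : 0 ≤ β / 1000 := by positivity
  have hw := hu 0 m x
  have hj := abs_nonneg (jump P f x)
  have a1 : ∑ y, anc P p M 0 m y * ringAt P f x y ^ 2 - ∑ y, anc P p M 0 m y * f y ^ 2 =
      anc P p M 0 m x * (jump P f x * ((P *ᵥ f) x + f x)) := by
    rw [← Finset.sum_sub_distrib, Finset.sum_eq_single x]
    · simp only [ringAt, Function.update_self, jump]; ring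
    · intro y _ hy
      rw [ringAt, Function.update_of_ne hy, sub_self]
    · simp
  have a2 : |anc P p M 0 m x * (jump P f x * ((P *ᵥ f) x + f x))| ≤
      anc P p M 0 m x * (|jump P f x| * 2) := by
    rw [abs_mul, abs_mul, abs_of_nonneg hw]
    refine mul_le_mul_of_nonneg_left (mul_le_mul_of_nonneg_left ?_ hj) hw
    have := abs_le.1 (abs_mulVec_le hP hf x)
    have := abs_le.1 (hf x)
    rw [abs_le]; constructor <;> linarith
  have a3 : ∀ i, |levelEnergy P p M β i m (ringAt P f x) - levelEnergy P p M β i m f| ≤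
      4 * |jump P f x| * (anc P p M 0 m x + pairMarginal P p M β i m x) := by
    intro i
    refine (abs_pairEnergy_ringAt_sub_le hP (pairWeight_nonneg hP (hu (i + 1) m) i)
      (pairWeight_self i _) hf x).trans (mul_le_mul_of_nonneg_left ?_ (by positivity))
    exact add_le_add ((sum_pairWeight_le hP (hu (i + 1) m) i x).trans
      (anc_vecMul_branchPow_le hP h0 h1 hM i m x)) le_rfl
  have a4 : lyap P p M β K m (ringAt P f x) - lyap P p M β K m f =
      800 * (anc P p M 0 m x * (jump P f x * ((P *ᵥ f) x + f x))) -
        ∑ i ∈ Finset.range K, (β / 1000) ^ i *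
          (levelEnergy P p M β i m (ringAt P f x) - levelEnergy P p M β i m f) := by
    rw [← a1]
    simp only [lyap, mul_sub, Finset.sum_sub_distrib]
    ring
  have a5 : |∑ i ∈ Finset.range K, (β / 1000) ^ i *
      (levelEnergy P p M β i m (ringAt P f x) - levelEnergy P p M β i m f)| ≤
      ∑ i ∈ Finset.range K, (4 * |jump P f x| * anc P p M 0 m x * (β / 1000) ^ i +
        4 * |jump P f x| * ((β / 1000) ^ i * pairMarginal P p M β i m x)) := by
    refine (Finset.abs_sum_le_sum_abs _ _).trans (Finset.sum_le_sum fun i _ => ?_)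
    rw [abs_mul, abs_of_nonneg (pow_nonneg hq i)]
    have := mul_le_mul_of_nonneg_left (a3 i) (pow_nonneg hq i)
    linarith
  rw [Finset.sum_add_distrib, ← Finset.mul_sum, ← Finset.mul_sum] at a5
  have a6 := mul_le_mul_of_nonneg_left (sum_range_pow_le_two hq (by linarith) K)
    (by positivity : 0 ≤ 4 * |jump P f x| * anc P p M 0 m x)
  rw [a4, influence]
  refine (abs_sub _ _).trans ?_
  rw [abs_mul, abs_of_pos (by norm_num : (0 : ℝ) < 800)]
  linarith

theorem influence_nonneg (hP : P ∈ rowStochastic ℝ V) (h0 : 0 ≤ p) (h1 : p ≤ 1)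
    (hM : ∀ x, 0 ≤ M x) (hβ0 : 0 ≤ β) (m : ℕ) (x : V) : 0 ≤ influence P p M β K m x := by
  have := anc_nonneg hP h0 h1 hM 0 m x
  have : 0 ≤ ∑ i ∈ Finset.range K, (β / 1000) ^ i * pairMarginal P p M β i m x :=
    Finset.sum_nonneg fun i _ => mul_nonneg (by positivity)
      (pairMarginal_nonneg hP h0 h1 hM i m x)
  unfold influence; positivity

theorem influence_le (hP : P ∈ rowStochastic ℝ V) (h0 : 0 ≤ p) (h1 : p ≤ 1)
    (hM : ∀ x, 0 ≤ M x) (hβ0 : 0 ≤ β) (hβ : β ≤ 1) {η : ℝ} (hη0 : 0 ≤ η)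
    (hη : ∀ m x, (M ᵥ* lazyMat P p ^ m) x ≤ η) (m : ℕ) (x : V) :
    influence P p M β K m x ≤ 2000 * η := by
  have a := hη m x
  rw [← anc_zero] at a
  have b : ∑ i ∈ Finset.range K, (β / 1000) ^ i * pairMarginal P p M β i m x ≤
      ∑ i ∈ Finset.range K, (β / 1000) ^ i * η :=
    Finset.sum_le_sum fun i _ => mul_le_mul_of_nonneg_left
      (pairMarginal_le hP h0 h1 hM hη0 hη i m x) (by positivity)
  rw [← Finset.sum_mul] at b
  have := mul_le_mul_of_nonneg_right
    (sum_range_pow_le_two (q := β / 1000) (by positivity) (by linarith) K) hη0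
  rw [influence]; linarith

theorem sum_influence_mul_le (hP : P ∈ rowStochastic ℝ V) (h0 : 0 < p) (h1 : p ≤ 1 / 16)
    (hM : ∀ x, 0 ≤ M x) (hM1 : ∑ x, M x = 1) (hβ0 : 0 ≤ β) (hβ : β ≤ 1) (m : ℕ) {f : V → ℝ}
    (hf : ∀ x, |f x| ≤ 1) : ∑ x, influence P p M β K m x * jump P f x ^ 2 ≤
      2000 * (jumpEnergy P p M m f + Real.exp (-(p * m / 2))) := by
  have e : ∑ x, influence P p M β K m x * jump P f x ^ 2 = 1608 * jumpEnergy P p M m f +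
      4 * ∑ i ∈ Finset.range K, (β / 1000) ^ i *
        ∑ x, pairMarginal P p M β i m x * jump P f x ^ 2 := by
    simp only [influence, add_mul, Finset.sum_add_distrib, jumpEnergy, mul_assoc, Finset.mul_sum,
      Finset.sum_mul]
    congr 1
    exact Finset.sum_comm
  have b : ∑ i ∈ Finset.range K, (β / 1000) ^ i *
      ∑ x, pairMarginal P p M β i m x * jump P f x ^ 2 ≤ ∑ i ∈ Finset.range K, (β / 1000) ^ i *
        (16 * jumpEnergy P p M m f + 4 * Real.exp (-(p * m / 2))) :=
    Finset.sum_le_sum fun i _ => mul_le_mul_of_nonneg_left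
      (sum_pairMarginal_mul_le hP h0 h1 hM hM1 i m hf) (by positivity)
  rw [← Finset.sum_mul] at b
  have hE := jumpEnergy_nonneg hP h0.le (by linarith) hM m f
  have he := Real.exp_pos (-(p * m / 2))
  have := mul_le_mul_of_nonneg_right
    (sum_range_pow_le_two (q := β / 1000) (by positivity) (by linarith) K)
    (by positivity : 0 ≤ 16 * jumpEnergy P p M m f + 4 * Real.exp (-(p * m / 2)))
  rw [e]; linarith

/-- One step of the exponential functional. -/
theorem IsSetup.exp_step (h : IsSetup P p K) (hM : ∀ x, 0 ≤ M x) (hM1 : ∑ x, M x = 1)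
    {η lam κ : ℝ} (hη0 : 0 ≤ η) (hη : ∀ m x, (M ᵥ* lazyMat P p ^ m) x ≤ η) (hlam : 0 ≤ lam)
    (hκ : 0 ≤ κ) (c1 : lam * η ≤ 1 / 4) (c2 : κ * η ≤ 1 / 10000)
    (c3 : 2 * lam ^ 2 * η ≤ κ * driftRate K / 2) (c4 : 8000000 * (κ * η) ≤ driftRate K / 2)
    (m : ℕ) {f : V → ℝ} (hf : ∀ x, |f x| ≤ 1) :
    Real.exp (lam * (anc P p M 0 m ⬝ᵥ f) + κ * lyap P p M (1 / (2 * K)) K m f) +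
      p * ∑ x, (Real.exp (lam * (anc P p M 0 m ⬝ᵥ ringAt P f x) +
          κ * lyap P p M (1 / (2 * K)) K m (ringAt P f x)) -
        Real.exp (lam * (anc P p M 0 m ⬝ᵥ f) + κ * lyap P p M (1 / (2 * K)) K m f)) ≤
    Real.exp (p * (κ * ((201 + 4 * Real.exp K) * Real.exp (-(p * m / 2))))) *
      Real.exp (lam * (anc P p M 0 (m + 1) ⬝ᵥ f) + κ * lyap P p M (1 / (2 * K)) K (m + 1) f) := by
  set β : ℝ := 1 / (2 * K)
  have hβ0 : 0 ≤ β := by positivity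
  have hβ1 : β ≤ 1 := one_div_two_mul_le_one h.one_le
  have hP := h.mem
  have hp1 := h.le_one
  set err := Real.exp (-(p * m / 2))
  have herr : 0 < err := Real.exp_pos _
  set E := jumpEnergy P p M m f
  have hE : 0 ≤ E := jumpEnergy_nonneg hP h.pos.le hp1 hM m f
  set w := anc P p M 0 m
  set G := influence P p M β K m
  have hw0 : ∀ x, 0 ≤ w x := anc_nonneg hP h.pos.le hp1 hM 0 m
  have hwη : ∀ x, w x ≤ η := fun x => by
    have := hη m x
    rwa [← anc_zero] at this
  have hG0 : ∀ x, 0 ≤ G x := influence_nonneg hP h.pos.le hp1 hM hβ0 m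
  have hGη : ∀ x, G x ≤ 2000 * η := influence_le hP h.pos.le hp1 hM hβ0 hβ1 hη0 hη m
  set Δ : V → ℝ := fun x => lyap P p M β K m (ringAt P f x) - lyap P p M β K m f with hΔ
  have hΔG : ∀ x, |Δ x| ≤ |jump P f x| * G x :=
    abs_lyap_ringAt_sub_le hP h.pos.le hp1 hM hβ0 hβ1 m hf
  set D : V → ℝ := fun x => lam * (w x * jump P f x) + κ * Δ x with hD
  set A := lam * (w ⬝ᵥ f) + κ * lyap P p M β K m f
  have hA : ∀ x, lam * (w ⬝ᵥ ringAt P f x) + κ * lyap P p M β K m (ringAt P f x) = A + D x := by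
    intro x
    rw [dotProduct_ringAt]
    simp only [A, hD, hΔ]
    ring
  have hD1 : ∀ x, |D x| ≤ 1 := by
    intro x
    have hj := abs_jump_le hP hf x
    have b1 : |lam * (w x * jump P f x)| ≤ 2 * (lam * η) := by
      rw [abs_mul, abs_mul, abs_of_nonneg hlam, abs_of_nonneg (hw0 x)]
      have := mul_le_mul (hwη x) hj (abs_nonneg _) hη0
      nlinarith [mul_le_mul_of_nonneg_left this hlam]
    have b2 : |κ * Δ x| ≤ 4000 * (κ * η) := by
      rw [abs_mul, abs_of_nonneg hκ]
      have := (hΔG x).trans (mul_le_mul hj (hGη x) (hG0 x) (by norm_num))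
      nlinarith [mul_le_mul_of_nonneg_left this hκ]
    have := abs_add_le (lam * (w x * jump P f x)) (κ * Δ x)
    simp only [hD]
    linarith
  -- For `|D| ≤ 1` one has `exp D ≤ 1 + D + D²`; this is why `lam * η` and `κ * η` must be small.
  have hexp : ∀ x, Real.exp (A + D x) - Real.exp A ≤ Real.exp A * (D x + D x ^ 2) := by
    intro x
    have := (abs_le.1 (Real.abs_exp_sub_one_sub_id_le (hD1 x))).2
    rw [Real.exp_add]
    nlinarith [mul_le_mul_of_nonneg_left this (Real.exp_pos A).le]
  have hD2 : ∑ x, D x ^ 2 ≤ 2 * lam ^ 2 * η * E + 8000000 * (κ * η) * κ * (E + err) := by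
    have b0 : ∀ x, D x ^ 2 ≤ 2 * lam ^ 2 * η * (w x * jump P f x ^ 2) +
        4000 * (κ * η) * κ * (G x * jump P f x ^ 2) := by
      intro x
      have b1 : (lam * (w x * jump P f x)) ^ 2 ≤ lam ^ 2 * η * (w x * jump P f x ^ 2) := by
        have : 0 ≤ lam ^ 2 * (w x * jump P f x ^ 2) * (η - w x) :=
          mul_nonneg (mul_nonneg (sq_nonneg _) (mul_nonneg (hw0 x) (sq_nonneg _)))
            (sub_nonneg.2 (hwη x))
        nlinarith
      have b2 : (κ * Δ x) ^ 2 ≤ 2000 * (κ * η) * κ * (G x * jump P f x ^ 2) := by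
        have b3 : Δ x ^ 2 ≤ jump P f x ^ 2 * G x ^ 2 := by
          rw [← mul_pow, ← sq_abs]
          have := hΔG x
          rw [← abs_of_nonneg (hG0 x), ← abs_mul] at this
          rw [sq_le_sq, abs_abs]
          exact this
        have b4 : 0 ≤ κ ^ 2 * (G x * jump P f x ^ 2) * (2000 * η - G x) :=
          mul_nonneg (mul_nonneg (sq_nonneg _) (mul_nonneg (hG0 x) (sq_nonneg _)))
            (sub_nonneg.2 (hGη x))
        nlinarith [mul_le_mul_of_nonneg_left b3 (sq_nonneg κ)]
      have b5 := add_sq_le (a := lam * (w x * jump P f x)) (b := κ * Δ x)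
      simp only [hD]
      linarith
    refine (Finset.sum_le_sum fun x _ => b0 x).trans ?_
    rw [Finset.sum_add_distrib, ← Finset.mul_sum, ← Finset.mul_sum]
    have b6 := sum_influence_mul_le (K := K) (β := β) hP h.pos h.le hM hM1 hβ0 hβ1 m hf
    have b7 := mul_le_mul_of_nonneg_left b6 (by positivity : 0 ≤ 4000 * (κ * η) * κ)
    change _ ≤ 2 * lam ^ 2 * η * ∑ x, w x * jump P f x ^ 2 + _
    linarith
  have hdrift := h.drift hM hM1 m hf
  have hDsum : ∑ x, D x = lam * ∑ x, w x * jump P f x + κ * ∑ x, Δ x := by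
    simp only [hD, Finset.sum_add_distrib, Finset.mul_sum]
  have hrate := driftRate_pos h.one_le
  have hrate1 := driftRate_le_one h.one_le
  -- The second order terms are absorbed by the negative drift `κ * driftRate K * E` of `κ * lyap`:
  -- by `c3` half of it covers the fluctuations of the linear part, by `c4` the other half those of
  -- `lyap` itself.
  have hfin : ∑ x, D x ^ 2 ≤ κ * driftRate K * E + κ * err := by
    have a1 := mul_le_mul_of_nonneg_right c3 hE
    have a2 := mul_le_mul_of_nonneg_right c4 (mul_nonneg hκ (add_nonneg hE herr.le))
    have a3 : driftRate K * (κ * err) ≤ 1 * (κ * err) :=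
      mul_le_mul_of_nonneg_right hrate1 (mul_nonneg hκ herr.le)
    have := mul_nonneg hκ herr.le
    nlinarith
  simp only [hA]
  calc Real.exp A + p * ∑ x, (Real.exp (A + D x) - Real.exp A)
      ≤ Real.exp A + p * ∑ x, Real.exp A * (D x + D x ^ 2) := by
        have := mul_le_mul_of_nonneg_left (Finset.sum_le_sum fun x (_ : x ∈ Finset.univ) => hexp x)
          h.pos.le
        linarith
    _ = Real.exp A * (p * ∑ x, (D x + D x ^ 2) + 1) := by rw [← Finset.mul_sum]; ring
    _ ≤ Real.exp A * Real.exp (p * ∑ x, (D x + D x ^ 2)) :=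
        mul_le_mul_of_nonneg_left (Real.add_one_le_exp _) (Real.exp_pos _).le
    _ = Real.exp (A + p * ∑ x, (D x + D x ^ 2)) := (Real.exp_add _ _).symm
    _ ≤ _ := by
        rw [← Real.exp_add, Real.exp_le_exp, anc_zero_dotProduct_step, Finset.sum_add_distrib,
          hDsum]
        have d1 := mul_le_mul_of_nonneg_left hdrift hκ
        have d2 := mul_le_mul_of_nonneg_left hfin h.pos.le
        simp only [A]
        change κ * (lyap P p M β K m f + p * ∑ x, Δ x - lyap P p M β K (m + 1) f) ≤ _ at d1
        change lam * (w ⬝ᵥ f) + κ * lyap P p M β K m f + _ ≤ p * (κ * ((201 + 4 * Real.exp K) * err))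
          + (lam * (w ⬝ᵥ f + p * ∑ x, w x * jump P f x) + κ * lyap P p M β K (m + 1) f)
        change _ ≤ κ * (p * (-driftRate K * E + (200 + 4 * Real.exp K) * err)) at d1
        linarith

/-- The Laplace transform of a spread out average of the opinions. -/
theorem IsSetup.expec_exp_le (h : IsSetup P p K) (hM : ∀ x, 0 ≤ M x) (hM1 : ∑ x, M x = 1)
    {η lam : ℝ} (hη0 : 0 ≤ η) (hη : ∀ m x, (M ᵥ* lazyMat P p ^ m) x ≤ η) (hlam : 0 ≤ lam)
    (hle : lam * η * concConst K ≤ 1) {f : V → ℝ} (hf : ∀ x, |f x| ≤ 1) (J : ℕ) :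
    expec p J (fun l => Real.exp (lam * (M ⬝ᵥ listMat P l *ᵥ f))) ≤
      Real.exp (lam * (M ᵥ* lazyMat P p ^ J ⬝ᵥ f) + concConst K * lam ^ 2 * η) := by
  set β : ℝ := 1 / (2 * K)
  have hβ0 : 0 ≤ β := by positivity
  have hβ1 : β ≤ 1 := one_div_two_mul_le_one h.one_le
  have hc := driftRate_pos h.one_le
  have hc1 := driftRate_le_one h.one_le
  have hexpK : 1 ≤ Real.exp K := Real.one_le_exp (Nat.cast_nonneg K)
  -- This value turns condition `c3` of `IsSetup.exp_step` into an equality.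
  set κ : ℝ := 4 * lam ^ 2 * η / driftRate K with hκdef
  have hκ0 : 0 ≤ κ := by positivity
  have hκc : κ * driftRate K = 4 * lam ^ 2 * η := by rw [hκdef]; field_simp
  have hlη : lam * η ≤ driftRate K / 8000 := by
    have e : lam * η * concConst K = lam * η * (8000 * (2420 + 16 * Real.exp K)) / driftRate K := by
      rw [concConst]; ring
    rw [e, div_le_one hc] at hle
    have : 0 ≤ lam * η := by positivity
    nlinarith
  have hκη : κ * η ≤ driftRate K / 16000000 := by
    have e1 : (lam * η) ^ 2 ≤ (driftRate K / 8000) ^ 2 := pow_le_pow_left₀ (by positivity) hlη 2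
    have e2 : κ * η * driftRate K = 4 * (lam * η) ^ 2 := by
      rw [mul_right_comm, hκc]; ring
    have e3 : κ * η * driftRate K ≤ driftRate K / 16000000 * driftRate K := by
      rw [e2]; nlinarith
    exact le_of_mul_le_mul_right e3 hc
  set C : ℝ := 201 + 4 * Real.exp K
  have key : ∀ j m : ℕ, expec p j (fun l => Real.exp (lam * (anc P p M 0 m ⬝ᵥ listMat P l *ᵥ f) +
      κ * lyap P p M β K m (listMat P l *ᵥ f))) ≤
      Real.exp (κ * C * ∑ i ∈ Finset.range j, p * Real.exp (-(p * (m + j - 1 - i : ℕ) / 2))) *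
      Real.exp (lam * (anc P p M 0 (m + j) ⬝ᵥ f) + κ * lyap P p M β K (m + j) f) := by
    intro j
    induction j with
    | zero => intro m; simp [expec]
    | succ j ih =>
      intro m
      have ih' := ih (m + 1)
      simp only [show m + 1 + j = m + (j + 1) by ring] at ih'
      rw [Finset.sum_range_succ, show m + (j + 1) - 1 - j = m by omega,
        expec_succ_listMat (F := fun g => Real.exp (lam * (anc P p M 0 m ⬝ᵥ g) +
          κ * lyap P p M β K m g))]
      refine (expec_mono h.pos.le h.card_mul_le fun l => h.exp_step hM hM1 hη0 hη hlam hκ0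
        (by linarith) (by linarith) (by linarith) (by linarith) m
        (abs_listMat_mulVec_le h.mem hf l)).trans ?_
      rw [expec_const_mul]
      refine (mul_le_mul_of_nonneg_left ih' (Real.exp_pos _).le).trans_eq ?_
      rw [← mul_assoc, ← Real.exp_add]
      congr 2
      simp only [C]
      ring
  have k := key J 0
  simp only [zero_add] at k
  have s := sum_mul_exp_reflect_le h.pos h.le_one J
  have b1 : expec p J (fun l => Real.exp (-8 * κ) * Real.exp (lam * (M ⬝ᵥ listMat P l *ᵥ f))) ≤
      expec p J (fun l => Real.exp (lam * (anc P p M 0 0 ⬝ᵥ listMat P l *ᵥ f) +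
        κ * lyap P p M β K 0 (listMat P l *ᵥ f))) := by
    refine expec_mono h.pos.le h.card_mul_le fun l => ?_
    have := neg_eight_le_lyap (β := β) h.mem h.pos.le h.le_one hM hM1 hβ0 hβ1 K 0
      (abs_listMat_mulVec_le h.mem hf l)
    rw [← Real.exp_add, Real.exp_le_exp, anc_zero, pow_zero, Matrix.vecMul_one]
    nlinarith
  rw [expec_const_mul] at b1
  have b2 := b1.trans k
  have b3 := mul_le_mul_of_nonneg_left b2 (Real.exp_pos (8 * κ)).le
  rw [← mul_assoc, ← Real.exp_add, show 8 * κ + -8 * κ = 0 by ring, Real.exp_zero, one_mul,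
    ← Real.exp_add, ← Real.exp_add] at b3
  refine b3.trans (Real.exp_le_exp.2 ?_)
  have b4 := lyap_le (β := β) h.mem h.pos.le h.le_one hM hM1 hβ0 K J hf
  have b5 := mul_le_mul_of_nonneg_left b4 hκ0
  have b6 := mul_le_mul_of_nonneg_left s (by positivity : 0 ≤ κ * C)
  -- Since `lyap` lies between `-8` and `800`, removing it costs `808 κ`; the accumulated errors
  -- cost at most `4 κ C`, with `C = 201 + 4 * Real.exp K`.
  have b7 : κ * (1612 + 16 * Real.exp K) ≤ concConst K * lam ^ 2 * η := by
    have e : concConst K * lam ^ 2 * η = κ * (2000 * (2420 + 16 * Real.exp K)) := by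
      rw [concConst, hκdef]; ring
    rw [e]
    exact mul_le_mul_of_nonneg_left (by linarith) hκ0
  rw [anc_zero]
  simp only [C] at b6 ⊢
  linarith

/-- Concentration of a spread out average of the opinions. -/
theorem IsSetup.expec_indicator_le (h : IsSetup P p K) (hM : ∀ x, 0 ≤ M x) (hM1 : ∑ x, M x = 1)
    {η ε : ℝ} (hη0 : 0 < η) (hη : ∀ m x, (M ᵥ* lazyMat P p ^ m) x ≤ η) (hε0 : 0 ≤ ε) (hε1 : ε ≤ 1)
    {f : V → ℝ} (hf : ∀ x, |f x| ≤ 1) (J : ℕ) :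
    expec p J (fun l => if ε < |M ⬝ᵥ listMat P l *ᵥ f - M ᵥ* lazyMat P p ^ J ⬝ᵥ f| then 1 else 0) ≤
      2 * Real.exp (-(ε ^ 2 / (4 * concConst K * η))) := by
  have hC := concConst_pos h.one_le
  -- The minimiser of `concConst K * lam ^ 2 * η - lam * ε`.
  set lam : ℝ := ε / (2 * concConst K * η) with hlam
  have hlam0 : 0 ≤ lam := by positivity
  have hle : lam * η * concConst K ≤ 1 := by
    have : lam * η * concConst K = ε / 2 := by rw [hlam]; field_simp
    linarith
  have hval : concConst K * lam ^ 2 * η - lam * ε = -(ε ^ 2 / (4 * concConst K * η)) := by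
    rw [hlam]; field_simp; ring
  have main : ∀ g : V → ℝ, (∀ x, |g x| ≤ 1) → expec p J (fun l => Real.exp (-lam * ε) *
      (Real.exp (-(lam * (M ᵥ* lazyMat P p ^ J ⬝ᵥ g))) *
        Real.exp (lam * (M ⬝ᵥ listMat P l *ᵥ g)))) ≤
        Real.exp (-(ε ^ 2 / (4 * concConst K * η))) := by
    intro g hg
    rw [expec_const_mul, expec_const_mul]
    have := h.expec_exp_le hM hM1 hη0.le hη hlam0 hle hg J
    refine (mul_le_mul_of_nonneg_left (mul_le_mul_of_nonneg_left this (Real.exp_pos _).le)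
      (Real.exp_pos _).le).trans_eq ?_
    rw [← Real.exp_add, ← Real.exp_add, ← hval]
    ring_nf
  have m1 := main f hf
  -- Deviations downwards are deviations upwards for `-f`.
  have m2 := main (-f) (fun x => by simpa using hf x)
  rw [two_mul]
  refine le_trans ?_ (add_le_add m1 m2)
  rw [← expec_add]
  refine expec_mono h.pos.le h.card_mul_le fun l => ?_
  simp only [← Real.exp_add, Matrix.mulVec_neg, dotProduct_neg]
  split_ifs with hlt
  · rcases lt_abs.1 hlt with h1 | h1
    · have : 1 ≤ Real.exp (-lam * ε + (-(lam * (M ᵥ* lazyMat P p ^ J ⬝ᵥ f)) +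
          lam * (M ⬝ᵥ listMat P l *ᵥ f))) := Real.one_le_exp (by nlinarith)
      linarith [Real.exp_pos (-lam * ε + (-(lam * -(M ᵥ* lazyMat P p ^ J ⬝ᵥ f)) +
          lam * -(M ⬝ᵥ listMat P l *ᵥ f)))]
    · have : 1 ≤ Real.exp (-lam * ε + (-(lam * -(M ᵥ* lazyMat P p ^ J ⬝ᵥ f)) +
          lam * -(M ⬝ᵥ listMat P l *ᵥ f))) := Real.one_le_exp (by nlinarith)
      linarith [Real.exp_pos (-lam * ε + (-(lam * (M ᵥ* lazyMat P p ^ J ⬝ᵥ f)) +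
          lam * (M ⬝ᵥ listMat P l *ᵥ f)))]
  · positivity

end Exponential

end DeGroot

namespace DeGroot

open Matrix

/-! ### A long block of steps spreads out any probability vector. -/

section Spreading

set_option linter.unusedSectionVars false

variable {V : Type*} [Fintype V] [DecidableEq V] {P : Matrix V V ℝ} {p : ℝ} {K : ℕ}

theorem dotProduct_le_of_forall_le {ν g : V → ℝ} {c : ℝ} (h0 : ∀ x, 0 ≤ ν x) (h1 : ∑ x, ν x = 1)
    (hg : ∀ x, g x ≤ c) : ν ⬝ᵥ g ≤ c := by
  have := sum_mul_le_mul_sum h0 hg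
  rwa [h1, mul_one] at this

theorem sq_dotProduct_le {ν g : V → ℝ} (h0 : ∀ x, 0 ≤ ν x) (h1 : ∑ x, ν x = 1) :
    (ν ⬝ᵥ g) ^ 2 ≤ ∑ x, ν x * g x ^ 2 := by
  have h : 0 ≤ ∑ x, ν x * (g x - ν ⬝ᵥ g) ^ 2 :=
    Finset.sum_nonneg fun x _ => mul_nonneg (h0 x) (sq_nonneg _)
  have e : ∑ x, ν x * (g x - ν ⬝ᵥ g) ^ 2 = ∑ x, ν x * g x ^ 2 - (ν ⬝ᵥ g) ^ 2 := by
    have : ∀ x, ν x * (g x - ν ⬝ᵥ g) ^ 2 =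
        ν x * g x ^ 2 - 2 * (ν ⬝ᵥ g) * (ν x * g x) + (ν ⬝ᵥ g) ^ 2 * ν x := fun x => by ring
    simp only [this, Finset.sum_add_distrib, Finset.sum_sub_distrib, ← Finset.mul_sum, h1]
    change _ - 2 * (ν ⬝ᵥ g) * (ν ⬝ᵥ g) + _ = _
    ring
  linarith

theorem pow_entry_le {A : Matrix V V ℝ} (hA : A ∈ rowStochastic ℝ V) {B m : ℕ} (hm : B ≤ m)
    {c : ℝ} (h : ∀ x y, (A ^ B) x y ≤ c) (x y : V) : (A ^ m) x y ≤ c := by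
  obtain ⟨d, rfl⟩ := Nat.exists_eq_add_of_le' hm
  rw [pow_add, Matrix.mul_apply]
  have hd := pow_mem hA d
  exact dotProduct_le_of_forall_le (ν := (A ^ d) x) (g := fun z => (A ^ B) z y)
    (fun z => nonneg_of_mem_rowStochastic hd) (sum_row_of_mem_rowStochastic hd x) (fun z => h z y)

/-- Transfer of a bound on the entries of powers of `P` to powers of the lazy matrix. -/
theorem lazyMat_pow_entry_le (hP : P ∈ rowStochastic ℝ V) (h0 : 0 ≤ p) (h1 : p ≤ 1) (B k : ℕ)
    {a : ℝ} (ha : ∀ x y, (P ^ k) x y ≤ a) (x y : V) :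
    (lazyMat P p ^ B) x y ≤ Real.exp (k - p * B / 8) * Real.exp (-(p * B / 2)) + a := by
  have ha0 : 0 ≤ a := (nonneg_of_mem_rowStochastic (pow_mem hP k)).trans (ha x y)
  refine le_trans ?_ (add_le_add_left (sum_binom_lt_le h0 h1 B k) a)
  rw [lazyMat_pow, Matrix.sum_apply]
  have hb := binom_nonneg h0 h1 B
  have h2 : ∀ l ∈ Finset.range (B + 1), (binom p B l • P ^ l) x y ≤
      (if l < k then binom p B l else 0) + binom p B l * a := by
    intro l _
    rw [Matrix.smul_apply, smul_eq_mul]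
    split_ifs with hl
    · have := mul_le_mul_of_nonneg_left (le_one_of_mem_rowStochastic (pow_mem hP l) (i := x) (j := y))
        (hb l)
      have := mul_nonneg (hb l) ha0
      linarith
    · rw [zero_add]
      exact mul_le_mul_of_nonneg_left (pow_entry_le hP (not_lt.1 hl) ha x y) (hb l)
  refine (Finset.sum_le_sum h2).trans ?_
  rw [Finset.sum_add_distrib, ← Finset.sum_mul, sum_binom, one_mul, ← Finset.sum_filter]
  refine add_le_add_left (Finset.sum_le_sum_of_subset_of_nonneg (fun l hl => ?_) fun l _ _ => hb l) _
  simpa using (Finset.mem_filter.1 hl).2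

/-- A choice of signs as a real function. -/
def signFun (s : V → Bool) (x : V) : ℝ := if s x then 1 else -1

theorem abs_signFun (s : V → Bool) (x : V) : |signFun s x| ≤ 1 := by
  unfold signFun; split_ifs <;> norm_num

/-- Flipping the sign at `x` is an involution that reverses the product. -/
theorem sum_signFun_mul {x y : V} (h : x ≠ y) : ∑ s : V → Bool, signFun s x * signFun s y = 0 := by
  let φ : Equiv.Perm (V → Bool) :=
    Function.Involutive.toPerm (fun s => Function.update s x (!(s x))) (fun s => by
      ext z; by_cases hz : z = x
      · subst hz; simp
      · simp [hz])
  have h1 : ∑ s : V → Bool, signFun s x * signFun s y =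
      ∑ s : V → Bool, signFun (φ s) x * signFun (φ s) y := 
      (Equiv.sum_comp φ (fun s => signFun s x * signFun s y)).symm
  have h2 : ∀ s : V → Bool, signFun (φ s) x * signFun (φ s) y = -(signFun s x * signFun s y) := by
    intro s
    have e1 : φ s x = !(s x) := by
      show Function.update s x (!(s x)) x = _
      simp
    have e2 : φ s y = s y := by
      show Function.update s x (!(s x)) y = _
      simp [h.symm]
    simp only [signFun, e1, e2]
    cases s x <;> cases s y <;> simp
  simp only [h2, Finset.sum_neg_distrib] at h1
  linarith

/-- Squared norms of the transported vectors thus become averages of second moments of the dynamics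
started from random signs, to which the energy bounds apply. -/
theorem sum_sq_dotProduct_signFun (ν : V → ℝ) :
    ∑ s : V → Bool, (ν ⬝ᵥ signFun s) ^ 2 = Fintype.card (V → Bool) * ∑ x, ν x ^ 2 := by
  have h1 : ∀ s : V → Bool, (ν ⬝ᵥ signFun s) ^ 2 =
      ∑ x, ∑ y, ν x * ν y * (signFun s x * signFun s y) := by
    intro s
    rw [sq, dotProduct, Finset.sum_mul_sum]
    exact Finset.sum_congr rfl fun x _ => Finset.sum_congr rfl fun y _ => by ring
  simp only [h1]
  rw [Finset.sum_comm, Finset.mul_sum]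
  refine Finset.sum_congr rfl fun x _ => ?_
  rw [Finset.sum_comm, Finset.sum_eq_single x]
  · have : ∀ s : V → Bool, ν x * ν x * (signFun s x * signFun s x) = ν x ^ 2 := by
      intro s; unfold signFun; split_ifs <;> ring
    simp [this]
  · intro y _ hy
    rw [← Finset.mul_sum, sum_signFun_mul hy.symm, mul_zero]
  · simp

/-- The mean square of the opinions at the position of the lazy walk after `m` steps. -/
noncomputable def sqEnergy (P : Matrix V V ℝ) (p : ℝ) (M : V → ℝ) (m : ℕ) (f : V → ℝ) : ℝ :=
  ∑ x, anc P p M 0 m x * f x ^ 2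

/-- By `sum_anc_zero_sq_drift`, each step of the dynamics in place of a step of the walk loses local
variance. -/
theorem IsSetup.expec_sqEnergy_le (h : IsSetup P p K) {M : V → ℝ} (hM : ∀ x, 0 ≤ M x) (f : V → ℝ)
    (j d m : ℕ) : expec p (j + d) (fun l => sqEnergy P p M m (listMat P l *ᵥ f)) ≤
      expec p j (fun l => sqEnergy P p M (m + d) (listMat P l *ᵥ f)) := by
  induction d generalizing m with
  | zero => simp
  | succ d ih =>
    rw [← add_assoc, expec_succ_listMat (F := sqEnergy P p M m)]
    refine le_trans (expec_mono h.pos.le h.card_mul_le fun l => ?_)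
      ((ih (m + 1)).trans_eq (by rw [show m + 1 + d = m + (d + 1) by ring]))
    have := sum_anc_zero_sq_drift (P := P) (p := p) (M := M) m (listMat P l *ᵥ f)
    have := mul_nonneg h.pos.le (varEnergy_nonneg h.mem h.pos.le h.le_one hM m (listMat P l *ᵥ f))
    unfold sqEnergy
    linarith

theorem sub_lazyMat_pow_mulVec (B : ℕ) (f : V → ℝ) :
    f - lazyMat P p ^ B *ᵥ f = -(p • ∑ i ∈ Finset.range B, lazyMat P p ^ i *ᵥ jump P f) := by
  induction B with
  | zero => simp
  | succ B ih =>
    have e : lazyMat P p *ᵥ f = f + p • jump P f := by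
      ext x; rw [lazyMat_mulVec]; rfl
    rw [pow_succ, ← Matrix.mulVec_mulVec, e, Matrix.mulVec_add, Matrix.mulVec_smul,
      Finset.sum_range_succ, smul_add, neg_add, ← ih]
    abel

/-- The difference telescopes into `B` propagated jumps; Cauchy-Schwarz over these terms gives `B`,
and Jensen's inequality moves the square inside each average. -/
theorem sq_sub_lazyMat_pow_le (hH : lazyMat P p ∈ rowStochastic ℝ V) (B : ℕ) (f : V → ℝ) (x : V) :
    (f x - (lazyMat P p ^ B *ᵥ f) x) ^ 2 ≤
      p ^ 2 * B * ∑ i ∈ Finset.range B, (lazyMat P p ^ i *ᵥ fun y => jump P f y ^ 2) x := by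
  have e := congrFun (sub_lazyMat_pow_mulVec (P := P) (p := p) B f) x
  simp only [Pi.sub_apply, Pi.neg_apply, Pi.smul_apply, Finset.sum_apply, smul_eq_mul] at e
  rw [e, neg_sq, mul_pow, mul_assoc]
  refine mul_le_mul_of_nonneg_left ?_ (sq_nonneg p)
  have h1 := sq_sum_le_card_mul_sum_sq (s := Finset.range B)
    (f := fun i => (lazyMat P p ^ i *ᵥ jump P f) x)
  rw [Finset.card_range] at h1
  refine h1.trans (mul_le_mul_of_nonneg_left (Finset.sum_le_sum fun i _ => ?_) (Nat.cast_nonneg B))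
  have hi := pow_mem hH i
  exact sq_dotProduct_le (ν := (lazyMat P p ^ i) x) (fun _ => nonneg_of_mem_rowStochastic hi)
    (sum_row_of_mem_rowStochastic hi x)

theorem vecMul_prob {A : Matrix V V ℝ} (hA : A ∈ rowStochastic ℝ V) {ν : V → ℝ}
    (h0 : ∀ x, 0 ≤ ν x) (h1 : ∑ x, ν x = 1) :
    (∀ x, 0 ≤ (ν ᵥ* A) x) ∧ ∑ x, (ν ᵥ* A) x = 1 :=
  ⟨vecMul_nonneg (fun _ _ => nonneg_of_mem_rowStochastic hA) h0, by rw [sum_vecMul hA, h1]⟩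

/-- The time average of the mean square distance of the opinions to their local averages. -/
theorem IsSetup.sum_expec_sub_sq_le (h : IsSetup P p K) {ν : V → ℝ} (h0 : ∀ x, 0 ≤ ν x)
    (h1 : ∑ x, ν x = 1) {f : V → ℝ} (hf : ∀ x, |f x| ≤ 1) (B J : ℕ) :
    ∑ j ∈ Finset.range J, expec p j (fun l => ∑ x, anc P p ν 0 (J - j) x *
      ((listMat P l *ᵥ f) x - (lazyMat P p ^ B *ᵥ listMat P l *ᵥ f) x) ^ 2) ≤
      p * B ^ 2 * concConst K := by
  have hH := h.lazy_mem
  have point : ∀ j ∈ Finset.range J, expec p j (fun l => ∑ x, anc P p ν 0 (J - j) x *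
      ((listMat P l *ᵥ f) x - (lazyMat P p ^ B *ᵥ listMat P l *ᵥ f) x) ^ 2) ≤
      ∑ i ∈ Finset.range B, p * B * (p * expec p j (fun l =>
        jumpEnergy P p (ν ᵥ* lazyMat P p ^ (i + 1)) (J - 1 - j) (listMat P l *ᵥ f))) := by
    intro j hj
    have hj' := Finset.mem_range.1 hj
    have : ∀ i, p * B * (p * expec p j (fun l =>
        jumpEnergy P p (ν ᵥ* lazyMat P p ^ (i + 1)) (J - 1 - j) (listMat P l *ᵥ f))) =
        expec p j (fun l => p ^ 2 * B * jumpEnergy P p (ν ᵥ* lazyMat P p ^ (i + 1)) (J - 1 - j)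
          (listMat P l *ᵥ f)) := fun i => by rw [expec_const_mul]; ring
    simp only [this]
    rw [← expec_sum]
    refine expec_mono h.pos.le h.card_mul_le fun l => ?_
    set g := listMat P l *ᵥ f
    have hu := anc_nonneg h.mem h.pos.le h.le_one h0 0 (J - j)
    calc ∑ x, anc P p ν 0 (J - j) x * (g x - (lazyMat P p ^ B *ᵥ g) x) ^ 2
        ≤ ∑ x, anc P p ν 0 (J - j) x * (p ^ 2 * B * ∑ i ∈ Finset.range B,
            (lazyMat P p ^ i *ᵥ fun y => jump P g y ^ 2) x) :=
          Finset.sum_le_sum fun x _ =>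
            mul_le_mul_of_nonneg_left (sq_sub_lazyMat_pow_le hH B g x) (hu x)
      _ = ∑ i ∈ Finset.range B, p ^ 2 * B *
            (anc P p ν 0 (J - j) ⬝ᵥ lazyMat P p ^ i *ᵥ fun y => jump P g y ^ 2) := by
          simp only [dotProduct, Finset.mul_sum]
          rw [Finset.sum_comm]
          exact Finset.sum_congr rfl fun i _ => Finset.sum_congr rfl fun x _ => by ring
      -- Of the `J - j + i` lazy steps, `i + 1` are moved into the initial law. What remains has the
      -- length required by `IsSetup.sum_jumpEnergy_le`, which is uniform in the initial law.
      _ = _ := by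
          refine Finset.sum_congr rfl fun i _ => ?_
          rw [jumpEnergy, Matrix.dotProduct_mulVec, anc_zero, anc_zero, Matrix.vecMul_vecMul,
            Matrix.vecMul_vecMul, ← pow_add, ← pow_add,
            show J - j + i = i + 1 + (J - 1 - j) by omega]
          rfl
  refine (Finset.sum_le_sum point).trans ?_
  rw [Finset.sum_comm]
  have : ∀ i ∈ Finset.range B, ∑ j ∈ Finset.range J, p * B * (p * expec p j (fun l =>
        jumpEnergy P p (ν ᵥ* lazyMat P p ^ (i + 1)) (J - 1 - j) (listMat P l *ᵥ f))) ≤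
        p * B * concConst K := by
    intro i _
    rw [← Finset.mul_sum, ← Finset.mul_sum]
    have hν := vecMul_prob (pow_mem hH (i + 1)) h0 h1
    exact mul_le_mul_of_nonneg_left (h.sum_jumpEnergy_le hν.1 hν.2 hf J)
      (mul_nonneg h.pos.le (Nat.cast_nonneg B))
  refine (Finset.sum_le_sum this).trans_eq ?_
  rw [Finset.sum_const, Finset.card_range, nsmul_eq_mul]; ring

/-- After `J` steps the law of the fragments is spread out, in mean square. -/
theorem IsSetup.expec_sum_sq_le (h : IsSetup P p K) {ν : V → ℝ} (h0 : ∀ x, 0 ≤ ν x)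
    (h1 : ∑ x, ν x = 1) {B : ℕ} {c : ℝ} (hc : ∀ x y, (lazyMat P p ^ B) x y ≤ c) (J m₀ : ℕ) :
    J * expec p J (fun l => ∑ y, (ν ᵥ* listMat P l ᵥ* lazyMat P p ^ m₀) y ^ 2) ≤
      2 * (p * B ^ 2 * concConst K) + 2 * (J * ((1 + concConst K) * c)) := by
  have hH := h.lazy_mem
  have hC := concConst_pos h.one_le
  set S : ℝ := ((Fintype.card (V → Bool) : ℕ) : ℝ) with hS
  have hS0 : 0 < S := by
    rw [hS]; exact_mod_cast Fintype.card_pos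
  obtain ⟨x₀⟩ : Nonempty V := by
    by_contra hne
    rw [not_nonempty_iff] at hne
    simp at h1
  have hc0 : 0 ≤ c := (nonneg_of_mem_rowStochastic (pow_mem hH B)).trans (hc x₀ x₀)
  -- The extra `m₀` lazy steps are absorbed into the initial condition, whose values stay in `[-1,
  -- 1]`.
  set F : (V → Bool) → V → ℝ := fun s => lazyMat P p ^ m₀ *ᵥ signFun s with hF
  have hF1 : ∀ s x, |F s x| ≤ 1 := fun s => abs_mulVec_le (pow_mem hH m₀) (abs_signFun s)
  have eL : S * expec p J (fun l => ∑ y, (ν ᵥ* listMat P l ᵥ* lazyMat P p ^ m₀) y ^ 2) =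
      ∑ s, expec p J (fun l => (ν ⬝ᵥ listMat P l *ᵥ F s) ^ 2) := by
    rw [← expec_sum, ← expec_const_mul]
    congr 1
    ext l
    rw [hS, ← sum_sq_dotProduct_signFun]
    refine Finset.sum_congr rfl fun s _ => ?_
    rw [hF, Matrix.dotProduct_mulVec, Matrix.dotProduct_mulVec]
  -- The mean square at the end is bounded by the one at any earlier step `j`. There the opinions
  -- are compared with their averages over `B` lazy steps: summing over `j` bounds the distance by
  -- the energy, while the averages are taken against vectors with entries at most `c` and fall
  -- under `IsSetup.expec_sq_le`.
  have b1 : ∀ s, ∀ j ∈ Finset.range J, expec p J (fun l => (ν ⬝ᵥ listMat P l *ᵥ F s) ^ 2) ≤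
      2 * expec p j (fun l => ∑ x, anc P p ν 0 (J - j) x *
        ((listMat P l *ᵥ F s) x - (lazyMat P p ^ B *ᵥ listMat P l *ᵥ F s) x) ^ 2) +
      2 * ∑ x, anc P p ν 0 (J - j) x * ((((lazyMat P p ^ (B + j + m₀)) x) ⬝ᵥ signFun s) ^ 2 +
        c * concConst K) := by
    intro s j hj
    have hj' := (Finset.mem_range.1 hj).le
    have a1 : expec p J (fun l => (ν ⬝ᵥ listMat P l *ᵥ F s) ^ 2) ≤
        expec p J (fun l => sqEnergy P p ν 0 (listMat P l *ᵥ F s)) := by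
      refine expec_mono h.pos.le h.card_mul_le fun l => ?_
      rw [sqEnergy, anc_zero, pow_zero, Matrix.vecMul_one]
      exact sq_dotProduct_le h0 h1
    have a2 := h.expec_sqEnergy_le h0 (F s) j (J - j) 0
    rw [Nat.add_sub_cancel' hj', zero_add] at a2
    have hu := anc_nonneg h.mem h.pos.le h.le_one h0 0 (J - j)
    have a3 : expec p j (fun l => sqEnergy P p ν (J - j) (listMat P l *ᵥ F s)) ≤
        2 * expec p j (fun l => ∑ x, anc P p ν 0 (J - j) x *
          ((listMat P l *ᵥ F s) x - (lazyMat P p ^ B *ᵥ listMat P l *ᵥ F s) x) ^ 2) +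
        2 * ∑ x, anc P p ν 0 (J - j) x *
          expec p j (fun l => (((lazyMat P p ^ B) x) ⬝ᵥ listMat P l *ᵥ F s) ^ 2) := by
      simp only [← expec_const_mul, ← expec_sum, ← expec_add]
      refine expec_mono h.pos.le h.card_mul_le fun l => ?_
      rw [sqEnergy, Finset.mul_sum, Finset.mul_sum, ← Finset.sum_add_distrib]
      refine Finset.sum_le_sum fun x _ => ?_
      set g := listMat P l *ᵥ F s
      change _ ≤ 2 * (anc P p ν 0 (J - j) x * (g x - (lazyMat P p ^ B *ᵥ g) x) ^ 2) +
        2 * (anc P p ν 0 (J - j) x * ((lazyMat P p ^ B *ᵥ g) x) ^ 2)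
      have : g x ^ 2 ≤ 2 * (g x - (lazyMat P p ^ B *ᵥ g) x) ^ 2 +
          2 * ((lazyMat P p ^ B *ᵥ g) x) ^ 2 := by
        nlinarith [sq_nonneg (g x - 2 * (lazyMat P p ^ B *ᵥ g) x)]
      nlinarith [mul_le_mul_of_nonneg_left this (hu x)]
    refine a1.trans (a2.trans (a3.trans (add_le_add_right (mul_le_mul_of_nonneg_left
      (Finset.sum_le_sum fun x _ => mul_le_mul_of_nonneg_left ?_ (hu x)) (by norm_num)) _)))
    have hB := pow_mem hH B
    have hrow : ∀ m, ((lazyMat P p ^ B) x) ᵥ* lazyMat P p ^ m = (lazyMat P p ^ (B + m)) x := by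
      intro m; rw [pow_add]; rfl
    have a4 := h.expec_sq_le (M := (lazyMat P p ^ B) x) (η := c)
      (fun _ => nonneg_of_mem_rowStochastic hB) (sum_row_of_mem_rowStochastic hB x) hc0
      (fun m y => by rw [hrow]; exact pow_entry_le hH (Nat.le_add_right B m) hc x y) (hF1 s) j
    refine a4.trans_eq ?_
    rw [hrow, hF, Matrix.dotProduct_mulVec]
    congr 3
    rw [pow_add _ (B + j)]
    rfl
  have b2 : ∀ j, ∑ s, ∑ x, anc P p ν 0 (J - j) x *
      ((((lazyMat P p ^ (B + j + m₀)) x) ⬝ᵥ signFun s) ^ 2 + c * concConst K) ≤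
      S * ((1 + concConst K) * c) := by
    intro j
    have hu := anc_nonneg h.mem h.pos.le h.le_one h0 0 (J - j)
    rw [Finset.sum_comm]
    have e : ∀ x ∈ Finset.univ, ∑ s, anc P p ν 0 (J - j) x *
        ((((lazyMat P p ^ (B + j + m₀)) x) ⬝ᵥ signFun s) ^ 2 + c * concConst K) ≤
        anc P p ν 0 (J - j) x * (S * ((1 + concConst K) * c)) := by
      intro x _
      rw [← Finset.mul_sum]
      refine mul_le_mul_of_nonneg_left ?_ (hu x)
      rw [Finset.sum_add_distrib, sum_sq_dotProduct_signFun, Finset.sum_const, Finset.card_univ,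
        nsmul_eq_mul]
      have hk := pow_mem hH (B + j + m₀)
      have e2 : ∑ y, (lazyMat P p ^ (B + j + m₀)) x y ^ 2 ≤ c := by
        simp only [sq]
        exact dotProduct_le_of_forall_le (ν := (lazyMat P p ^ (B + j + m₀)) x)
          (fun _ => nonneg_of_mem_rowStochastic hk) (sum_row_of_mem_rowStochastic hk x)
          (fun y => pow_entry_le hH (by omega) hc x y)
      nlinarith [mul_le_mul_of_nonneg_left e2 hS0.le]
    refine (Finset.sum_le_sum e).trans_eq ?_
    rw [← Finset.sum_mul, sum_anc_zero h.mem h.pos.le h.le_one h1, one_mul]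
  have b3 : ∀ s, J * expec p J (fun l => (ν ⬝ᵥ listMat P l *ᵥ F s) ^ 2) ≤
      2 * (p * B ^ 2 * concConst K) + 2 * ∑ j ∈ Finset.range J, ∑ x, anc P p ν 0 (J - j) x *
        ((((lazyMat P p ^ (B + j + m₀)) x) ⬝ᵥ signFun s) ^ 2 + c * concConst K) := by
    intro s
    have e1 := Finset.sum_le_sum (b1 s)
    rw [Finset.sum_const, Finset.card_range, nsmul_eq_mul, Finset.sum_add_distrib,
      ← Finset.mul_sum, ← Finset.mul_sum] at e1
    have e2 := h.sum_expec_sub_sq_le h0 h1 (hF1 s) B J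
    linarith
  have b4 := Finset.sum_le_sum fun s (_ : s ∈ Finset.univ) => b3 s
  rw [← Finset.mul_sum, ← eL, Finset.sum_add_distrib, Finset.sum_const, Finset.card_univ,
    nsmul_eq_mul, ← Finset.mul_sum, Finset.sum_comm] at b4
  have b5 := Finset.sum_le_sum fun j (_ : j ∈ Finset.range J) => b2 j
  rw [Finset.sum_const, Finset.card_range, nsmul_eq_mul] at b5
  refine le_of_mul_le_mul_left ?_ hS0
  have b6 : ((Fintype.card (V → Bool) : ℕ) : ℝ) = S := rfl
  rw [b6] at b4
  linarith

/-- A probability vector all of whose images under the lazy walk have small entries. -/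
def IsSpread (P : Matrix V V ℝ) (p η : ℝ) (ν : V → ℝ) : Prop :=
  ∀ m x, (ν ᵥ* lazyMat P p ^ m) x ≤ η

theorem one_eighth_le_pow {q : ℕ} (h1 : p ≤ 1 / 16) (hq : p * q ≤ 1) :
    1 / 8 ≤ (1 - p) ^ q := by
  have e1 : Real.exp (-(2 * p)) ≤ 1 - p ∨ p < 0 := by
    rcases lt_or_ge p 0 with hp | hp
    · exact Or.inr hp
    · left
      rw [Real.exp_neg, inv_le_comm₀ (Real.exp_pos _) (by linarith)]
      refine le_trans ?_ (Real.add_one_le_exp (2 * p))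
      rw [inv_le_iff_one_le_mul₀ (by linarith)]
      nlinarith
  rcases e1 with e1 | e1
  · calc (1 / 8 : ℝ) ≤ Real.exp (-2) := by
          rw [Real.exp_neg, show (2 : ℝ) = 1 + 1 by norm_num, Real.exp_add, one_div]
          refine inv_anti₀ (by positivity) ?_
          nlinarith [Real.exp_one_lt_d9, Real.exp_pos 1]
      _ ≤ Real.exp (-(2 * p)) ^ q := by
          rw [← Real.exp_nat_mul, Real.exp_le_exp]; linarith
      _ ≤ (1 - p) ^ q := pow_le_pow_left₀ (Real.exp_pos _).le e1 q
  · exact le_trans (by norm_num) (one_le_pow₀ (by linarith : (1 : ℝ) ≤ 1 - p))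

theorem pow_le_lazyMat_pow_diag (hP : P ∈ rowStochastic ℝ V) (h0 : 0 ≤ p) (h1 : p ≤ 1) (d : ℕ)
    (x : V) : (1 - p) ^ d ≤ (lazyMat P p ^ d) x x := by
  rw [lazyMat_pow, Matrix.sum_apply]
  have := Finset.single_le_sum (f := fun l => (binom p d l • P ^ l) x x)
    (fun l _ => mul_nonneg (binom_nonneg h0 h1 d l) (pow_nonneg_entries hP l x x))
    (Finset.mem_range.2 (Nat.succ_pos d))
  simpa [binom] using this

open Classical in
/-- With conditional probability at least one half, a long block of steps spreads out any
probability vector. -/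
theorem IsSetup.expec_not_isSpread_le (h : IsSetup P p K) {ν : V → ℝ} (h0 : ∀ x, 0 ≤ ν x)
    (h1 : ∑ x, ν x = 1) {B q R : ℕ} (hq : 1 ≤ q) (hpq : p * q ≤ 1) {c η : ℝ} (hη : 0 < η)
    (hc : ∀ x y, (lazyMat P p ^ B) x y ≤ c) (hR : ∀ x y, (lazyMat P p ^ (R * q)) x y ≤ η) (J : ℕ) :
    J * expec p J (fun l => if IsSpread P p η (ν ᵥ* listMat P l) then 0 else 1) ≤
      64 / η ^ 2 * ((R + 1) * (2 * (p * B ^ 2 * concConst K) +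
        2 * (J * ((1 + concConst K) * c)))) := by
  have hH := h.lazy_mem
  have key : ∀ l : List (Option V), (if IsSpread P p η (ν ᵥ* listMat P l) then (0 : ℝ) else 1) ≤
      64 / η ^ 2 * ∑ i ∈ Finset.range (R + 1),
        ∑ y, (ν ᵥ* listMat P l ᵥ* lazyMat P p ^ (i * q)) y ^ 2 := by
    intro l
    have hpos : 0 ≤ 64 / η ^ 2 * ∑ i ∈ Finset.range (R + 1),
        ∑ y, (ν ᵥ* listMat P l ᵥ* lazyMat P p ^ (i * q)) y ^ 2 :=
      mul_nonneg (by positivity) (Finset.sum_nonneg fun i _ => Finset.sum_nonneg fun y _ =>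
        sq_nonneg _)
    split_ifs with hs
    · exact hpos
    · unfold IsSpread at hs
      push Not at hs
      obtain ⟨m, x, hmx⟩ := hs
      have hν := vecMul_prob (listMat_mem h.mem l) h0 h1
      set ν' := ν ᵥ* listMat P l
      -- From `R * q` lazy steps on the bound `η` is automatic, so a violation occurs earlier.
      have hm : m < R * q := by
        by_contra hm
        refine absurd (dotProduct_le_of_forall_le (g := fun y => (lazyMat P p ^ m) y x) hν.1 hν.2
          fun y => pow_entry_le hH (not_lt.1 hm) hR y x) (not_le.2 hmx)
      -- Rounding up to the next multiple of `q` leaves at most `q` further lazy steps, during which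
      -- an eighth of the mass at `x` stays in place. So only `R + 1` times need to be examined.
      set i := m / q + 1 with hi
      have hiR : i ≤ R := by
        have := (Nat.div_lt_iff_lt_mul hq).2 hm
        omega
      have him : m < i * q := Nat.lt_div_mul_add hq |>.trans_eq (by rw [hi]; ring)
      have himq : i * q ≤ m + q := by
        rw [hi, add_mul, one_mul]
        exact Nat.add_le_add_right (Nat.div_mul_le_self m q) q
      have hd : (lazyMat P p ^ (i * q)) = lazyMat P p ^ m * lazyMat P p ^ (i * q - m) := by
        rw [← pow_add, Nat.add_sub_cancel' him.le]
      have hdiag : 1 / 8 ≤ (lazyMat P p ^ (i * q - m)) x x := by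
        refine (one_eighth_le_pow h.le hpq).trans (le_trans ?_
          (pow_le_lazyMat_pow_diag h.mem h.pos.le h.le_one _ x))
        exact pow_le_pow_of_le_one (by linarith [h.le_one]) (by linarith [h.pos]) (by omega)
      have hν2 := vecMul_prob (pow_mem hH m) hν.1 hν.2
      have hval : η / 8 ≤ (ν' ᵥ* lazyMat P p ^ (i * q)) x := by
        rw [hd, ← Matrix.vecMul_vecMul]
        refine le_trans ?_ (Finset.single_le_sum (f := fun y => (ν' ᵥ* lazyMat P p ^ m) y *
          (lazyMat P p ^ (i * q - m)) y x) (fun y _ => mul_nonneg (hν2.1 y)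
            (nonneg_of_mem_rowStochastic (pow_mem hH _))) (Finset.mem_univ x))
        nlinarith
      have hsq : (η / 8) ^ 2 ≤ ∑ i ∈ Finset.range (R + 1),
          ∑ y, (ν' ᵥ* lazyMat P p ^ (i * q)) y ^ 2 := by
        refine (pow_le_pow_left₀ (by positivity) hval 2).trans ?_
        refine (Finset.single_le_sum (f := fun y => (ν' ᵥ* lazyMat P p ^ (i * q)) y ^ 2)
          (fun y _ => sq_nonneg _) (Finset.mem_univ x)).trans ?_
        exact Finset.single_le_sum (f := fun i => ∑ y, (ν' ᵥ* lazyMat P p ^ (i * q)) y ^ 2)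
          (fun i _ => Finset.sum_nonneg fun y _ => sq_nonneg _)
          (Finset.mem_range.2 (Nat.lt_succ_of_le hiR))
      calc (1 : ℝ) = 64 / η ^ 2 * (η / 8) ^ 2 := by field_simp; norm_num
        _ ≤ _ := mul_le_mul_of_nonneg_left hsq (by positivity)
  have e1 := expec_mono (p := p) (j := J) h.pos.le h.card_mul_le key
  rw [expec_const_mul, expec_sum] at e1
  have e2 := mul_le_mul_of_nonneg_left e1 (Nat.cast_nonneg J : (0 : ℝ) ≤ J)
  refine e2.trans ?_
  rw [mul_left_comm, Finset.mul_sum]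
  refine mul_le_mul_of_nonneg_left ?_ (by positivity)
  refine (Finset.sum_le_sum fun i _ => h.expec_sum_sq_le h0 h1 hc J (i * q)).trans_eq ?_
  rw [Finset.sum_const, Finset.card_range, nsmul_eq_mul]
  push_cast
  ring

end Spreading

end DeGroot

namespace DeGroot

open Matrix

/-! ### Hoeffding's inequality for the initial opinions and repeated trials. -/

section Initial

set_option linter.unusedSectionVars false

variable {V : Type*} [Fintype V] [DecidableEq V] {P : Matrix V V ℝ} {p : ℝ} {K : ℕ}
variable {Ω : Type*} [MeasurableSpace Ω] {μ : Measure Ω} [IsProbabilityMeasure μ]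
  {f₀ : V → Ω → ℝ} {m : ℝ}

theorem IsIIDOpinions.aemeasurable (hf : IsIIDOpinions f₀ m μ) (v : V) : AEMeasurable (f₀ v) μ :=
  (hf.identDistrib v v).aemeasurable_fst

theorem IsIIDOpinions.aemeasurable_dotProduct (hf : IsIIDOpinions f₀ m μ) (ν : V → ℝ) :
    AEMeasurable (fun ω => ν ⬝ᵥ fun v => f₀ v ω) μ := by
  have h : (fun ω => ν ⬝ᵥ fun v => f₀ v ω) = fun ω => ∑ v ∈ Finset.univ, ν v * f₀ v ω := rfl
  rw [h]
  exact Finset.aemeasurable_fun_sum _ fun v _ => (hf.aemeasurable v).const_mul _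

/-- The probability that the `ν`-average of the initial opinions is more than `t` away from the
mean. -/
noncomputable def devProb (μ : Measure Ω) (f₀ : V → Ω → ℝ) (m : ℝ) (ν : V → ℝ) (t : ℝ) : ℝ :=
  μ.real {ω | t < |(ν ⬝ᵥ fun v => f₀ v ω) - m|}

theorem devProb_le_one (ν : V → ℝ) (t : ℝ) : devProb μ f₀ m ν t ≤ 1 := measureReal_le_one

theorem IsIIDOpinions.measure_sum_ge_le (hf : IsIIDOpinions f₀ m μ) {ν : V → ℝ} {η t : ℝ}
    (hη : ∑ v, ν v ^ 2 ≤ η) (hpos : 0 < ∑ v, ν v ^ 2) (ht : 0 ≤ t) :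
    μ.real {ω | t ≤ ∑ v, ν v * (f₀ v ω - m)} ≤ Real.exp (-(2 * t ^ 2 / η)) := by
  have h1 : iIndepFun (fun v ω => ν v * (f₀ v ω - m)) μ :=
    hf.indep.comp (fun v x => ν v * (x - m)) fun v => by fun_prop
  have h2 : ∀ v, HasSubgaussianMGF (fun ω => ν v * (f₀ v ω - m))
      (Real.toNNReal (ν v ^ 2 / 4)) μ := by
    intro v
    have := (hasSubgaussianMGF_of_mem_Icc (hf.aemeasurable v) (hf.mem_Icc v)).const_mul (ν v)
    rw [hf.mean v] at this
    convert this using 1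
    refine NNReal.eq ?_
    rw [Real.coe_toNNReal _ (by positivity)]
    change _ = ν v ^ 2 * (((‖(1 : ℝ) - 0‖₊ / 2) ^ 2 : ℝ≥0) : ℝ)
    norm_num
    ring
  have h3 := HasSubgaussianMGF.measure_sum_ge_le_of_iIndepFun h1
    (s := Finset.univ) (fun v _ => h2 v) ht
  refine h3.trans (Real.exp_le_exp.2 ?_)
  have e : ((∑ v, Real.toNNReal (ν v ^ 2 / 4) : ℝ≥0) : ℝ) = (∑ v, ν v ^ 2) / 4 := by
    rw [Finset.sum_div, NNReal.coe_sum]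
    exact Finset.sum_congr rfl fun v _ => Real.coe_toNNReal _ (by positivity)
  rw [e, neg_div, neg_le_neg_iff, div_le_div_iff₀ (hpos.trans_le hη) (by linarith)]
  nlinarith [sq_nonneg t, mul_le_mul_of_nonneg_left hη (sq_nonneg t)]

/-- Hoeffding's inequality for weighted averages of the initial opinions. -/
theorem IsIIDOpinions.devProb_le (hf : IsIIDOpinions f₀ m μ) {ν : V → ℝ} {η t : ℝ}
    (h0 : ∀ x, 0 ≤ ν x) (h1 : ∑ x, ν x = 1) (hη : ∀ x, ν x ≤ η) (ht : 0 ≤ t) :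
    devProb μ f₀ m ν t ≤ 2 * Real.exp (-(2 * t ^ 2 / η)) := by
  have hsq : ∑ v, ν v ^ 2 ≤ η := by
    simp only [sq]
    exact dotProduct_le_of_forall_le h0 h1 hη
  have hpos : 0 < ∑ v, ν v ^ 2 := by
    refine (Finset.sum_nonneg fun v _ => sq_nonneg _).lt_of_ne' fun h => ?_
    rw [Finset.sum_eq_zero_iff_of_nonneg fun v _ => sq_nonneg _] at h
    have : ∑ x, ν x = 0 := Finset.sum_eq_zero fun v hv => by simpa using h v hv
    linarith
  have a1 := hf.measure_sum_ge_le hsq hpos ht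
  have a2 := hf.measure_sum_ge_le (ν := -ν) (by simpa using hsq) (by simpa using hpos) ht
  have hsub : {ω | t < |(ν ⬝ᵥ fun v => f₀ v ω) - m|} ⊆
      {ω | t ≤ ∑ v, ν v * (f₀ v ω - m)} ∪ {ω | t ≤ ∑ v, (-ν) v * (f₀ v ω - m)} := by
    intro ω hω
    have e : ∑ v, ν v * (f₀ v ω - m) = (ν ⬝ᵥ fun v => f₀ v ω) - m := by
      simp only [mul_sub, Finset.sum_sub_distrib, ← Finset.sum_mul, h1, one_mul]
      rfl
    have e' : ∑ v, (-ν) v * (f₀ v ω - m) = -((ν ⬝ᵥ fun v => f₀ v ω) - m) := by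
      rw [← e, ← Finset.sum_neg_distrib]
      exact Finset.sum_congr rfl fun v _ => by simp
    simp only [Set.mem_ofPred_eq, Set.mem_union, e, e'] at hω ⊢
    rcases lt_abs.1 hω with h | h
    · exact Or.inl h.le
    · exact Or.inr h.le
  refine (measureReal_mono hsub).trans ((measureReal_union_le _ _).trans ?_)
  linarith

theorem integral_expec {F : List (Option V) → Ω → ℝ} (hF : ∀ l, Integrable (F l) μ) (j : ℕ) :
    Integrable (fun ω => expec p j fun l => F l ω) μ ∧
    ∫ ω, expec p j (fun l => F l ω) ∂μ = expec p j fun l => ∫ ω, F l ω ∂μ := by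
  induction j generalizing F with
  | zero => exact ⟨hF [], rfl⟩
  | succ j ih =>
    have ih' := fun a => ih (F := fun l => F (a :: l)) fun l => hF (a :: l)
    simp only [expec]
    refine ⟨integrable_finsetSum _ fun a _ => (ih' a).1.const_mul _, ?_⟩
    rw [integral_finsetSum _ fun a _ => (ih' a).1.const_mul _]
    exact Finset.sum_congr rfl fun a _ => by rw [integral_const_mul, (ih' a).2]

theorem integral_ite_lt {X : Ω → ℝ} (hX : AEMeasurable X μ) (t : ℝ) :
    Integrable (fun ω => if t < X ω then (1 : ℝ) else 0) μ ∧
    ∫ ω, (if t < X ω then (1 : ℝ) else 0) ∂μ = μ.real {ω | t < X ω} := by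
  have hs : NullMeasurableSet {ω | t < X ω} μ := nullMeasurableSet_lt aemeasurable_const hX
  have e : (fun ω => if t < X ω then (1 : ℝ) else 0) =
      {ω | t < X ω}.indicator fun _ => (1 : ℝ) := by
    ext ω; simp [Set.indicator_apply]
  rw [e]
  refine ⟨(integrable_const _).indicator₀ hs, ?_⟩
  rw [integral_indicator₀ hs]
  simp

/-- From a spread out probability vector, the dynamics concentrates the averaged opinion. -/
theorem IsSetup.expec_devProb_le_of_isSpread (h : IsSetup P p K) (hf : IsIIDOpinions f₀ m μ)
    {ν : V → ℝ} (h0 : ∀ x, 0 ≤ ν x) (h1 : ∑ x, ν x = 1) {η ε : ℝ} (hη : 0 < η)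
    (hs : IsSpread P p η ν) (hε0 : 0 ≤ ε) (hε1 : ε ≤ 1) (J : ℕ) :
    expec p J (fun l => devProb μ f₀ m (ν ᵥ* listMat P l) (2 * ε)) ≤
      2 * Real.exp (-(ε ^ 2 / (4 * concConst K * η))) + 2 * Real.exp (-(2 * ε ^ 2 / η)) := by
  set F : List (Option V) → Ω → ℝ := fun l ω =>
    if 2 * ε < |((ν ᵥ* listMat P l) ⬝ᵥ fun v => f₀ v ω) - m| then 1 else 0 with hF
  have hX : ∀ ν' : V → ℝ, AEMeasurable (fun ω => |(ν' ⬝ᵥ fun v => f₀ v ω) - m|) μ := fun ν' =>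
    ((hf.aemeasurable_dotProduct ν').sub_const m).norm
  have hFi := fun l => integral_ite_lt (hX (ν ᵥ* listMat P l)) (2 * ε)
  have e1 := integral_expec (p := p) (F := F) (fun l => (hFi l).1) J
  have e2 : expec p J (fun l => devProb μ f₀ m (ν ᵥ* listMat P l) (2 * ε)) =
      ∫ ω, expec p J (fun l => F l ω) ∂μ := by
    rw [e1.2]
    congr 1
    ext l
    exact (hFi l).2.symm
  set ν' := ν ᵥ* lazyMat P p ^ J
  have hν' := vecMul_prob (pow_mem h.lazy_mem J) h0 h1
  have hG := integral_ite_lt (hX ν') ε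
  have hae : ∀ᵐ ω ∂μ, ∀ v, f₀ v ω ∈ Set.Icc (0 : ℝ) 1 := ae_all_iff.2 hf.mem_Icc
  -- For fixed initial opinions the steps concentrate the average around its conditional mean, the
  -- average against `ν'`; that `ν'`-average is then compared with `m`, at a further distance `ε`.
  have hle : ∀ᵐ ω ∂μ, expec p J (fun l => F l ω) ≤
      2 * Real.exp (-(ε ^ 2 / (4 * concConst K * η))) +
        if ε < |(ν' ⬝ᵥ fun v => f₀ v ω) - m| then 1 else 0 := by
    filter_upwards [hae] with ω hω
    have a1 := h.expec_indicator_le h0 h1 hη hs hε0 hε1 (f := fun v => f₀ v ω)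
      (fun x => abs_le.2 ⟨by linarith [(hω x).1], (hω x).2⟩) J
    refine le_trans ?_ (add_le_add_left a1 _)
    rw [← expec_const (V := V) (p := p) J (if ε < |(ν' ⬝ᵥ fun v => f₀ v ω) - m| then (1 : ℝ) else 0),
      ← expec_add]
    refine expec_mono h.pos.le h.card_mul_le fun l => ?_
    simp only [hF]
    rw [Matrix.dotProduct_mulVec]
    set a := (ν ᵥ* listMat P l) ⬝ᵥ fun v => f₀ v ω
    set b := ν' ⬝ᵥ fun v => f₀ v ω
    have tri : |a - m| ≤ |a - b| + |b - m| := abs_sub_le a b m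
    split_ifs with c1 c2 c3 c3 <;> linarith
  rw [e2]
  refine (integral_mono_ae e1.1 ((integrable_const _).add hG.1) hle).trans ?_
  rw [integral_add' (integrable_const _) hG.1, hG.2, integral_const]
  simp only [probReal_univ, smul_eq_mul, one_mul]
  gcongr
  refine hf.devProb_le hν'.1 hν'.2 (fun x => hs J x) hε0

open Classical in
/-- Repeated trials: if from every probability vector a block of `ℓ` steps spreads out the mass
with probability at least one half, then `k` blocks concentrate the averaged opinion. -/
theorem IsSetup.expec_devProb_le (h : IsSetup P p K) (hf : IsIIDOpinions f₀ m μ)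
    {η ε : ℝ} (hη : 0 < η) (hε0 : 0 ≤ ε) (hε1 : ε ≤ 1) {ℓ : ℕ}
    (hblock : ∀ ν : V → ℝ, (∀ x, 0 ≤ ν x) → ∑ x, ν x = 1 →
      expec p ℓ (fun l => if IsSpread P p η (ν ᵥ* listMat P l) then 0 else 1) ≤ 1 / 2)
    (k : ℕ) {ν : V → ℝ} (h0 : ∀ x, 0 ≤ ν x) (h1 : ∑ x, ν x = 1) :
    expec p (k * ℓ) (fun l => devProb μ f₀ m (ν ᵥ* listMat P l) (2 * ε)) ≤
      (1 / 2) ^ k + 2 * (2 * Real.exp (-(ε ^ 2 / (4 * concConst K * η))) +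
        2 * Real.exp (-(2 * ε ^ 2 / η))) := by
  set δ := 2 * Real.exp (-(ε ^ 2 / (4 * concConst K * η))) + 2 * Real.exp (-(2 * ε ^ 2 / η))
    with hδ
  have hδ0 : 0 ≤ δ := by positivity
  induction k generalizing ν with
  | zero =>
    rw [Nat.zero_mul, pow_zero]
    have : expec p 0 (fun l => devProb μ f₀ m (ν ᵥ* listMat P l) (2 * ε)) ≤ 1 := devProb_le_one _ _
    linarith
  | succ k ih =>
    rw [show (k + 1) * ℓ = ℓ + k * ℓ by ring, expec_append]
    -- The block examined is the last one in time. If it spreads the mass, the earlier steps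
    -- concentrate with error `δ`; otherwise the induction hypothesis applies to the vector it
    -- leaves. Failure having probability at most one half, the term `2 * δ` reproduces itself.
    have step : ∀ l : List (Option V),
        expec p (k * ℓ) (fun l' => devProb μ f₀ m (ν ᵥ* listMat P (l ++ l')) (2 * ε)) ≤
        δ + ((1 / 2) ^ k + 2 * δ) * (if IsSpread P p η (ν ᵥ* listMat P l) then 0 else 1) := by
      intro l
      have hν := vecMul_prob (listMat_mem h.mem l) h0 h1
      simp only [listMat_append, ← Matrix.vecMul_vecMul]
      split_ifs with hs
      · rw [mul_zero, add_zero]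
        exact h.expec_devProb_le_of_isSpread hf hν.1 hν.2 hη hs hε0 hε1 _
      · have := ih hν.1 hν.2
        linarith
    refine (expec_mono h.pos.le h.card_mul_le step).trans ?_
    rw [expec_add, expec_const, expec_const_mul]
    have := mul_le_mul_of_nonneg_left (hblock ν h0 h1)
      (by positivity : 0 ≤ (1 / 2 : ℝ) ^ k + 2 * δ)
    rw [pow_succ]
    linarith

end Initial

end DeGroot

namespace DeGroot

open Matrix

/-! ### Paths of the dynamics along a mesh. -/

section Path

set_option linter.unusedSectionVars false

variable {V : Type*} [Fintype V] [DecidableEq V] {P : Matrix V V ℝ} {p : ℝ}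

theorem not_rings_of_eq {N : ℝ≥0 → ℕ} (hN : Monotone N) {s t r : ℝ≥0} (h : N t = N s)
    (hsr : s < r) (hrt : r ≤ t) : ¬ Rings N r := fun hr =>
  absurd (hr.2 s hsr) (by have := hN hrt; omega)

/-- The ring is the infimum of the times at which the count exceeds `N s`; right-continuity of an
integer-valued path makes the infimum one of these times. -/
theorem exists_rings_of_lt {N : ℝ≥0 → ℕ} (hN : Monotone N)
    (hc : ∀ t, ContinuousWithinAt N (Set.Ici t) t) {s t : ℝ≥0} (h : N s < N t) :
    ∃ r, s < r ∧ r ≤ t ∧ Rings N r := by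
  set S : Set ℝ≥0 := {r | N s < N r}
  have htS : t ∈ S := h
  have hb : BddBelow S := OrderBot.bddBelow S
  have hmem : sInf S ∈ S := by
    have h1 : ∀ᶠ x in 𝓝[≥] (sInf S), N x = N (sInf S) := by
      have := hc (sInf S)
      rw [ContinuousWithinAt, nhds_discrete ℕ, tendsto_pure] at this
      exact this
    obtain ⟨u, hu, hu'⟩ := (mem_nhdsGE_iff_exists_Ico_subset' (a := sInf S)
      (u' := sInf S + 1) (by simp)).1 h1
    obtain ⟨x, hx, hxu⟩ := exists_lt_of_csInf_lt ⟨t, htS⟩ hu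
    have : N x = N (sInf S) := hu' ⟨csInf_le hb hx, hxu⟩
    change N s < N (sInf S)
    rw [← this]; exact hx
  have hs : s < sInf S := by
    by_contra hle
    exact absurd (hN (not_lt.1 hle)) (not_le.2 hmem)
  refine ⟨sInf S, hs, csInf_le hb htS, (zero_le).trans_lt hs, fun r hr => ?_⟩
  have hrS : r ∉ S := fun h' => absurd (csInf_le hb h') (not_le.2 hr)
  exact (not_lt.1 hrS).trans_lt hmem

open Classical in
/-- The vertex that rings in a time interval, given the numbers of rings of all the vertices, if
exactly one vertex rings. -/
noncomputable def soleRing (d : V → ℕ) : Option V :=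
  -- The value is also `none` when several vertices ring, and still `some v` when `v` alone rings
  -- repeatedly. Both cases are excluded by `AtMostOne`.
  if h : ∃ v, d v ≠ 0 ∧ ∀ u, u ≠ v → d u = 0 then some h.choose else none

theorem soleRing_eq_some {d : V → ℕ} {v : V} :
    soleRing d = some v ↔ d v ≠ 0 ∧ ∀ u, u ≠ v → d u = 0 := by
  unfold soleRing
  constructor
  · intro h
    split_ifs at h with h'
    rw [Option.some_inj] at h
    exact h ▸ h'.choose_spec
  · intro h
    have h' : ∃ v, d v ≠ 0 ∧ ∀ u, u ≠ v → d u = 0 := ⟨v, h⟩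
    rw [dif_pos h', Option.some_inj]
    by_contra hne
    exact h'.choose_spec.1 (h.2 _ hne)

/-- At most one ring in total. -/
def AtMostOne (d : V → ℕ) : Prop := (∀ v, d v ≤ 1) ∧ ∀ u v, u ≠ v → d u = 0 ∨ d v = 0

theorem AtMostOne.eq_zero_of_soleRing {d : V → ℕ} (h : AtMostOne d) (h' : soleRing d = none)
    (v : V) : d v = 0 := by
  by_contra hv
  have : soleRing d = some v := soleRing_eq_some.2 ⟨hv, fun u hu => (h.2 u v hu).resolve_right hv⟩
  rw [h'] at this
  exact absurd this (by simp)

/-- The evolution of the opinions over a time interval with at most one ring. -/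
theorem opinion_eq_stepMat_mulVec {N : V → ℝ≥0 → ℕ} (hN : ∀ v, Monotone (N v))
    (hc : ∀ v t, ContinuousWithinAt (N v) (Set.Ici t) t) {s t : ℝ≥0} (hst : s ≤ t)
    (h : AtMostOne fun v => N v t - N v s) (f : V → ℝ) :
    opinion P N f t = stepMat P (soleRing fun v => N v t - N v s) *ᵥ opinion P N f s := by
  have heq : ∀ v, N v t - N v s = 0 → N v t = N v s := fun v hv => by
    have := hN v hst; omega
  cases ha : soleRing fun v => N v t - N v s with
  | none =>
    rw [stepMat_none_mulVec]
    ext v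
    exact opinion_eq_of_not_rings hN hst fun r h1 h2 =>
      not_rings_of_eq (hN v) (heq v (h.eq_zero_of_soleRing ha v)) h1 h2
  | some x =>
    obtain ⟨hx, hx'⟩ := soleRing_eq_some.1 ha
    obtain ⟨r, hsr, hrt, hr⟩ := exists_rings_of_lt (hN x) (hc x) (s := s) (t := t) (by omega)
    have hno : ∀ u, u ≠ x → ∀ r', s < r' → r' ≤ t → ¬ Rings (N u) r' := fun u hu r' h1 h2 =>
      not_rings_of_eq (hN u) (heq u (hx' u hu)) h1 h2
    have huniq : ∀ r', s < r' → r' ≤ t → Rings (N x) r' → r' = r := by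
      intro r' h1 h2 h3
      have hle := h.1 x
      have a1 := hN x hrt
      have a2 := hN x h2
      have a3 := hr.2 s hsr
      have a4 := h3.2 s h1
      rcases lt_trichotomy r' r with hlt | he | hlt
      · have := hr.2 r' hlt; simp only at hle; omega
      · exact he
      · have := h3.2 r hlt; simp only at hle; omega
    have hl := ringList_eq_append hN hst (l := [r]) (List.pairwise_singleton _ _) (fun r' => by
      rw [List.mem_singleton]
      constructor
      · rintro rfl
        exact ⟨hsr, hrt, x, hr⟩
      · rintro ⟨h1, h2, u, hu⟩
        by_cases hux : u = x
        · subst hux; exact huniq r' h1 h2 hu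
        · exact absurd hu (hno u hux r' h1 h2))
    have h2 : opinion P N f t = update P N (opinion P N f s) r := by
      simp [opinion, hl]
    rw [h2, stepMat_some_mulVec]
    ext v
    rw [ringAt_apply, update]
    by_cases hv : v = x
    · subst hv
      rw [if_pos hr, if_pos rfl, jump, add_sub_cancel]
      rfl
    · rw [if_neg (hno v hv r hsr hrt), if_neg hv, add_zero]

/-- The opinions at a mesh point, if every mesh interval contains at most one ring. -/
theorem opinion_mesh {N : V → ℝ≥0 → ℕ} (hN : ∀ v, Monotone (N v))
    (hc : ∀ v t, ContinuousWithinAt (N v) (Set.Ici t) t) {τ : ℕ → ℝ≥0} (hτ : Monotone τ)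
    (hτ0 : τ 0 = 0) {J : ℕ} (h : ∀ i < J, AtMostOne fun v => N v (τ (i + 1)) - N v (τ i))
    (f : V → ℝ) :
    opinion P N f (τ J) = listMat P (List.ofFn fun i : Fin J =>
      soleRing fun v => N v (τ (i + 1)) - N v (τ i)).reverse *ᵥ f := by
  induction J with
  | zero => simp [hτ0, opinion_zero]
  | succ J ih =>
    rw [opinion_eq_stepMat_mulVec hN hc (hτ J.le_succ) (h J J.lt_succ_self),
      ih fun i hi => h i (hi.trans J.lt_succ_self), List.ofFn_succ', List.concat_eq_append,
      List.reverse_append, List.reverse_singleton, List.singleton_append, listMat_cons,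
      Matrix.mulVec_mulVec]
    rfl

/-- Independent identically distributed steps may be read in reverse, which reconciles the
chronological order of the mesh with the order of the factors in `listMat`. -/
theorem expec_reverse (j : ℕ) (F : List (Option V) → ℝ) :
    expec p j (fun l => F l.reverse) = expec p j F := by
  induction j generalizing F with
  | zero => rfl
  | succ j ih =>
    rw [expec_append j 1 F, expec]
    have e : ∀ l, expec p 1 (fun l' => F (l ++ l')) = ∑ a, stepWeight V p a * F (l ++ [a]) :=
      fun l => rfl
    simp only [e, expec_sum, expec_const_mul]
    refine Finset.sum_congr rfl fun a _ => ?_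
    rw [← ih fun l => F (l ++ [a])]
    simp only [List.reverse_cons]

end Path

end DeGroot

namespace DeGroot

open Matrix

/-! ### The law of the steps produced by Poisson clocks. -/

section Law

set_option linter.unusedSectionVars false

variable {V : Type*} [Fintype V] [DecidableEq V] {P : Matrix V V ℝ} {p : ℝ}
variable {Ω : Type*} [MeasurableSpace Ω] {μ : Measure Ω} [IsProbabilityMeasure μ]
  {N : V → ℝ≥0 → Ω → ℕ} {f₀ : V → Ω → ℝ} {m : ℝ}

/-- The law of the ring counts of all the vertices in an interval of length `δ`. -/
noncomputable abbrev countLaw (V : Type*) [Fintype V] (δ : ℝ≥0) : Measure (V → ℕ) :=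
  Measure.pi fun _ => poissonMeasure δ

/-- The space of counts is countable, so singletons suffice. Independence of the clocks factorises
over vertices, and independence of increments over mesh intervals. -/
theorem IsClockFamily.map_counts (hN : IsClockFamily N f₀ μ) {τ : ℕ → ℝ≥0} (hτ : Monotone τ)
    {δ : ℝ≥0} (hδ : ∀ i, τ (i + 1) - τ i = δ) (J : ℕ) :
    μ.map (fun ω (i : Fin J) v => N v (τ (i + 1)) ω - N v (τ i) ω) =
      Measure.pi fun _ : Fin J => countLaw V δ := by
  have hm : Measurable fun ω (i : Fin J) v => N v (τ (i + 1)) ω - N v (τ i) ω :=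
    measurable_pi_lambda _ fun i => measurable_pi_lambda _ fun v =>
      ((hN.poisson v).measurable _).sub ((hN.poisson v).measurable _)
  refine Measure.ext_of_singleton fun d => ?_
  rw [Measure.map_apply hm (measurableSet_singleton d), Measure.pi_singleton]
  simp only [Measure.pi_singleton]
  have e : (fun ω (i : Fin J) v => N v (τ (i + 1)) ω - N v (τ i) ω) ⁻¹' {d} =
      ⋂ v, (fun ω t => N v t ω) ⁻¹' (⋂ i : Fin J, {x | x (τ (i + 1)) - x (τ i) = d i v}) := by
    ext ω
    simp only [Set.mem_preimage, Set.mem_singleton_iff, Set.mem_iInter, Set.mem_ofPred_eq]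
    constructor
    · rintro h v i
      rw [← h]
    · intro h
      ext i v
      exact h v i
  have hms : ∀ v, MeasurableSet (⋂ i : Fin J, {x : ℝ≥0 → ℕ | x (τ (i + 1)) - x (τ i) = d i v}) :=
    fun v => MeasurableSet.iInter fun i => by
      have : Measurable fun x : ℝ≥0 → ℕ => x (τ (i + 1)) - x (τ i) := by fun_prop
      exact this (measurableSet_singleton _)
  rw [e, hN.indep.meas_iInter fun v => ⟨_, hms v, rfl⟩, Finset.prod_comm]
  refine Finset.prod_congr rfl fun v _ => ?_
  have hi := (hN.poisson v).indepIncrements J (fun i : Fin (J + 1) => τ i)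
    (hτ.comp Fin.val_strictMono.monotone)
  have e' : (fun ω t => N v t ω) ⁻¹' (⋂ i : Fin J, {x | x (τ (i + 1)) - x (τ i) = d i v}) =
      ⋂ i : Fin J, (fun ω => N v (τ (i.succ : Fin (J + 1))) ω -
        N v (τ (i.castSucc : Fin (J + 1))) ω) ⁻¹' {d i v} := by
    ext ω
    simp
  rw [e', hi.meas_iInter fun i => ⟨_, measurableSet_singleton _, rfl⟩]
  refine Finset.prod_congr rfl fun i _ => ?_
  have hmi : Measurable fun ω => N v (τ (i + 1)) ω - N v (τ i) ω :=
    ((hN.poisson v).measurable _).sub ((hN.poisson v).measurable _)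
  rw [← hδ i, ← (hN.poisson v).law _ _ (hτ (Nat.le_succ i)), Measure.map_apply hmi
    (measurableSet_singleton _)]
  simp

/-- The probability that a given vertex is the only one to ring in an interval of length `δ`. -/
noncomputable def soleProb (n : ℕ) (δ : ℝ) : ℝ := (1 - Real.exp (-δ)) * Real.exp (-δ) ^ (n - 1)

theorem poissonMeasure_real_zero (δ : ℝ≥0) : (poissonMeasure δ).real {0} = Real.exp (-δ) := by
  simp [poissonMeasure_real_singleton]

theorem countLaw_real_soleRing_eq_some (δ : ℝ≥0) (v : V) :
    (countLaw V δ).real (soleRing ⁻¹' {some v}) = soleProb (Fintype.card V) δ := by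
  have e : (soleRing ⁻¹' {some v} : Set (V → ℕ)) =
      Set.pi Set.univ fun u => if u = v then {0}ᶜ else {0} := by
    ext d
    simp only [Set.mem_preimage, Set.mem_singleton_iff, soleRing_eq_some, Set.mem_pi, Set.mem_univ,
      true_imp_iff]
    constructor
    · rintro ⟨h1, h2⟩ u
      split_ifs with hu
      · subst hu; exact h1
      · exact h2 u hu
    · intro h
      refine ⟨?_, fun u hu => ?_⟩
      · simpa using h v
      · simpa [hu] using h u
  rw [e, measureReal_def, Measure.pi_pi, ENNReal.toReal_prod,
    ← Finset.mul_prod_erase _ _ (Finset.mem_univ v), soleProb]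
  congr 1
  · rw [if_pos rfl, ← measureReal_def, probReal_compl_eq_one_sub (measurableSet_singleton _),
      poissonMeasure_real_zero]
  · rw [Finset.prod_congr rfl (g := fun _ => Real.exp (-(δ : ℝ))), Finset.prod_const,
      Finset.card_erase_of_mem (Finset.mem_univ v), Finset.card_univ]
    intro u hu
    rw [if_neg (Finset.ne_of_mem_erase hu), ← measureReal_def, poissonMeasure_real_zero]

theorem sum_measureReal_preimage {α β : Type*} [MeasurableSpace α] [Fintype β] (ν : Measure α)
    [IsProbabilityMeasure ν] {g : α → β} (hg : ∀ b, MeasurableSet (g ⁻¹' {b})) :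
    ∑ b, ν.real (g ⁻¹' {b}) = 1 := by
  rw [← measureReal_biUnion_finset (fun a _ b _ hab => ?_) fun b _ => hg b]
  · have : (⋃ b ∈ (Finset.univ : Finset β), g ⁻¹' {b}) = Set.univ := by
      ext x; simp
    rw [this, probReal_univ]
  · exact Disjoint.preimage g (by simpa using hab)

/-- The extracted steps have exactly the law `stepWeight`, since `none` receives the complementary
probability. The only error of the discretisation lies in intervals with more than one ring, where
the path need not follow the steps. -/
theorem countLaw_real_soleRing (δ : ℝ≥0) (a : Option V) :
    (countLaw V δ).real (soleRing ⁻¹' {a}) =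
      stepWeight V (soleProb (Fintype.card V) δ) a := by
  cases a with
  | some v => exact countLaw_real_soleRing_eq_some δ v
  | none =>
    have h := sum_measureReal_preimage (countLaw V δ) (g := soleRing (V := V))
      fun b => MeasurableSet.of_discrete
    rw [Fintype.sum_option] at h
    simp only [countLaw_real_soleRing_eq_some, Finset.sum_const, Finset.card_univ,
      nsmul_eq_mul] at h
    change _ = 1 - _
    linarith

theorem poissonMeasure_real_two_le (δ : ℝ≥0) : (poissonMeasure δ).real {k | 2 ≤ k} ≤ (δ : ℝ) ^ 2 := by
  have e : ({k | 2 ≤ k} : Set ℕ) = ({0} ∪ {1})ᶜ := by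
    ext k
    simp
    omega
  rw [e, probReal_compl_eq_one_sub MeasurableSet.of_discrete,
    measureReal_union (by simp) (measurableSet_singleton _), poissonMeasure_real_zero,
    poissonMeasure_real_singleton]
  have h1 := Real.add_one_le_exp (-(δ : ℝ))
  have h2 := δ.coe_nonneg
  simp only [pow_one, Nat.factorial_one, Nat.cast_one, div_one]
  nlinarith

theorem poissonMeasure_real_ne_zero_le (δ : ℝ≥0) : (poissonMeasure δ).real {0}ᶜ ≤ δ := by
  rw [probReal_compl_eq_one_sub (measurableSet_singleton _), poissonMeasure_real_zero]
  have h1 := Real.add_one_le_exp (-(δ : ℝ))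
  linarith

theorem countLaw_real_pi_le (δ : ℝ≥0) (s : V → Set ℕ) (t : Finset V) :
    (countLaw V δ).real {d | ∀ v ∈ t, d v ∈ s v} = ∏ v ∈ t, (poissonMeasure δ).real (s v) := by
  have e : {d : V → ℕ | ∀ v ∈ t, d v ∈ s v} =
      Set.pi Set.univ fun v => if v ∈ t then s v else Set.univ := by
    ext d
    simp only [Set.mem_ofPred_eq, Set.mem_pi, Set.mem_univ, true_imp_iff]
    refine forall_congr' fun v => ?_
    split_ifs with h <;> simp [h]
  rw [e, measureReal_def, Measure.pi_pi, ENNReal.toReal_prod,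
    ← Finset.prod_subset (Finset.subset_univ t)]
  · exact Finset.prod_congr rfl fun v hv => by rw [if_pos hv, measureReal_def]
  · intro v _ hv
    rw [if_neg hv, measure_univ, ENNReal.toReal_one]

theorem countLaw_real_not_atMostOne_le (δ : ℝ≥0) :
    (countLaw V δ).real {d | ¬ AtMostOne d} ≤ 2 * (Fintype.card V : ℝ) ^ 2 * (δ : ℝ) ^ 2 := by
  have hsub : {d : V → ℕ | ¬ AtMostOne d} ⊆
      ⋃ x ∈ (Finset.univ : Finset (V × V)), {d : V → ℕ | 2 ≤ d x.1} ∪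
        {d | x.1 ≠ x.2 ∧ d x.1 ≠ 0 ∧ d x.2 ≠ 0} := by
    intro d hd
    simp only [AtMostOne, not_and_or, not_forall, Set.mem_ofPred_eq] at hd
    simp only [Finset.mem_univ, Set.iUnion_true, Set.mem_iUnion, Set.mem_union, Set.mem_ofPred_eq]
    rcases hd with ⟨v, hv⟩ | ⟨u, v, huv, h⟩
    · exact ⟨(v, v), Or.inl (not_le.1 hv)⟩
    · exact ⟨(u, v), Or.inr ⟨huv, not_or.1 h⟩⟩
  -- For each ordered pair, a double ring of the first vertex and rings of both vertices, if
  -- distinct, each have probability at most `δ²`.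
  have h1 : ∀ x ∈ (Finset.univ : Finset (V × V)), (countLaw V δ).real ({d : V → ℕ | 2 ≤ d x.1} ∪
        {d | x.1 ≠ x.2 ∧ d x.1 ≠ 0 ∧ d x.2 ≠ 0}) ≤ 2 * (δ : ℝ) ^ 2 := by
    rintro ⟨u, v⟩ -
    refine (measureReal_union_le _ _).trans ?_
    have a1 : (countLaw V δ).real {d : V → ℕ | 2 ≤ d u} ≤ (δ : ℝ) ^ 2 := by
      have := countLaw_real_pi_le δ (fun _ : V => {k | 2 ≤ k}) {u}
      simp only [Finset.mem_singleton, forall_eq, Set.mem_ofPred_eq, Finset.prod_singleton] at this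
      rw [this]
      exact poissonMeasure_real_two_le δ
    have a2 : (countLaw V δ).real {d : V → ℕ | u ≠ v ∧ d u ≠ 0 ∧ d v ≠ 0} ≤ (δ : ℝ) ^ 2 := by
      by_cases huv : u = v
      · simp only [huv, ne_eq, not_true_eq_false, false_and, Set.ofPred_false, measureReal_empty]
        positivity
      · have := countLaw_real_pi_le δ (fun _ : V => {0}ᶜ) {u, v}
        simp only [Finset.mem_insert, Finset.mem_singleton, forall_eq_or_imp, forall_eq,
          Set.mem_compl_iff, Set.mem_singleton_iff, Finset.prod_pair huv] at this
        simp only [ne_eq, huv, not_false_eq_true, true_and]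
        rw [this, sq]
        have := poissonMeasure_real_ne_zero_le δ
        gcongr
    simp only
    linarith
  refine (measureReal_mono hsub (measure_ne_top _ _)).trans ((measureReal_biUnion_finset_le _ _).trans
    ((Finset.sum_le_sum h1).trans_eq ?_))
  rw [Finset.sum_const, Finset.card_univ, Fintype.card_prod, nsmul_eq_mul]
  push_cast
  ring

/-- The opinion of a vertex at a mesh point is governed by independent steps, up to the
probability that some mesh interval contains two rings. -/
theorem IsClockFamily.measureReal_opinion_le (hN : IsClockFamily N f₀ μ) {τ : ℕ → ℝ≥0}
    (hτ : Monotone τ) (hτ0 : τ 0 = 0) {δ : ℝ≥0} (hδ : ∀ i, τ (i + 1) - τ i = δ) (J : ℕ) (v : V)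
    (t : ℝ) :
    μ.real {ω | t < |opinion P (fun v t => N v t ω) (fun v => f₀ v ω) (τ J) v - m|} ≤
      expec (soleProb (Fintype.card V) δ) J
        (fun l => devProb μ f₀ m (Pi.single v 1 ᵥ* listMat P l) t) +
      J * (2 * (Fintype.card V : ℝ) ^ 2 * (δ : ℝ) ^ 2) := by
  set D : Ω → Fin J → V → ℕ := fun ω i v => N v (τ (i + 1)) ω - N v (τ i) ω with hD
  have hDm : Measurable D :=
    measurable_pi_lambda _ fun i => measurable_pi_lambda _ fun v =>
      ((hN.poisson v).measurable _).sub ((hN.poisson v).measurable _)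
  have hlaw : μ.map D = Measure.pi fun _ : Fin J => countLaw V δ := hN.map_counts hτ hδ J
  set A : (Fin J → Option V) → Set (V → ℝ) := fun σ =>
    {f | t < |((Pi.single v 1 ᵥ* listMat P (List.ofFn σ).reverse) ⬝ᵥ f) - m|} with hA
  have hAm : ∀ σ, MeasurableSet (A σ) := by
    intro σ
    refine measurableSet_lt measurable_const ?_
    have : Measurable fun f : V → ℝ =>
        (Pi.single v 1 ᵥ* listMat P (List.ofFn σ).reverse) ⬝ᵥ f := by
      unfold dotProduct
      exact Finset.measurable_fun_sum _ fun u _ => (measurable_pi_apply u).const_mul _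
    exact (this.sub_const m).norm
  set S : (Fin J → Option V) → Set (Fin J → V → ℕ) := fun σ =>
    Set.pi Set.univ fun i => soleRing ⁻¹' {σ i} with hS
  set Bd : Fin J → Set (Fin J → V → ℕ) := fun i => {d | ¬ AtMostOne (d i)} with hBd
  have hmono : ∀ᵐ ω ∂μ, ∀ v, Monotone fun t => N v t ω := ae_all_iff.2 fun v => (hN.poisson v).mono
  have hcont : ∀ᵐ ω ∂μ, ∀ v t, ContinuousWithinAt (fun s => N v s ω) (Set.Ici t) t :=
    ae_all_iff.2 fun v => (hN.poisson v).rightCont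
  -- Outside the bad intervals the event is split according to the whole sequence `σ` of steps; for
  -- fixed `σ` the opinion is a fixed linear form of `f₀`, which is independent of the clocks.
  have hsub : {ω | t < |opinion P (fun v t => N v t ω) (fun v => f₀ v ω) (τ J) v - m|} ≤ᵐ[μ]
      (((⋃ σ ∈ (Finset.univ : Finset (Fin J → Option V)),
        D ⁻¹' S σ ∩ (fun ω v => f₀ v ω) ⁻¹' A σ) ∪
        ⋃ i ∈ (Finset.univ : Finset (Fin J)), D ⁻¹' Bd i : Set Ω)) := by
    filter_upwards [hmono, hcont] with ω h1 h2 hω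
    change t < |opinion P (fun v t => N v t ω) (fun v => f₀ v ω) (τ J) v - m| at hω
    by_cases hb : ∃ i : Fin J, D ω ∈ Bd i
    · obtain ⟨i, hi⟩ := hb
      exact Or.inr (Set.mem_biUnion (Finset.mem_univ i) hi)
    · left
      push Not at hb
      refine Set.mem_biUnion (Finset.mem_univ fun i : Fin J => soleRing (D ω i))
        ⟨fun i _ => rfl, ?_⟩
      have hg : ∀ i < J, AtMostOne fun v => N v (τ (i + 1)) ω - N v (τ i) ω := fun i hi =>
        not_not.1 (hb ⟨i, hi⟩)
      rw [opinion_mesh h1 h2 hτ hτ0 hg] at hω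
      change t < _
      rw [← Matrix.dotProduct_mulVec, single_one_dotProduct]
      exact hω
  have hμreal : ∀ T : Set (Fin J → V → ℕ), μ.real (D ⁻¹' T) =
      (Measure.pi fun _ : Fin J => countLaw V δ).real T := fun T => by
    rw [← hlaw, measureReal_def, measureReal_def, Measure.map_apply hDm MeasurableSet.of_discrete]
  have hmain : ∀ σ : Fin J → Option V, μ.real (D ⁻¹' S σ ∩ (fun ω v => f₀ v ω) ⁻¹' A σ) =
      (∏ i, stepWeight V (soleProb (Fintype.card V) δ) (σ i)) *
        devProb μ f₀ m (Pi.single v 1 ᵥ* listMat P (List.ofFn σ).reverse) t := by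
    intro σ
    have hind : IndepFun D (fun ω v => f₀ v ω) μ :=
      hN.indep_initial.comp (φ := fun x (i : Fin J) v => x v (τ (i + 1)) - x v (τ i)) (ψ := id)
        (measurable_pi_lambda _ fun i => measurable_pi_lambda _ fun v => by fun_prop) measurable_id
    rw [measureReal_def, indepFun_iff_measure_inter_preimage_eq_mul.1 hind _ _
      MeasurableSet.of_discrete (hAm σ), ENNReal.toReal_mul, ← measureReal_def, ← measureReal_def,
      hμreal]
    congr 1
    rw [measureReal_def, Measure.pi_pi, ENNReal.toReal_prod]
    exact Finset.prod_congr rfl fun i _ => countLaw_real_soleRing δ (σ i)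
  have hbad : ∀ i, μ.real (D ⁻¹' Bd i) ≤ 2 * (Fintype.card V : ℝ) ^ 2 * (δ : ℝ) ^ 2 := by
    intro i
    rw [hμreal]
    have e : Bd i = (fun d : Fin J → V → ℕ => d i) ⁻¹' {d | ¬ AtMostOne d} := rfl
    have hmp := measurePreserving_eval (fun _ : Fin J => countLaw V δ) i
    rw [e, measureReal_def, hmp.measure_preimage MeasurableSet.of_discrete.nullMeasurableSet]
    exact countLaw_real_not_atMostOne_le δ
  have h1 : μ.real {ω | t < |opinion P (fun v t => N v t ω) (fun v => f₀ v ω) (τ J) v - m|} ≤ _ :=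
    ENNReal.toReal_mono (measure_ne_top _ _) (measure_mono_ae hsub)
  refine h1.trans ((measureReal_union_le _ _).trans (add_le_add ?_ ?_))
  · refine (measureReal_biUnion_finset_le _ _).trans_eq ?_
    rw [← expec_reverse, expec_eq_sum]
    exact Finset.sum_congr rfl fun σ _ => hmain σ
  · refine (measureReal_biUnion_finset_le _ _).trans ((Finset.sum_le_sum fun i _ => hbad i).trans_eq ?_)
    rw [Finset.sum_const, Finset.card_univ, Fintype.card_fin, nsmul_eq_mul]

end Law

end DeGroot

namespace DeGroot

open Matrix

/-! ### Choice of block lengths and removal of the mesh. -/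

section Mesh

set_option linter.unusedSectionVars false

variable {V : Type*} [Fintype V] [DecidableEq V] {P : Matrix V V ℝ} {p C₀ : ℝ}

theorem soleProb_pos (n : ℕ) {δ : ℝ} (hδ : 0 < δ) : 0 < soleProb n δ :=
  mul_pos (by rw [sub_pos, Real.exp_lt_one_iff]; linarith) (pow_pos (Real.exp_pos _) _)

theorem soleProb_le (n : ℕ) {δ : ℝ} (hδ : 0 ≤ δ) : soleProb n δ ≤ δ := by
  have h1 := Real.add_one_le_exp (-δ)
  have h2 : Real.exp (-δ) ^ (n - 1) ≤ 1 :=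
    pow_le_one₀ (Real.exp_pos _).le (Real.exp_le_one_iff.2 (by linarith))
  have h3 : 0 ≤ 1 - Real.exp (-δ) := by
    rw [sub_nonneg, Real.exp_le_one_iff]; linarith
  unfold soleProb
  nlinarith

/-- With `δ = 1 / q`, this and `soleProb_le` keep `p * q` between `1/2` and `1`: in `q` steps each
clock rings about once, uniformly in the mesh. -/
theorem half_le_soleProb {n : ℕ} {δ : ℝ} (hδ : 0 < δ) (h : 4 * n * δ ≤ 1) (hn : 1 ≤ n) :
    δ / 2 ≤ soleProb n δ := by
  have hn' : (1 : ℝ) ≤ n := by exact_mod_cast hn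
  have hδ4 : δ ≤ 1 / 4 := by nlinarith
  have h1 : Real.exp (-δ) ≤ 1 - 4 / 5 * δ := by
    rw [Real.exp_neg, inv_le_comm₀ (Real.exp_pos _) (by linarith)]
    refine le_trans ?_ (Real.add_one_le_exp δ)
    rw [inv_le_iff_one_le_mul₀ (by linarith)]
    nlinarith
  have h2 : 3 / 4 ≤ Real.exp (-δ) ^ (n - 1) := by
    rw [← Real.exp_nat_mul]
    refine le_trans ?_ (Real.add_one_le_exp _)
    rw [Nat.cast_sub hn]
    push_cast
    nlinarith
  unfold soleProb
  nlinarith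

/-- The lazy walk makes at least `8 b²` jumps on average, so it makes fewer than `b²` with
probability at most `exp (-b) ≤ 1 / b`; after `b²` jumps the entries are at most `C₀ / b`. The
condition `b ≤ |V|` keeps `b²` in the range of the decay hypothesis. -/
theorem lazyMat_pow_entry_le_of_sqrtDecay (hP : P ∈ rowStochastic ℝ V) (hdec : SqrtDecay P C₀)
    (h0 : 0 ≤ p) (h1 : p ≤ 1) {q b : ℕ} (hpq : 1 / 2 ≤ p * q) (hb : 1 ≤ b)
    (hbn : b ≤ Fintype.card V) (x y : V) :
    (lazyMat P p ^ (16 * b ^ 2 * q)) x y ≤ (1 + C₀) / b := by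
  have hb' : (1 : ℝ) ≤ b := by exact_mod_cast hb
  have h2 := lazyMat_pow_entry_le hP h0 h1 (16 * b ^ 2 * q) (b ^ 2)
    (hdec (b ^ 2) (Nat.one_le_pow _ _ hb) (Nat.pow_le_pow_left hbn 2)) x y
  refine h2.trans ?_
  have e1 : (((b ^ 2 : ℕ) : ℝ)) ^ (-(1 / 2) : ℝ) = 1 / b := by
    push_cast
    rw [Real.rpow_neg (by positivity), ← Real.sqrt_eq_rpow, Real.sqrt_sq (by positivity), one_div]
  rw [e1, add_div, mul_one_div]
  refine add_le_add_left ?_ _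
  rw [← Real.exp_add]
  have h3 : ((b ^ 2 : ℕ) : ℝ) - p * (16 * b ^ 2 * q : ℕ) / 8 + -(p * (16 * b ^ 2 * q : ℕ) / 2) ≤ -b := by
    push_cast
    nlinarith [mul_le_mul_of_nonneg_left hpq (by positivity : (0 : ℝ) ≤ b ^ 2)]
  refine (Real.exp_le_exp.2 h3).trans ?_
  rw [Real.exp_neg, ← one_div]
  exact one_div_le_one_div_of_le (by linarith) (by linarith [Real.add_one_le_exp (b : ℝ)])

open Classical in
/-- A block of length of order `g ^ 35` in time makes every probability vector spread out, with
probability at least one half. -/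
theorem IsSetup.expec_not_isSpread_le_half {K : ℕ} (h : IsSetup P p K) (hdec : SqrtDecay P C₀)
    (hC₀ : 0 ≤ C₀) {q g : ℕ} (hq : 1 ≤ q) (hpq : p * q ≤ 1) (hpq' : 1 / 2 ≤ p * q)
    (hg : g ^ 7 ≤ Fintype.card V) (hg1 : 1 + C₀ ≤ g)
    (hg2 : 2176 * (512 * concConst K + 2 * ((1 + concConst K) * (1 + C₀))) ≤ g) {ν : V → ℝ}
    (h0 : ∀ x, 0 ≤ ν x) (h1 : ∑ x, ν x = 1) :
    expec p (g ^ 35 * q)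
      (fun l => if IsSpread P p (1 / g) (ν ᵥ* listMat P l) then 0 else 1) ≤ 1 / 2 := by
  have hgR : (1 : ℝ) ≤ g := by linarith
  have hg' : 1 ≤ g := by exact_mod_cast hgR
  -- Here `B` is of order `g ^ 14 * q` and `c` of order `g ^ (-7)`, so that with `J = g ^ 35 * q`
  -- the terms `p * B ^ 2` and `J * c` are both of order `g ^ 28 * q`.
  have hc := lazyMat_pow_entry_le_of_sqrtDecay h.mem hdec h.pos.le h.le_one hpq'
    (Nat.one_le_pow 7 g hg') hg
  -- The threshold `η = 1 / g` needs only `b = g ^ 2`, hence `R = 16 * g ^ 4`.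
  have hR : ∀ x y, (lazyMat P p ^ (16 * (g ^ 2) ^ 2 * q)) x y ≤ 1 / g := fun x y => by
    refine (lazyMat_pow_entry_le_of_sqrtDecay h.mem hdec h.pos.le h.le_one hpq'
      (Nat.one_le_pow 2 g hg') ((Nat.pow_le_pow_right hg' (by norm_num)).trans hg) x y).trans ?_
    push_cast
    rw [div_le_div_iff₀ (by positivity) (by positivity)]
    nlinarith
  -- The prefactor `(R + 1) / η ^ 2` is of order `g ^ 6`, so the right side is of order `g ^ 34 *
  -- q`. The spare power of `g` in `J` absorbs the constants through `hg2`.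
  have key := h.expec_not_isSpread_le h0 h1 hq hpq (one_div_pos.2 (by linarith)) hc hR
    (g ^ 35 * q)
  set E := expec p (g ^ 35 * q)
      (fun l => if IsSpread P p (1 / g) (ν ᵥ* listMat P l) then 0 else 1)
  have hK := concConst_pos h.one_le
  set κ := concConst K
  have hqR : (1 : ℝ) ≤ q := by exact_mod_cast hq
  push_cast at key
  have b1 : p * (16 * ((g : ℝ) ^ 7) ^ 2 * q) ^ 2 * κ ≤ 256 * g ^ 28 * q * κ := by
    have : p * (16 * ((g : ℝ) ^ 7) ^ 2 * q) ^ 2 * κ = (256 * g ^ 28 * q * κ) * (p * q) := by ring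
    rw [this]
    exact mul_le_of_le_one_right (by positivity) hpq
  have b2 : (g : ℝ) ^ 35 * q * ((1 + κ) * ((1 + C₀) / (g : ℝ) ^ 7)) =
      g ^ 28 * q * ((1 + κ) * (1 + C₀)) := by
    field_simp
  have b3 : (16 * ((g : ℝ) ^ 2) ^ 2 + 1) ≤ 17 * g ^ 4 := by
    have : (1 : ℝ) ≤ g ^ 4 := one_le_pow₀ hgR
    nlinarith
  have b4 : (64 : ℝ) / (1 / g) ^ 2 = 64 * g ^ 2 := by field_simp
  rw [b4, b2] at key
  have b5 : (64 : ℝ) * g ^ 2 * ((16 * ((g : ℝ) ^ 2) ^ 2 + 1) *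
      (2 * (p * (16 * ((g : ℝ) ^ 7) ^ 2 * q) ^ 2 * κ) + 2 * (g ^ 28 * q * ((1 + κ) * (1 + C₀))))) ≤
      64 * g ^ 2 * (17 * g ^ 4 * (2 * (256 * g ^ 28 * q * κ) +
        2 * (g ^ 28 * q * ((1 + κ) * (1 + C₀))))) := by
    have := h.pos
    gcongr
  have b6 : (64 : ℝ) * g ^ 2 * (17 * g ^ 4 * (2 * (256 * g ^ 28 * q * κ) +
        2 * (g ^ 28 * q * ((1 + κ) * (1 + C₀))))) =
      g ^ 34 * q * (2176 * (512 * κ + 2 * ((1 + κ) * (1 + C₀)))) * (1 / 2) := by ring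
  have b7 : (g : ℝ) ^ 34 * q * (2176 * (512 * κ + 2 * ((1 + κ) * (1 + C₀)))) * (1 / 2) ≤
      g ^ 35 * q * (1 / 2) := by
    rw [show (g : ℝ) ^ 35 * q = g ^ 34 * q * g by ring]
    gcongr
  have b8 := key.trans (b5.trans (b6.trans_le b7))
  exact le_of_mul_le_mul_left b8 (by positivity)

variable {Ω : Type*} [MeasurableSpace Ω] {μ : Measure Ω} [IsProbabilityMeasure μ]
  {N : V → ℝ≥0 → Ω → ℕ} {f₀ : V → Ω → ℝ} {m : ℝ}

/-- Concentration of the opinion of a vertex at time `k * g ^ 35` around the mean. -/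
theorem measureReal_opinion_deviation_le (hP : P ∈ rowStochastic ℝ V) (hdec : SqrtDecay P C₀)
    (hC₀ : 0 ≤ C₀) (hN : IsClockFamily N f₀ μ) (hf : IsIIDOpinions f₀ m μ) {K g : ℕ} (hK : 1 ≤ K)
    (hKn : K ≤ Fintype.card V ^ 2) (hKC : C₀ * (K : ℝ) ^ (-(1 / 2) : ℝ) < 1 / 2)
    (hg : g ^ 7 ≤ Fintype.card V) (hg1 : 1 + C₀ ≤ g)
    (hg2 : 2176 * (512 * concConst K + 2 * ((1 + concConst K) * (1 + C₀))) ≤ g) {ε : ℝ}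
    (hε0 : 0 ≤ ε) (hε1 : ε ≤ 1) (k : ℕ) (v : V) :
    μ.real {ω | 2 * ε < |opinion P (fun v t => N v t ω) (fun v => f₀ v ω) (k * g ^ 35) v - m|} ≤
      (1 / 2) ^ k + 2 * (2 * Real.exp (-(ε ^ 2 / (4 * concConst K * (1 / g)))) +
        2 * Real.exp (-(2 * ε ^ 2 / (1 / g)))) := by
  have hgR : (1 : ℝ) ≤ g := by linarith
  have hn : 1 ≤ Fintype.card V := Fintype.card_pos_iff.2 ⟨v⟩
  set n := Fintype.card V with hn_def
  -- The estimate does not depend on the mesh; `γ` bounds the probability of a mesh interval with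
  -- two rings, and `q` is taken large accordingly.
  refine le_of_forall_pos_le_add fun γ hγ => ?_
  obtain ⟨q, hq⟩ := exists_nat_ge (max (16 * n : ℝ) (k * g ^ 35 * (2 * (n : ℝ) ^ 2) / γ))
  have hq1 : (16 * n : ℝ) ≤ q := (le_max_left _ _).trans hq
  have hq2 : k * g ^ 35 * (2 * (n : ℝ) ^ 2) / γ ≤ q := (le_max_right _ _).trans hq
  have hnR : (1 : ℝ) ≤ n := by exact_mod_cast hn
  have hq0 : (0 : ℝ) < q := by linarith
  have hqN : 1 ≤ q := by exact_mod_cast (by linarith : (1 : ℝ) ≤ q)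
  set δ : ℝ≥0 := 1 / q with hδ_def
  have hδ : (δ : ℝ) = 1 / q := by simp [hδ_def]
  have hδ0 : (0 : ℝ) < δ := by rw [hδ]; positivity
  have hδq : (δ : ℝ) * q = 1 := by rw [hδ]; field_simp
  have hδq' : δ * q = 1 := by exact_mod_cast hδq
  have hp1 := soleProb_le n hδ0.le
  have hp2 : (δ : ℝ) / 2 ≤ soleProb n δ := by
    refine half_le_soleProb hδ0 ?_ hn
    nlinarith
  have hnδ : 16 * n * (δ : ℝ) ≤ 1 := by nlinarith
  have hset : IsSetup P (soleProb n δ) K :=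
    { mem := hP
      pos := soleProb_pos n hδ0
      le := by nlinarith
      card_mul_le := by nlinarith
      one_le := hK
      pow_lt := fun x y => (hdec K hK hKn x y).trans_lt hKC }
  have hpq : soleProb n δ * q ≤ 1 := by nlinarith
  have hpq' : 1 / 2 ≤ soleProb n δ * q := by nlinarith
  have hτ : Monotone fun i : ℕ => (i : ℝ≥0) * δ := fun i j hij => by
    dsimp only
    gcongr
  have hmesh := hN.measureReal_opinion_le (P := P) (m := m) hτ (by simp) (δ := δ) (fun i => by
    push_cast
    rw [add_mul, one_mul, add_tsub_cancel_left]) (k * (g ^ 35 * q)) v (2 * ε)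
  have ht : ((k * (g ^ 35 * q) : ℕ) : ℝ≥0) * δ = k * g ^ 35 := by
    push_cast
    rw [mul_assoc, mul_assoc, mul_comm (q : ℝ≥0), hδq', mul_one]
  rw [ht] at hmesh
  refine hmesh.trans (add_le_add ?_ ?_)
  · refine hset.expec_devProb_le hf (by positivity) hε0 hε1 (fun ν h0 h1 =>
      hset.expec_not_isSpread_le_half hdec hC₀ hqN hpq hpq' hg hg1 hg2 h0 h1) k ?_ ?_
    · intro x
      by_cases hx : x = v
      · subst hx; simp
      · simp [hx]
    · simp
  · push_cast
    rw [div_le_iff₀ hγ] at hq2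
    have e : (k : ℝ) * (g ^ 35 * q) * (2 * n ^ 2 * (δ : ℝ) ^ 2) =
        k * g ^ 35 * (2 * n ^ 2) * δ * (δ * q) := by ring
    rw [e, hδq, mul_one]
    calc (k : ℝ) * g ^ 35 * (2 * n ^ 2) * δ ≤ q * γ * δ := by gcongr
      _ = γ * (δ * q) := by ring
      _ = γ := by rw [hδq, mul_one]

end Mesh

end DeGroot

namespace DeGroot

open Matrix

/-! ### From deviations of single opinions to the consensus time. -/

section Consensus

set_option linter.unusedSectionVars false

variable {V : Type*} [Fintype V] [DecidableEq V] {P : Matrix V V ℝ} {C₀ : ℝ}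

theorem osc_le [Nonempty V] {f : V → ℝ} {a b : ℝ} (ha : ∀ v, a ≤ f v) (hb : ∀ v, f v ≤ b) :
    osc f ≤ b - a :=
  sub_le_sub (ciSup_le hb) (le_ciInf ha)

theorem exists_lt_abs_sub_of_lt_osc [Nonempty V] {f : V → ℝ} {ε : ℝ} (h : ε < osc f) (m : ℝ) :
    ∃ v, ε / 2 < |f v - m| := by
  by_contra! hle
  have := osc_le (f := f) (a := m - ε / 2) (b := m + ε / 2)
    (fun v => by linarith [(abs_le.1 (hle v)).1]) (fun v => by linarith [(abs_le.1 (hle v)).2])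
  linarith

theorem lt_osc_of_lt_consensusTime {f : ℝ≥0 → V → ℝ} {ε : ℝ} {t : ℝ≥0}
    (h : (t : ℝ≥0∞) < consensusTime f ε) : ε < osc (f t) := by
  by_contra hle
  exact absurd (iInf₂_le (f := fun (t : ℝ≥0) (_ : osc (f t) ≤ ε) => (t : ℝ≥0∞)) t (not_lt.1 hle))
    (not_le.2 h)

variable {Ω : Type*} [MeasurableSpace Ω] {μ : Measure Ω} [IsProbabilityMeasure μ]
  {N : V → ℝ≥0 → Ω → ℕ} {f₀ : V → Ω → ℝ} {m : ℝ}

/-- Opinions in `[0, 1]` are within `1` of each other already at time `0`. -/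
theorem measure_le_consensusTime_of_one_le [Nonempty V] (hf : IsIIDOpinions f₀ m μ) {ε : ℝ}
    (hε : 1 ≤ ε) {θ : ℝ≥0∞} (hθ : 0 < θ) :
    μ {ω | θ ≤ consensusTime (opinion P (fun v t => N v t ω) (fun v => f₀ v ω)) ε} = 0 := by
  have hae : ∀ᵐ ω ∂μ, ∀ v, f₀ v ω ∈ Set.Icc (0 : ℝ) 1 := ae_all_iff.2 hf.mem_Icc
  refine measure_mono_null (t := {ω | ¬ ∀ v, f₀ v ω ∈ Set.Icc (0 : ℝ) 1}) (fun ω hω h => ?_) hae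
  have h1 := lt_osc_of_lt_consensusTime (t := 0) (lt_of_lt_of_le (by simpa using hθ) hω)
  rw [opinion_zero] at h1
  have h2 := osc_le (fun v => (h v).1) (fun v => (h v).2)
  linarith

/-- If consensus comes after `T`, then at time `T` some opinion is more than `ε / 2` away from `m`;
a union bound over the vertices follows. -/
theorem measure_le_consensusTime_le [Nonempty V] {ε B : ℝ} {T : ℝ≥0}
    (hB : ∀ v, μ.real {ω | ε / 2 < |opinion P (fun v t => N v t ω) (fun v => f₀ v ω) T v - m|} ≤ B)
    {θ : ℝ≥0∞} (hθ : (T : ℝ≥0∞) < θ) :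
    μ {ω | θ ≤ consensusTime (opinion P (fun v t => N v t ω) (fun v => f₀ v ω)) ε} ≤
      ENNReal.ofReal (Fintype.card V * B) := by
  have hsub : {ω | θ ≤ consensusTime (opinion P (fun v t => N v t ω) (fun v => f₀ v ω)) ε} ⊆
      ⋃ v ∈ (Finset.univ : Finset V),
        {ω | ε / 2 < |opinion P (fun v t => N v t ω) (fun v => f₀ v ω) T v - m|} := by
    intro ω hω
    obtain ⟨v, hv⟩ := exists_lt_abs_sub_of_lt_osc
      (lt_osc_of_lt_consensusTime (lt_of_lt_of_le hθ hω)) m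
    exact Set.mem_biUnion (Finset.mem_univ v) hv
  rw [← ofReal_measureReal (measure_ne_top _ _)]
  refine ENNReal.ofReal_le_ofReal ((measureReal_mono hsub (measure_ne_top _ _)).trans
    ((measureReal_biUnion_finset_le _ _).trans ((Finset.sum_le_sum fun v _ => hB v).trans_eq ?_)))
  rw [Finset.sum_const, Finset.card_univ, nsmul_eq_mul]

end Consensus

/-! ### Numerical estimates for the choice of parameters. -/

section Asymptotics

theorem exists_pow_lt_half {C₀ : ℝ} (hC₀ : 0 < C₀) :
    ∃ K : ℕ, 1 ≤ K ∧ C₀ * (K : ℝ) ^ (-(1 / 2) : ℝ) < 1 / 2 := by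
  obtain ⟨b, hb⟩ := exists_nat_gt (2 * C₀ + 1)
  have hb' : (0 : ℝ) < b := by linarith
  refine ⟨b ^ 2, Nat.one_le_pow _ _ (by exact_mod_cast hb'), ?_⟩
  push_cast
  rw [Real.rpow_neg (by positivity), ← Real.sqrt_eq_rpow, Real.sqrt_sq hb'.le,
    ← div_eq_mul_inv, div_lt_iff₀ hb']
  linarith

/-- The second bound is the one needed for `g ^ 14` when `g ≤ 2 (log n)³ / ε²`. -/
theorem eventually_log_ge (M : ℝ) :
    ∀ᶠ n : ℕ in atTop, M ≤ Real.log n ∧ 2 ^ 14 * Real.log n ^ 42 ≤ n := by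
  have h1 : ∀ᶠ x : ℝ in atTop, M ≤ Real.log x := Real.tendsto_log_atTop.eventually_ge_atTop M
  have h2 : ∀ᶠ x : ℝ in atTop, 2 ^ 14 * Real.log x ^ 42 ≤ x := by
    have := (Real.isLittleO_pow_log_id_atTop (n := 42)).bound (c := 1 / 2 ^ 14) (by positivity)
    filter_upwards [this, eventually_ge_atTop 1] with x hx hx1
    rw [Real.norm_of_nonneg (pow_nonneg (Real.log_nonneg hx1) _), id,
      Real.norm_of_nonneg (by linarith)] at hx
    linarith
  exact tendsto_natCast_atTop_atTop.eventually (h1.and h2)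

/-- The union bound over the vertices, with the choice of parameters of the main theorem. -/
theorem mul_deviation_le {n g ε κ ℒ : ℝ} {k : ℕ} (hn : n = Real.exp ℒ) (hε : 0 < ε) (hκ : 0 < κ)
    (h1 : 64 * κ * 3 ≤ ℒ) (h2 : 24 ≤ ℒ) (hg : ℒ ^ 3 / ε ^ 2 ≤ g) (hk : 4 * ℒ ^ 2 ≤ k) :
    n * ((1 / 2) ^ k + 2 * (2 * Real.exp (-((ε / 4) ^ 2 / (4 * κ * (1 / g)))) +
        2 * Real.exp (-(2 * (ε / 4) ^ 2 / (1 / g))))) ≤ Real.exp (-ℒ ^ 2) := by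
  have hℒ : 0 < ℒ := by linarith
  have hg0 : 0 < g := lt_of_lt_of_le (by positivity) hg
  have hg' : ℒ ^ 3 ≤ g * ε ^ 2 := by rwa [div_le_iff₀ (by positivity)] at hg
  have b1 : ((1 : ℝ) / 2) ^ k ≤ Real.exp (-(2 * ℒ ^ 2)) := by
    have : (1 : ℝ) / 2 ≤ Real.exp (-(1 / 2)) := by
      have := Real.add_one_le_exp (-(1 / 2) : ℝ)
      linarith
    refine (pow_le_pow_left₀ (by norm_num) this k).trans ?_
    rw [← Real.exp_nat_mul, Real.exp_le_exp]
    linarith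
  have b2 : Real.exp (-((ε / 4) ^ 2 / (4 * κ * (1 / g)))) ≤ Real.exp (-(2 * ℒ ^ 2)) := by
    rw [Real.exp_le_exp, neg_le_neg_iff, le_div_iff₀ (by positivity)]
    rw [show 2 * ℒ ^ 2 * (4 * κ * (1 / g)) = 8 * κ * ℒ ^ 2 / g by ring, div_le_iff₀ hg0]
    nlinarith [mul_le_mul_of_nonneg_right h1 (sq_nonneg ℒ)]
  have b3 : Real.exp (-(2 * (ε / 4) ^ 2 / (1 / g))) ≤ Real.exp (-(2 * ℒ ^ 2)) := by
    rw [Real.exp_le_exp, neg_le_neg_iff, le_div_iff₀ (by positivity)]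
    rw [show 2 * ℒ ^ 2 * (1 / g) = 2 * ℒ ^ 2 / g by ring, div_le_iff₀ hg0]
    nlinarith [mul_le_mul_of_nonneg_right h2 (sq_nonneg ℒ)]
  -- The bracket is at most `1 + 4 + 4` times `exp (-(2 * ℒ ^ 2))`.
  have b4 : (9 : ℝ) ≤ Real.exp 8 := by
    have := Real.add_one_le_exp (8 : ℝ)
    linarith
  calc _ ≤ Real.exp ℒ * (Real.exp 8 * Real.exp (-(2 * ℒ ^ 2))) := by
        rw [hn]
        refine mul_le_mul_of_nonneg_left ?_ (Real.exp_pos _).le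
        have := mul_le_mul_of_nonneg_right b4 (Real.exp_pos (-(2 * ℒ ^ 2))).le
        linarith
    _ = Real.exp (ℒ + 8 - 2 * ℒ ^ 2) := by
        rw [← Real.exp_add, ← Real.exp_add]; ring_nf
    _ ≤ _ := Real.exp_le_exp.2 (by nlinarith)

/-- In terms of `x = ε⁻¹ * ℒ`, the bounds are `k ≤ 8 x²` and `g ≤ 2 x³`. The exponent is `108 = 2 +
3 * 35 + 1`, the last power being spent on the constant `8 * 2 ^ 35 = 2 ^ 38`. -/
theorem time_lt {g ε ℒ : ℝ} {k : ℕ} (hε0 : 0 < ε) (hε1 : ε < 1) (hℒ : 2 ^ 38 < ℒ)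
    (hg0 : 0 ≤ g) (hg : g ≤ 2 * (ℒ ^ 3 / ε ^ 2)) (hk : k ≤ 8 * ℒ ^ 2) :
    k * g ^ 35 < (ε⁻¹ * ℒ) ^ (108 : ℝ) := by
  have hℒ0 : 0 < ℒ := lt_trans (by norm_num) hℒ
  have hi : 1 ≤ ε⁻¹ := (one_le_inv₀ hε0).2 hε1.le
  set x := ε⁻¹ * ℒ with hx
  have hx0 : 0 < x := by positivity
  have hℒx : ℒ ≤ x := le_mul_of_one_le_left hℒ0.le hi
  rw [show (108 : ℝ) = (108 : ℕ) by norm_num, Real.rpow_natCast]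
  have e : ℒ ^ 3 / ε ^ 2 = x ^ 2 * ℒ := by
    rw [hx]; field_simp
  rw [e] at hg
  have hg' : g ≤ 2 * x ^ 3 := hg.trans (by rw [pow_succ x 2]; gcongr)
  calc k * g ^ 35 ≤ (8 * x ^ 2) * (2 * x ^ 3) ^ 35 := by
        gcongr
        exact hk.trans (by gcongr)
    _ = 2 ^ 38 * x ^ 107 := by ring
    _ < x * x ^ 107 := by
        gcongr
        exact hℒ.trans_le hℒx
    _ = x ^ 108 := by ring

end Asymptotics

end DeGroot

/-! ### The main theorem. -/

theorem mainTheorem2 :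
    ∃ C : ℝ, 0 < C ∧ ∃ c : ℝ, 0 < c ∧
      ∀ C₀ : ℝ, 0 < C₀ → ∃ n₀ : ℕ,
        ∀ (V : Type*) [Fintype V] [DecidableEq V] (P : Matrix V V ℝ),
          n₀ ≤ Fintype.card V →
          P ∈ Matrix.rowStochastic ℝ V →
          DeGroot.SqrtDecay P C₀ →
          ∀ (Ω : Type*) [MeasurableSpace Ω] (μ : Measure Ω) [IsProbabilityMeasure μ]
            (N : V → ℝ≥0 → Ω → ℕ) (f₀ : V → Ω → ℝ) (m : ℝ),
            DeGroot.IsClockFamily N f₀ μ →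
            DeGroot.IsIIDOpinions f₀ m μ →
            ∀ ε : ℝ, (Fintype.card V : ℝ) ^ (-c) ≤ ε →
              μ {ω | ENNReal.ofReal ((ε⁻¹ * Real.log (Fintype.card V)) ^ C) ≤
                  DeGroot.consensusTime
                    (DeGroot.opinion P (fun v t => N v t ω) (fun v => f₀ v ω)) ε}
                ≤ ENNReal.ofReal (Real.exp (-(Real.log (Fintype.card V)) ^ 2)) := by
  -- The exponent `108` comes from `DeGroot.time_lt`, and `1 / 28` from the requirement `g ^ 7 ≤ n`.
  refine ⟨108, by norm_num, 1 / 28, by norm_num, fun C₀ hC₀ => ?_⟩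
  obtain ⟨K, hK, hKC⟩ := DeGroot.exists_pow_lt_half hC₀
  have hκ := DeGroot.concConst_pos hK
  set κ := DeGroot.concConst K with hκ_def
  set G := 2176 * (512 * κ + 2 * ((1 + κ) * (1 + C₀))) with hG
  obtain ⟨n₀, hn₀⟩ := eventually_atTop.1 ((DeGroot.eventually_log_ge
    (max (max (64 * κ * 3) (2 ^ 38 + 1)) (max (1 + C₀) G))).and (eventually_ge_atTop (K + 1)))
  refine ⟨n₀, fun V _ _ P hV hP hdec Ω _ μ _ N f₀ m hN hf ε hε => ?_⟩
  obtain ⟨⟨hlog, hlog42⟩, hKn⟩ := hn₀ _ hV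
  set n := Fintype.card V with hn
  set ℒ := Real.log n with hℒ
  have hl1 : 64 * κ * 3 ≤ ℒ := (le_max_left _ _).trans ((le_max_left _ _).trans hlog)
  have hl2 : 2 ^ 38 + 1 ≤ ℒ := (le_max_right _ _).trans ((le_max_left _ _).trans hlog)
  have hl3 : 1 + C₀ ≤ ℒ := (le_max_left _ _).trans ((le_max_right _ _).trans hlog)
  have hl4 : G ≤ ℒ := (le_max_right _ _).trans ((le_max_right _ _).trans hlog)
  have hn1 : 1 ≤ n := by omega
  have : Nonempty V := Fintype.card_pos_iff.1 hn1
  have hn0 : (0 : ℝ) < n := by exact_mod_cast hn1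
  have hℒ1 : 1 ≤ ℒ := le_trans (by norm_num) hl2
  have hε0 : 0 < ε := (Real.rpow_pos_of_pos hn0 _).trans_le hε
  rcases le_or_gt 1 ε with hε1 | hε1
  · rw [DeGroot.measure_le_consensusTime_of_one_le hf hε1]
    · exact zero_le
    · rw [ENNReal.ofReal_pos]
      positivity
  have hq1 : 1 ≤ ℒ ^ 3 / ε ^ 2 := by
    rw [one_le_div (by positivity)]
    exact (pow_le_one₀ hε0.le hε1.le).trans (one_le_pow₀ hℒ1)
  have hqℒ : ℒ ≤ ℒ ^ 3 / ε ^ 2 := by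
    rw [le_div_iff₀ (by positivity)]
    have h1 : ε ^ 2 ≤ 1 := pow_le_one₀ hε0.le hε1.le
    have h2 : (1 : ℝ) ≤ ℒ ^ 2 := one_le_pow₀ hℒ1
    calc ℒ * ε ^ 2 ≤ ℒ * ℒ ^ 2 := by gcongr; linarith
      _ = ℒ ^ 3 := by ring
  -- Concentration at scale `ε` for vectors with entries at most `1 / g` has exponent of order `ε² g
  -- ≥ ℒ ^ 3`, and `k` blocks fail with probability `2 ^ (-k)`; both beat `exp (-(2 * ℒ ^ 2))`.
  set g := ⌈ℒ ^ 3 / ε ^ 2⌉₊ with hg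
  set k := ⌈4 * ℒ ^ 2⌉₊ with hk
  have hg1 : ℒ ^ 3 / ε ^ 2 ≤ g := Nat.le_ceil _
  have hg2 : g ≤ 2 * (ℒ ^ 3 / ε ^ 2) := by
    have := (Nat.ceil_lt_add_one (by positivity : 0 ≤ ℒ ^ 3 / ε ^ 2)).le
    linarith
  have hk1 : 4 * ℒ ^ 2 ≤ k := Nat.le_ceil _
  have hk2 : k ≤ 8 * ℒ ^ 2 := by
    have := (Nat.ceil_lt_add_one (by positivity : 0 ≤ 4 * ℒ ^ 2)).le
    nlinarith
  have hg7 : g ^ 7 ≤ n := by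
    -- Squaring the target turns the factor `ε ^ (-14)` of `g ^ 7` into `ε ^ (-28)`, which costs one
    -- factor `n`; the logarithms cost the other.
    have hεn : 1 ≤ n * ε ^ 28 := by
      have h1 : ((n : ℝ) ^ (-(1 / 28) : ℝ)) ^ 28 ≤ ε ^ 28 := pow_le_pow_left₀ (by positivity) hε 28
      rw [← Real.rpow_natCast, ← Real.rpow_mul hn0.le] at h1
      norm_num at h1
      rw [Real.rpow_neg_one] at h1
      have := mul_le_mul_of_nonneg_left h1 hn0.le
      rwa [mul_inv_cancel₀ hn0.ne'] at this
    have h2 : ((g : ℝ) ^ 7) ^ 2 ≤ (n : ℝ) ^ 2 := by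
      calc ((g : ℝ) ^ 7) ^ 2 = g ^ 14 := by ring
        _ ≤ (2 * (ℒ ^ 3 / ε ^ 2)) ^ 14 := by gcongr
        _ = (2 ^ 14 * ℒ ^ 42) / ε ^ 28 := by ring
        _ ≤ n / ε ^ 28 := by gcongr
        _ ≤ n * n := by
          rw [div_le_iff₀ (by positivity)]
          nlinarith
        _ = (n : ℝ) ^ 2 := by ring
    have h3 := le_of_sq_le_sq h2 hn0.le
    exact_mod_cast h3
  have hdev : ∀ v, μ.real {ω | ε / 2 < |DeGroot.opinion P (fun v t => N v t ω) (fun v => f₀ v ω)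
      (k * g ^ 35) v - m|} ≤ (1 / 2) ^ k +
        2 * (2 * Real.exp (-((ε / 4) ^ 2 / (4 * κ * (1 / g)))) +
          2 * Real.exp (-(2 * (ε / 4) ^ 2 / (1 / g)))) := by
    intro v
    have := DeGroot.measureReal_opinion_deviation_le hP hdec hC₀.le hN hf hK
      ((by omega : K ≤ n).trans (Nat.le_self_pow (by norm_num) n)) hKC hg7
      (hl3.trans (hqℒ.trans hg1)) (hl4.trans (hqℒ.trans hg1)) (ε := ε / 4) (by linarith)
      (by linarith) k v
    rwa [show 2 * (ε / 4) = ε / 2 by ring] at this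
  refine (DeGroot.measure_le_consensusTime_le hdev ?_).trans (ENNReal.ofReal_le_ofReal ?_)
  · rw [ENNReal.lt_ofReal_iff_toReal_lt ENNReal.coe_ne_top]
    push_cast
    exact DeGroot.time_lt hε0 hε1 (by linarith) (Nat.cast_nonneg g) hg2 hk2
  · exact DeGroot.mul_deviation_le (Real.exp_log hn0).symm hε0 hκ hl1 (by linarith) hg1 hk1
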